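/- Let $n\ge 1$. For $u=(u_1,\dots,u_{n-1})\in\mathbb R^{n-1}$ put $u_{ij}=u_i+u_{i+1}+\cdots+u_{j-1}$ for $1\le i<j\le n$, $\widetilde\Delta(u)=\prod_{1\le i<j\le n}u_{ij}$, let $t_1,\dots,t_n$ be the real numbers with $t_j-t_{j+1}=u_j$ and $\sum_j t_j=0$, and put $T=\mathrm{diag}(e^{\mathrm i t_1},\dots,e^{\mathrm i t_n})\in \mathrm{SU}(n)$, $\Delta(e^{\mathrm i t})=\prod_{i<j}(e^{\mathrm i t_i}-e^{\mathrm i t_j})$ and $\varpi_n(u)=\prod_{i<j}2\sin(u_{ij}/2)$. For $u$ with no $u_{ij}$ in $2\pi\mathbb Z$, consider the signed lattice sum $$D_n(u)=\sum_{p\in\mathbb Z^{n-1}}(-1)^{(n-1)\sum_j j p_j}\;\frac1{\widetilde\Delta(u+2\pi p)},$$ understood as the limit of the sums over the boxes $\{-N,\dots,N\}^{n-1}$. Then for all such $u$ the sum $D_n(u)$ converges (absolutely if $n\ne2$), and $R_n(T):=D_n(u)\,\varpi_n(u)$ is the value at $(e^{\mathrm i t_1},\dots,e^{\mathrm i t_n})$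 of a symmetric polynomial with real coefficients; $R_n(T)$ denotes this polynomial for every $T$, including those where $\varpi_n=0$. Moreover: 1. There are a finite set $\mathcal K$ of dominant weights of $\mathrm{SU}(n)$, depending only on $n$ and stable under passing to the complex conjugate representation $\kappa\mapsto\bar\kappa$, and rational numbers $r_\kappa$ with $r_{\bar\kappa}=r_\kappa$, such that $R_n(T)=\sum_{\kappa\in\mathcal K}r_\kappa\,\chi_\kappa(T)$ for all $T$, where $\chi_\kappa$ is the character of the irreducible representation of $\mathrm{SU}(n)$ with highest weight $\kappa$. (Thus $R_n$ is a combination of characters of real representations.) 2. $R_n(I)=1$, that is, the polynomial takes the value $1$ at $(1,\dots,1)$ and $\sum_{\kappa\in\mathcal K}r_\kappa\chi_\kappa(I)=1$. 3. Let $\lambda,\mu,\nu\in\mathbb Z^n$ be $\mathrm U(n)$ weights given by their Dynkin components, compatible in the sense that $\sum_{k=1}^n k(\lambda_k+\mu_k-\nu_k)=0$. Let $\ell_i(\lambda)=\sum_{j=i}^n\lambda_j$, let $\rho=(1,\dots,1,0)$ be the Weyl vector, and put $\alpha'=\ell(\lambda+\rho)$, $\beta'=\ell(\mu+\rho)$,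 $\gamma'=\ell(\nu+\rho)$. For permutations $P,P',P''\in S_n$ put $$A_j=\sum_{k=1}^j\bigl(\alpha'_{P(k)}+\beta'_{P'(k)}-\gamma'_{P''(k)}\bigr)-\frac jn\sum_{k=1}^n(\alpha'_k+\beta'_k-\gamma'_k),\qquad 1\le j\le n-1 .$$ Then for all $P,P',P''$ both sides of $$\int_{\mathbb R^{n-1}}\frac{\prod_{j=1}^{n-1}e^{\mathrm i u_jA_j}}{\widetilde\Delta(u)}\,d^{n-1}u=\mathrm i^{\,n(n-1)/2}\int_{(-\pi,\pi)^{n-1}}\prod_{j=1}^{n-1}e^{\mathrm i u_jA_j}\;\frac{R_n(T)}{\Delta(e^{\mathrm i t})}\,d^{n-1}u$$ exist as principal values and are equal. Here the left side is the limit, as $\varepsilon\to0^+$ and $M\to\infty$, of the integrals over $\{u:\ \varepsilon<|u_{ij}|<M\ \text{for all } i<j\}$, and the right-hand integral is the limit, as $\varepsilon\to0^+$, of the integrals over $\{u\in(-\pi,\pi)^{n-1}:\ |e^{\mathrm i t_i}-e^{\mathrm i t_j}|>\varepsilon\ \text{for all } i<j\}$. (The left-hand integrals are those in $$\mathcal J_n(\alpha',\beta';\gamma')=\frac{\mathrm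 i^{-n(n-1)/2}}{2^{n-1}\,n!\,\pi^{n-1}}\sum_{P,P',P''\in S_n}\varepsilon_P\,\varepsilon_{P'}\,\varepsilon_{P''}\int_{\mathbb R^{n-1}}\frac{\prod_{j}e^{\mathrm i u_jA_j}}{\widetilde\Delta(u)}\,d^{n-1}u,$$ where $\varepsilon_P$ is the signature of $P$.) -/

import Mathlib

open Filter Topology MeasureTheory

noncomputable section

namespace Horn

/-! Throughout, `n = m + 1`, the variables `u : Fin m → ℝ` are `u₁, …, u_{n-1}` (so the entry with
index `j : Fin m` is the variable numbered `j + 1`), and indices in `Fin (m + 1)` run over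
`1, …, n` in the same way. -/

/-- The Young components `ℓ_i(λ) = ∑_{j ≥ i} λ_j` of a `U(n)` weight with Dynkin components `λ`. -/
def young {m : ℕ} (wt : Fin (m + 1) → ℤ) (i : Fin (m + 1)) : ℤ :=
  ∑ j : Fin (m + 1) with i ≤ j, wt j

/-- The Weyl vector: Dynkin components `1, …, 1` along the fundamental weights of `SU(n)`, and
`0` for the last component. -/
def weylVector (m : ℕ) : Fin (m + 1) → ℤ :=
  Fin.snoc (α := fun _ => ℤ) (fun _ : Fin m => (1 : ℤ)) 0

/-- A triple of `U(n)` weights is compatible iff `∑_k k (λ_k + μ_k - ν_k) = 0`. -/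
def Compatible {m : ℕ} (wl wm wn : Fin (m + 1) → ℤ) : Prop :=
  ∑ k : Fin (m + 1), ((k.val : ℤ) + 1) * (wl k + wm k - wn k) = 0

/-- The exponents `A_j(P, P', P'')`. -/
def expA {m : ℕ} (a b c : Fin (m + 1) → ℝ) (P P' P'' : Equiv.Perm (Fin (m + 1))) (j : Fin m) : ℝ :=
  (∑ k : Fin (m + 1) with k.val ≤ j.val, (a (P k) + b (P' k) - c (P'' k))) -
    ((j.val : ℝ) + 1) / ((m : ℝ) + 1) * ∑ k : Fin (m + 1), (a k + b k - c k)

/-- `u_i + u_{i+1} + ⋯ + u_{i'-1}`. -/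
def pairSum {m : ℕ} (u : Fin m → ℝ) (i i' : Fin (m + 1)) : ℝ :=
  ∑ k : Fin m with i.val ≤ k.val ∧ k.val < i'.val, u k

/-- The Vandermonde in the variables `u`: `∏_{i < i'} (u_i + ⋯ + u_{i'-1})`. -/
def vandU {m : ℕ} (u : Fin m → ℝ) : ℝ :=
  ∏ i : Fin (m + 1), ∏ i' : Fin (m + 1) with i < i', pairSum u i i'

/-- The numbers `t_i` determined by `t_j - t_{j+1} = u_j` and `∑ t_i = 0`. -/
def tvar {m : ℕ} (u : Fin m → ℝ) (i : Fin (m + 1)) : ℝ :=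
  (∑ k : Fin m with i.val ≤ k.val, u k) -
    (∑ k : Fin m, ((k.val : ℝ) + 1) * u k) / ((m : ℝ) + 1)

theorem tvar_sub {m : ℕ} (u : Fin m → ℝ) {i i' : Fin (m + 1)} (h : i < i') :
    tvar u i - tvar u i' = pairSum u i i' := by
  have hlt : (i : ℕ) < (i' : ℕ) := h
  simp only [tvar, pairSum, Finset.sum_filter, sub_sub_sub_cancel_right]
  rw [← Finset.sum_sub_distrib]
  refine Finset.sum_congr rfl fun k _ => ?_
  split_ifs <;> first | omega | simp

theorem sum_tvar {m : ℕ} (u : Fin m → ℝ) : ∑ i, tvar u i = 0 := by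
  have h1 : ∑ i : Fin (m + 1), ∑ k : Fin m with i.val ≤ k.val, u k =
      ∑ k : Fin m, ((k.val : ℝ) + 1) * u k := by
    simp only [Finset.sum_filter]
    rw [Finset.sum_comm]
    refine Finset.sum_congr rfl fun k _ => ?_
    rw [← Finset.sum_filter, Finset.sum_const, nsmul_eq_mul]
    congr 1
    have : (Finset.univ.filter fun i : Fin (m + 1) => i.val ≤ k.val) =
        Finset.Iic (k.castSucc) := by
      ext i
      simp [Fin.le_def]
    rw [this, Fin.card_Iic]
    simp
  have h2 : ((m : ℝ) + 1) ≠ 0 := by positivity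
  simp only [tvar, Finset.sum_sub_distrib, h1, Finset.sum_const, Finset.card_univ, Fintype.card_fin,
    nsmul_eq_mul]
  push_cast
  field_simp
  ring

/-- The diagonal entries `e^{i t_j}` of the torus element. -/
def torusEntry {m : ℕ} (u : Fin m → ℝ) (j : Fin (m + 1)) : ℂ :=
  Complex.exp (Complex.I * (tvar u j : ℂ))

/-- `Δ(e^{it}) = ∏_{i < j} (e^{i t_i} - e^{i t_j})`. -/
def vandExp {m : ℕ} (u : Fin m → ℝ) : ℂ :=
  ∏ i : Fin (m + 1), ∏ j : Fin (m + 1) with i < j, (torusEntry u i - torusEntry u j)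

/-- `SU(n)` for `n = m + 1`. -/
abbrev SU (m : ℕ) : Type := Matrix.specialUnitaryGroup (Fin (m + 1)) ℂ

/-- The element `T = diag(e^{i t_j})` of the Cartan torus of `SU(n)`. -/
def torus {m : ℕ} (u : Fin m → ℝ) : SU m :=
  ⟨Matrix.diagonal (torusEntry u), by
    have hs : ∀ j, torusEntry u j * star (torusEntry u j) = 1 := by
      intro j
      simp only [torusEntry, Complex.star_def, ← Complex.exp_conj, ← Complex.exp_add, map_mul,
        Complex.conj_I, Complex.conj_ofReal]
      simp
    rw [Matrix.mem_specialUnitaryGroup_iff, Matrix.mem_unitaryGroup_iff]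
    refine ⟨?_, ?_⟩
    · rw [Matrix.star_eq_conjTranspose, Matrix.diagonal_conjTranspose, Matrix.diagonal_mul_diagonal,
        ← Matrix.diagonal_one]
      congr 1
      funext j
      exact hs j
    · rw [Matrix.det_diagonal]
      simp only [torusEntry]
      rw [← Complex.exp_sum, ← Finset.mul_sum, ← Complex.ofReal_sum, sum_tvar]
      simp⟩

/-! ### Irreducible characters of `SU(n)` -/

/-- The value on `t` of the `SU(n)` weight with Dynkin components `wt`:
`∑_i ℓ_i(wt) t_i`, where `ℓ` is computed with `wt_n = 0`. -/
def weightPairing {m : ℕ} (wt : Fin m → ℤ) (u : Fin m → ℝ) : ℝ :=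
  ∑ i : Fin (m + 1), (young (Fin.snoc (α := fun _ => ℤ) wt 0) i : ℝ) * tvar u i

/-- `wt` is a weight of the representation `π`: there is a nonzero vector on which every torus
element `T` acts as the scalar `e^{i ⟨wt, t⟩}`. -/
def IsWeight {m d : ℕ} (π : Representation ℂ (SU m) (Fin d → ℂ)) (wt : Fin m → ℤ) : Prop :=
  ∃ v : Fin d → ℂ, v ≠ 0 ∧ ∀ u : Fin m → ℝ,
    π (torus u) v = Complex.exp (Complex.I * (weightPairing wt u : ℂ)) • v

/-- `κ` is the highest weight of `π`: it is a weight, and every weight is obtained from it by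
subtracting a nonnegative integer combination of the simple roots `t ↦ t_k - t_{k+1} = u_k`. -/
def HasHighestWeight {m d : ℕ} (π : Representation ℂ (SU m) (Fin d → ℂ)) (κ : Fin m → ℕ) : Prop :=
  IsWeight π (fun k => (κ k : ℤ)) ∧
    ∀ wt : Fin m → ℤ, IsWeight π wt → ∃ c : Fin m → ℕ, ∀ u : Fin m → ℝ,
      weightPairing wt u = weightPairing (fun k => (κ k : ℤ)) u - ∑ k, (c k : ℝ) * u k

/-- `χ` is the character `T ↦ tr_{V_κ}(T)` of a continuous irreducible finite-dimensional complex
representation of `SU(n)` with highest weight `κ` (given by its Dynkin components). -/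
def IsIrreducibleCharacter {m : ℕ} (κ : Fin m → ℕ) (χ : SU m → ℂ) : Prop :=
  ∃ (d : ℕ) (π : Representation ℂ (SU m) (Fin d → ℂ)),
    (∀ v, Continuous fun g => π g v) ∧ π.IsIrreducible ∧ HasHighestWeight π κ ∧
      ∀ g, χ g = LinearMap.trace ℂ (Fin d → ℂ) (π g)

/-- The Dynkin components of the highest weight of the complex conjugate representation. -/
def conjWeight {m : ℕ} (κ : Fin m → ℕ) : Fin m → ℕ := fun k => κ k.rev

/-! ### The signed periodization of `1 / Δ̃(u)` -/

/-- `u` lies off the polar hyperplanes of the periodized kernel. -/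
def Regular {m : ℕ} (u : Fin m → ℝ) : Prop :=
  ∀ i i' : Fin (m + 1), i < i' → ∀ k : ℤ, pairSum u i i' ≠ 2 * Real.pi * (k : ℝ)

/-- The term of index `p ∈ ℤ^{n-1}`:
`(-1)^{∑_j j p_j (n-1)} ∏_{i < i'} 1 / (u_i + ⋯ + u_{i'-1} + 2π (p_i + ⋯ + p_{i'-1}))`. -/
def latticeTerm {m : ℕ} (u : Fin m → ℝ) (p : Fin m → ℤ) : ℝ :=
  (-1 : ℝ) ^ (∑ j : Fin m, ((j.val : ℤ) + 1) * p j * (m : ℤ)) *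
    (vandU fun j => u j + 2 * Real.pi * (p j : ℝ))⁻¹

/-- `D` is the value `D_n(u)` of the lattice sum. For `n ≠ 2` the sum converges absolutely; for
`n = 2` it converges conditionally. In all cases its value is the limit of the sums over the boxes
`{-N, …, N}^{n-1}`. -/
def HasLatticeSum {m : ℕ} (u : Fin m → ℝ) (D : ℝ) : Prop :=
  (m + 1 ≠ 2 → Summable (latticeTerm u)) ∧
    Tendsto (fun N : ℕ => ∑ p ∈ Fintype.piFinset fun _ : Fin m => Finset.Icc (-(N : ℤ)) (N : ℤ),
      latticeTerm u p) atTop (𝓝 D)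

/-- `ϖ_n = ∏_{i < i'} 2 sin ((u_i + ⋯ + u_{i'-1}) / 2)`. -/
def varpi {m : ℕ} (u : Fin m → ℝ) : ℝ :=
  ∏ i : Fin (m + 1), ∏ i' : Fin (m + 1) with i < i', 2 * Real.sin (pairSum u i i' / 2)

/-! ### Principal values -/

/-- Principal value over `ℝ^{n-1}` of a function with poles on the hyperplanes
`u_i + ⋯ + u_{i'-1} = 0`: symmetric neighbourhoods of the hyperplanes are cut out, and the integral
is semi-convergent at infinity (the cutoffs are invariant under the Weyl group). -/
def HasPV {m : ℕ} (F : (Fin m → ℝ) → ℂ) (v : ℂ) : Prop :=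
  Tendsto (fun q : ℝ × ℝ =>
      ∫ u in {u : Fin m → ℝ | ∀ i i' : Fin (m + 1), i < i' →
        q.1 < |pairSum u i i'| ∧ |pairSum u i i'| < q.2}, F u)
    (𝓝[>] 0 ×ˢ atTop) (𝓝 v)

/-- Principal value over `(-π, π)^{n-1}` of a function with poles where `e^{i t_i} = e^{i t_{i'}}`:
symmetric neighbourhoods of the polar set are cut out. -/
def HasCompactPV {m : ℕ} (F : (Fin m → ℝ) → ℂ) (v : ℂ) : Prop :=
  Tendsto (fun ε : ℝ =>
      ∫ u in {u : Fin m → ℝ | (∀ j, u j ∈ Set.Ioo (-Real.pi) Real.pi) ∧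
        ∀ i i' : Fin (m + 1), i < i' → ε < ‖torusEntry u i - torusEntry u i'‖}, F u)
    (𝓝[>] 0) (𝓝 v)

/-- `∏_j e^{i u_j A_j}`. -/
def planeWave {m : ℕ} (A : Fin m → ℝ) (u : Fin m → ℝ) : ℂ :=
  ∏ j : Fin m, Complex.exp (Complex.I * ((u j * A j : ℝ) : ℂ))

end Horn

end

noncomputable section

namespace Horn

/-! ### Tail sums and the action of the symmetric group -/

/-! Write S(u) for the product of sinc(u_ij/2) over i < j (`sincProd`). Translating u by 2πp
multiplies ϖ_n(u) by exactly the sign attached to the lattice term of index p. Hence D_n ϖ_n is the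
plain periodization ∑_p S(u + 2πp), in which no pole is left (`latticeTerm_mul_varpi`).

S is the Fourier transform of the box spline of the positive roots, a continuous compactly supported
function that is piecewise polynomial with rational coefficients on rational pieces
(`exists_boxSpline`). Poisson summation turns the periodization into a finite trigonometric sum
whose coefficients are values of the spline at integer points, hence rational
(`exists_trig_polynomial`). S is invariant under permutations of the t_i, so this sum is a symmetric
homogeneous polynomial in the e^{i t_j}. At u = 0 only the term p = 0 survives, which gives the
value 1.

For the expansion, the irreducible representation with a given highest weight is realized on
functions on SU(n), as the cyclic module generated by a product of leading principal minors
(`isIrreducibleCharacter_highestCharacter`). All its weights are dominated by the top one. A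
descending induction on the lexicographic leading monomial, as for elementary symmetric polynomials,
therefore writes a symmetric polynomial with rational coefficients on these characters
(`mem_span_highestCharacter`). Conjugation reverses the Dynkin components, and since R_n is real,
coefficients of conjugate weights can be averaged.

For the integrals, the cut-off regions on ℝ^{n-1} are invariant under S_n and Δ̃ is alternating.
Averaging replaces the plane wave by its alternating sum, which is a bounded multiple χ of Δ(e^{it})
(`exists_alternant_quotient`). The integrand becomes a constant times χ S, integrable when n ≠ 2.
The compact integral unfolds over 2πℤ^{n-1} to the same integral, because compatibility of the
weights makes the plane wave pick up the sign of the lattice sum (`hasPV_wave`,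
`hasCompactPV_wave`).

For n = 2 nothing converges absolutely. There R_n = 1 by the cosecant series, and uniformly bounded
symmetric partial sums replace absolute convergence (`tendsto_sincSum`, `abs_sincSum_le`). -/

/-- The tail sums `∑_{k ≥ i} u_k`, whose differences are the sums `u_i + ⋯ + u_{i'-1}`. -/
def tailSum {m : ℕ} {R : Type*} [AddCommMonoid R] (u : Fin m → R) (i : Fin (m + 1)) : R :=
  ∑ k : Fin m with i.val ≤ k.val, u k

section TailSum

variable {m : ℕ} {R : Type*} [CommRing R]

@[simp] theorem tailSum_last (u : Fin m → R) : tailSum u (Fin.last m) = 0 := by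
  refine Finset.sum_eq_zero fun k hk => ?_
  have := k.isLt
  simp at hk
  omega

theorem tailSum_castSucc (u : Fin m → R) (k : Fin m) :
    tailSum u k.castSucc = u k + tailSum u k.succ := by
  have : (Finset.univ.filter fun j : Fin m => k.castSucc.val ≤ j.val) =
      insert k (Finset.univ.filter fun j : Fin m => k.succ.val ≤ j.val) := by
    ext j
    simp only [Fin.val_castSucc, Fin.val_succ, Finset.mem_filter, Finset.mem_univ, true_and,
      Finset.mem_insert, Fin.ext_iff]
    omega
  rw [tailSum, this, Finset.sum_insert (by simp)]
  rfl

theorem tailSum_castSucc_sub (u : Fin m → R) (k : Fin m) :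
    tailSum u k.castSucc - tailSum u k.succ = u k := by
  rw [tailSum_castSucc]; ring

theorem tailSum_injective : Function.Injective (tailSum : (Fin m → R) → Fin (m + 1) → R) := by
  intro u v h
  funext k
  rw [← tailSum_castSucc_sub u, h, tailSum_castSucc_sub]

theorem tailSum_diff (a : Fin (m + 1) → R) (i : Fin (m + 1)) :
    tailSum (fun k : Fin m => a k.castSucc - a k.succ) i = a i - a (Fin.last m) := by
  induction i using Fin.reverseInduction with
  | last => simp
  | cast k ih => rw [tailSum_castSucc, ih]; ring

theorem tailSum_add (u v : Fin m → R) (i : Fin (m + 1)) :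
    tailSum (u + v) i = tailSum u i + tailSum v i := by
  simp [tailSum, Finset.sum_add_distrib]

theorem tailSum_smul (c : R) (u : Fin m → R) (i : Fin (m + 1)) :
    tailSum (c • u) i = c * tailSum u i := by
  simp [tailSum, Finset.mul_sum]

theorem tailSum_intCast (p : Fin m → ℤ) (i : Fin (m + 1)) :
    tailSum (fun k => (p k : ℝ)) i = (tailSum p i : ℤ) := by
  simp [tailSum]

theorem sum_tailSum (u : Fin m → R) :
    ∑ i : Fin (m + 1), tailSum u i = ∑ k : Fin m, ((k.val : R) + 1) * u k := by
  simp only [tailSum, Finset.sum_filter]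
  rw [Finset.sum_comm]
  refine Finset.sum_congr rfl fun k _ => ?_
  rw [← Finset.sum_filter, Finset.sum_const, nsmul_eq_mul]
  congr 1
  have : (Finset.univ.filter fun i : Fin (m + 1) => i.val ≤ k.val) =
      Finset.Iic (k.castSucc) := by
    ext i
    simp [Fin.le_def]
  rw [this, Fin.card_Iic]
  simp

/-- The action of a permutation of the `t_i` on the variables `u`. -/
def permAct (w : Equiv.Perm (Fin (m + 1))) : (Fin m → R) →ₗ[R] (Fin m → R) where
  toFun u k := tailSum u (w k.castSucc) - tailSum u (w k.succ)
  map_add' u v := by funext k; simp only [tailSum_add, Pi.add_apply]; ring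
  map_smul' c u := by
    funext k; simp only [tailSum_smul, Pi.smul_apply, smul_eq_mul, RingHom.id_apply]; ring

theorem permAct_apply (w : Equiv.Perm (Fin (m + 1))) (u : Fin m → R) (k : Fin m) :
    permAct w u k = tailSum u (w k.castSucc) - tailSum u (w k.succ) := rfl

theorem tailSum_permAct (w : Equiv.Perm (Fin (m + 1))) (u : Fin m → R) (i : Fin (m + 1)) :
    tailSum (permAct w u) i = tailSum u (w i) - tailSum u (w (Fin.last m)) :=
  tailSum_diff (fun i => tailSum u (w i)) i

theorem permAct_permAct (w w' : Equiv.Perm (Fin (m + 1))) (u : Fin m → R) :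
    permAct w (permAct w' u) = permAct (w' * w) u := by
  apply tailSum_injective
  funext i
  simp [tailSum_permAct]

theorem permAct_one (u : Fin m → R) : permAct 1 u = u := by
  apply tailSum_injective
  funext i
  simp [tailSum_permAct]

/-- `permAct` as a linear equivalence. -/
def permActEquiv (w : Equiv.Perm (Fin (m + 1))) : (Fin m → R) ≃ₗ[R] (Fin m → R) :=
  LinearEquiv.ofLinearMap (permAct w) (permAct w⁻¹)
    (by ext1 x; ext; simp [permAct_permAct, permAct_one])
    (by ext1 x; ext; simp [permAct_permAct, permAct_one])

@[simp] theorem permActEquiv_apply (w : Equiv.Perm (Fin (m + 1))) (u : Fin m → R) :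
    permActEquiv w u = permAct w u := rfl

theorem permAct_intCast (w : Equiv.Perm (Fin (m + 1))) (p : Fin m → ℤ) :
    permAct w (fun k => (p k : ℝ)) = fun k => ((permAct w p k : ℤ) : ℝ) := by
  funext k
  simp [permAct_apply, tailSum_intCast]

theorem permAct_pow (w : Equiv.Perm (Fin (m + 1))) (k : ℕ) :
    (permAct w : (Fin m → R) →ₗ[R] (Fin m → R)) ^ k = permAct (w ^ k) := by
  induction k with
  | zero => apply LinearMap.ext; intro u; simp [permAct_one]
  | succ k ih =>
    apply LinearMap.ext
    intro u
    rw [pow_succ, ih, Module.End.mul_apply, permAct_permAct, pow_succ']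

/-- A permutation has finite order, so the determinant is a root of unity. This makes the action
measure preserving without computing its matrix. -/
theorem abs_det_permAct (w : Equiv.Perm (Fin (m + 1))) :
    |LinearMap.det (permAct w : (Fin m → ℝ) →ₗ[ℝ] (Fin m → ℝ))| = 1 := by
  have h : (LinearMap.det (permAct w : (Fin m → ℝ) →ₗ[ℝ] (Fin m → ℝ))) ^ orderOf w = 1 := by
    rw [← map_pow, permAct_pow, pow_orderOf_eq_one]
    have : (permAct 1 : (Fin m → ℝ) →ₗ[ℝ] (Fin m → ℝ)) = 1 := LinearMap.ext permAct_one
    rw [this, map_one]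
  have h2 := congrArg abs h
  rw [abs_pow, abs_one] at h2
  exact (pow_eq_one_iff_of_nonneg (abs_nonneg _) (orderOf_pos w).ne').1 h2

theorem measurePreserving_permAct (w : Equiv.Perm (Fin (m + 1))) :
    MeasurePreserving (permAct w : (Fin m → ℝ) → (Fin m → ℝ)) volume volume := by
  refine ⟨(LinearMap.continuous_of_finiteDimensional _).measurable, ?_⟩
  have hd : LinearMap.det (permAct w : (Fin m → ℝ) →ₗ[ℝ] (Fin m → ℝ)) ≠ 0 := by
    intro h
    have := abs_det_permAct w
    rw [h] at this
    simp at this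
  rw [Real.map_linearMap_volume_pi_eq_smul_volume_pi hd, abs_inv, abs_det_permAct]
  simp

theorem measurableEmbedding_permAct (w : Equiv.Perm (Fin (m + 1))) :
    MeasurableEmbedding (permAct w : (Fin m → ℝ) → (Fin m → ℝ)) :=
  (permActEquiv w : (Fin m → ℝ) ≃ₗ[ℝ] (Fin m → ℝ)).toContinuousLinearEquiv.toHomeomorph.measurableEmbedding

end TailSum

/-! ### Products over pairs, Vandermonde products and torus coordinates. -/

section Pairs

variable {m : ℕ} {R : Type*} [CommRing R]

theorem pairSum_eq {u : Fin m → ℝ} {i i' : Fin (m + 1)} (h : i < i') :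
    pairSum u i i' = tailSum u i - tailSum u i' := by
  rw [← tvar_sub u h]
  simp [tvar, tailSum]

/-- Products over the pairs `i < i'`. -/
def pairProd (F : Fin (m + 1) → Fin (m + 1) → R) : R :=
  ∏ i : Fin (m + 1), ∏ i' : Fin (m + 1) with i < i', F i i'

theorem pairProd_congr {F G : Fin (m + 1) → Fin (m + 1) → R} (h : ∀ i i', i < i' → F i i' = G i i') :
    pairProd F = pairProd G :=
  Finset.prod_congr rfl fun i _ => Finset.prod_congr rfl fun i' hi' => h i i' (by simpa using hi')

theorem pairProd_mul (F G : Fin (m + 1) → Fin (m + 1) → R) :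
    pairProd (fun i i' => F i i' * G i i') = pairProd F * pairProd G := by
  simp [pairProd, Finset.prod_mul_distrib]

theorem pairProd_perm_antisymm (w : Equiv.Perm (Fin (m + 1))) {F : Fin (m + 1) → Fin (m + 1) → R}
    (hF : ∀ i j, F i j = -F j i) :
    pairProd (fun i j => F (w i) (w j)) = (Equiv.Perm.sign w : ℤ) * pairProd F := by
  have := w.prod_Ioi_comp_eq_sign_mul_prod hF
  simpa [pairProd, Finset.filter_lt_eq_Ioi] using this

/-- Multiplying F by the antisymmetric sign function s, whose product over pairs is 1, reduces this
to the antisymmetric case; the two signatures cancel. -/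
theorem pairProd_perm_symm (w : Equiv.Perm (Fin (m + 1))) {F : Fin (m + 1) → Fin (m + 1) → R}
    (hF : ∀ i j, F i j = F j i) :
    pairProd (fun i j => F (w i) (w j)) = pairProd F := by
  let s : Fin (m + 1) → Fin (m + 1) → R := fun i j => if i < j then 1 else if j < i then -1 else 0
  have hs : ∀ i j, s i j = -s j i := by
    intro i j
    simp only [s]
    rcases lt_trichotomy i j with h | h | h
    · simp [h, h.not_gt]
    · simp [h]
    · simp [h, h.not_gt]
  have h1 : pairProd s = 1 :=
    Finset.prod_eq_one fun i _ => Finset.prod_eq_one fun j hj => by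
      simp only [Finset.mem_filter, Finset.mem_univ, true_and] at hj
      simp [s, hj]
  have h2 := pairProd_perm_antisymm w hs
  have h3 := pairProd_perm_antisymm w (F := fun i j => F i j * s i j)
    (fun i j => by rw [hs i j, hF i j]; ring)
  rw [pairProd_mul, pairProd_mul, h1, h2, h1, mul_one, mul_one, mul_comm] at h3
  have hu : IsUnit ((Equiv.Perm.sign w : ℤ) : R) := by
    rcases Int.units_eq_one_or (Equiv.Perm.sign w) with h | h <;> simp [h]
  exact hu.mul_left_cancel h3

/-- Every index belongs to exactly m pairs. -/
theorem sum_pairs_add {R : Type*} [CommRing R] (t : Fin (m + 1) → R) :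
    ∑ i : Fin (m + 1), ∑ i' : Fin (m + 1) with i < i', (t i + t i') = m * ∑ i, t i := by
  have hsplit : ∀ i, ∑ i' : Fin (m + 1) with i < i', (t i + t i') =
      (m - i.val : R) * t i + ∑ i' : Fin (m + 1) with i < i', t i' := by
    intro i
    rw [Finset.sum_add_distrib, Finset.sum_const, Finset.filter_lt_eq_Ioi, Fin.card_Ioi,
      nsmul_eq_mul, Nat.cast_sub (by omega)]
    simp
  have hcomm : ∑ i : Fin (m + 1), ∑ i' : Fin (m + 1) with i < i', t i' =
      ∑ i' : Fin (m + 1), (i'.val : R) * t i' := by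
    simp only [Finset.sum_filter]
    rw [Finset.sum_comm]
    refine Finset.sum_congr rfl fun i' _ => ?_
    rw [← Finset.sum_filter, Finset.sum_const, Finset.filter_gt_eq_Iio, Fin.card_Iio, nsmul_eq_mul]
  simp_rw [hsplit]
  rw [Finset.sum_add_distrib, hcomm, ← Finset.sum_add_distrib, Finset.mul_sum]
  exact Finset.sum_congr rfl fun i _ => by ring

theorem pairProd_const (c : R) : pairProd (fun _ _ : Fin (m + 1) => c) = c ^ ((m + 1) * m / 2) := by
  simp only [pairProd, Finset.prod_const, Finset.prod_pow_eq_pow_sum]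
  congr 1
  simp only [Finset.filter_lt_eq_Ioi, Fin.card_Ioi]
  have h1 : ∑ i : Fin (m + 1), (m + 1 - 1 - (i : ℕ)) = ∑ i ∈ Finset.range (m + 1), (m + 1 - 1 - i) :=
    Fin.sum_univ_eq_sum_range (fun i => m + 1 - 1 - i) (m + 1)
  rw [h1, Finset.sum_range_reflect (fun i => i), Finset.sum_range_id]
  simp

theorem pairSum_permAct (w : Equiv.Perm (Fin (m + 1))) (u : Fin m → ℝ) {i i' : Fin (m + 1)}
    (h : i < i') : pairSum (permAct w u) i i' = tailSum u (w i) - tailSum u (w i') := by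
  rw [pairSum_eq h, tailSum_permAct, tailSum_permAct]; ring

theorem pairProd_even_permAct (w : Equiv.Perm (Fin (m + 1))) (u : Fin m → ℝ) {g : ℝ → ℝ}
    (hg : ∀ x, g (-x) = g x) :
    pairProd (fun i i' => g (pairSum (permAct w u) i i')) = pairProd fun i i' => g (pairSum u i i') := by
  rw [pairProd_congr (G := fun i i' => g (tailSum u (w i) - tailSum u (w i')))
    (fun i i' h => by rw [pairSum_permAct w u h]),
    pairProd_perm_symm w (F := fun i i' => g (tailSum u i - tailSum u i'))
    (fun i j => by rw [← hg, neg_sub])]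
  exact pairProd_congr fun i i' h => by rw [pairSum_eq h]

theorem vandU_eq_pairProd (u : Fin m → ℝ) : vandU u = pairProd (pairSum u) := rfl

theorem varpi_eq_pairProd (u : Fin m → ℝ) :
    varpi u = pairProd fun i i' => 2 * Real.sin (pairSum u i i' / 2) := rfl

theorem vandU_permAct (w : Equiv.Perm (Fin (m + 1))) (u : Fin m → ℝ) :
    vandU (permAct w u) = (Equiv.Perm.sign w : ℤ) * vandU u := by
  rw [vandU_eq_pairProd, vandU_eq_pairProd,
    pairProd_congr (fun i i' h => pairSum_permAct w u h),
    pairProd_perm_antisymm w (F := fun i i' => tailSum u i - tailSum u i') (fun i j => by ring),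
    pairProd_congr (fun i i' h => (pairSum_eq (u := u) h).symm)]

theorem forall_pairs_permAct {S : ℝ → Prop} (hS : ∀ x, S (-x) → S x) (w : Equiv.Perm (Fin (m + 1)))
    {u : Fin m → ℝ} (h : ∀ i i' : Fin (m + 1), i < i' → S (pairSum u i i')) :
    ∀ i i' : Fin (m + 1), i < i' → S (pairSum (permAct w u) i i') := by
  intro i i' hi
  rw [pairSum_permAct w u hi]
  rcases lt_or_gt_of_ne (w.injective.ne hi.ne) with h1 | h1
  · rw [← pairSum_eq h1]; exact h _ _ h1
  · apply hS
    rw [neg_sub, ← pairSum_eq h1]; exact h _ _ h1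

theorem tvar_eq (u : Fin m → ℝ) (i : Fin (m + 1)) :
    tvar u i = tailSum u i - (∑ k : Fin m, ((k.val : ℝ) + 1) * u k) / ((m : ℝ) + 1) := rfl

/-- Tail sums are equivariant only up to a constant independent of i; the normalization ∑ t_i = 0
forces that constant to vanish for the t_i. -/
theorem tvar_permAct (w : Equiv.Perm (Fin (m + 1))) (u : Fin m → ℝ) (i : Fin (m + 1)) :
    tvar (permAct w u) i = tvar u (w i) := by
  obtain ⟨c, hc⟩ : ∃ c, ∀ i, tvar (permAct w u) i = tvar u (w i) + c := by
    refine ⟨tvar (permAct w u) (Fin.last m) - tvar u (w (Fin.last m)), fun i => ?_⟩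
    simp only [tvar_eq, tailSum_permAct]
    ring
  have h1 := sum_tvar (permAct w u)
  simp_rw [hc] at h1
  rw [Finset.sum_add_distrib, Equiv.sum_comp w (fun i => tvar u i), sum_tvar] at h1
  simp at h1
  rw [hc, (h1.resolve_left (by positivity)), add_zero]

theorem torusEntry_permAct (w : Equiv.Perm (Fin (m + 1))) (u : Fin m → ℝ) (i : Fin (m + 1)) :
    torusEntry (permAct w u) i = torusEntry u (w i) := by
  simp [torusEntry, tvar_permAct]

theorem prod_torusEntry (u : Fin m → ℝ) : ∏ i, torusEntry u i = 1 := by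
  simp only [torusEntry]
  rw [← Complex.exp_sum, ← Finset.mul_sum, ← Complex.ofReal_sum, sum_tvar]
  simp

theorem norm_torusEntry (u : Fin m → ℝ) (i : Fin (m + 1)) : ‖torusEntry u i‖ = 1 := by
  rw [torusEntry, mul_comm, Complex.norm_exp_ofReal_mul_I]

theorem torusEntry_sub (u : Fin m → ℝ) {i j : Fin (m + 1)} (h : i < j) :
    torusEntry u i - torusEntry u j =
      Complex.exp (Complex.I * ((tvar u i + tvar u j : ℝ) : ℂ) / 2) *
        (Complex.I * ((2 * Real.sin (pairSum u i j / 2) : ℝ) : ℂ)) := by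
  rw [← tvar_sub u h]
  push_cast
  rw [Complex.sin, torusEntry, torusEntry]
  have e1 : Complex.I * (tvar u i : ℂ) = Complex.I * ((tvar u i : ℂ) + tvar u j) / 2 +
      ((tvar u i : ℂ) - tvar u j) / 2 * Complex.I := by ring
  have e2 : Complex.I * (tvar u j : ℂ) = Complex.I * ((tvar u i : ℂ) + tvar u j) / 2 +
      -(((tvar u i : ℂ) - tvar u j) / 2) * Complex.I := by ring
  rw [e1, e2, Complex.exp_add, Complex.exp_add]
  linear_combination (Complex.exp (Complex.I * ((tvar u i : ℂ) + tvar u j) / 2) *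
    (Complex.exp (((tvar u i : ℂ) - tvar u j) / 2 * Complex.I) -
      Complex.exp (-(((tvar u i : ℂ) - tvar u j) / 2) * Complex.I))) * Complex.I_sq

theorem norm_torusEntry_sub (u : Fin m → ℝ) {i j : Fin (m + 1)} (h : i < j) :
    ‖torusEntry u i - torusEntry u j‖ = 2 * |Real.sin (pairSum u i j / 2)| := by
  rw [torusEntry_sub u h, norm_mul, norm_mul, Complex.norm_I, Complex.norm_real]
  have : Complex.I * ((tvar u i + tvar u j : ℝ) : ℂ) / 2 =
      (((tvar u i + tvar u j) / 2 : ℝ) : ℂ) * Complex.I := by push_cast; ring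
  rw [this, Complex.norm_exp_ofReal_mul_I]
  simp

/-- Each difference is a half-angle phase e^{i(t_i+t_j)/2} times 2i sin(u_ij/2). The phases multiply
to 1 because ∑ t_i = 0, and the factors i that remain are the power of i in the statement. -/
theorem vandExp_eq (u : Fin m → ℝ) :
    vandExp u = Complex.I ^ ((m + 1) * m / 2) * (varpi u : ℂ) := by
  have h0 : vandExp u = pairProd fun i j => torusEntry u i - torusEntry u j := rfl
  rw [h0, pairProd_congr (fun i j h => torusEntry_sub u h), pairProd_mul, pairProd_mul,
    pairProd_const]
  have h1 : pairProd (fun i j : Fin (m + 1) =>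
      Complex.exp (Complex.I * ((tvar u i + tvar u j : ℝ) : ℂ) / 2)) = 1 := by
    simp only [pairProd, ← Complex.exp_sum]
    have h2 := sum_pairs_add (tvar u)
    rw [sum_tvar, mul_zero] at h2
    simp_rw [mul_div_assoc]
    simp_rw [← Finset.mul_sum, ← Finset.sum_div, ← Complex.ofReal_sum]
    rw [h2]
    simp
  rw [h1, one_mul]
  congr 1
  simp [varpi, pairProd]

end Pairs

/-! ### Lattice translates, the sinc product and plane waves. -/

section Lattice

variable {m : ℕ}

/-- The product of the functions `sinc (u_{ij} / 2)`. -/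
def sincProd (u : Fin m → ℝ) : ℝ := pairProd fun i i' => Real.sinc (pairSum u i i' / 2)

theorem sincProd_permAct (w : Equiv.Perm (Fin (m + 1))) (u : Fin m → ℝ) :
    sincProd (permAct w u) = sincProd u :=
  pairProd_even_permAct w u (g := fun x => Real.sinc (x / 2)) fun x => by rw [neg_div, Real.sinc_neg]

/-- The translate of `u` by the lattice vector `2πp`. -/
def shift (u : Fin m → ℝ) (p : Fin m → ℤ) : Fin m → ℝ := fun j => u j + 2 * Real.pi * (p j : ℝ)

theorem tailSum_shift (u : Fin m → ℝ) (p : Fin m → ℤ) (i : Fin (m + 1)) :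
    tailSum (shift u p) i = tailSum u i + 2 * Real.pi * (tailSum p i : ℤ) := by
  have : shift u p = u + (2 * Real.pi) • fun k => (p k : ℝ) := by
    funext k; simp [shift]
  rw [this, tailSum_add, tailSum_smul, tailSum_intCast]

theorem permAct_shift (w : Equiv.Perm (Fin (m + 1))) (u : Fin m → ℝ) (p : Fin m → ℤ) :
    permAct w (shift u p) = shift (permAct w u) (permAct w p) := by
  funext k
  simp only [permAct_apply, tailSum_shift, shift]
  push_cast
  ring

theorem pairSum_shift (u : Fin m → ℝ) (p : Fin m → ℤ) {i i' : Fin (m + 1)} (h : i < i') :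
    pairSum (shift u p) i i' =
      pairSum u i i' + 2 * Real.pi * ((tailSum p i - tailSum p i' : ℤ) : ℝ) := by
  rw [pairSum_eq h, pairSum_eq h, tailSum_shift, tailSum_shift]
  push_cast
  ring

theorem Regular.shift_ne {u : Fin m → ℝ} (hu : Regular u) (p : Fin m → ℤ) {i i' : Fin (m + 1)}
    (h : i < i') : pairSum (shift u p) i i' ≠ 0 := by
  rw [pairSum_shift u p h]
  intro h0
  apply hu i i' h (-(tailSum p i - tailSum p i'))
  push_cast at h0 ⊢
  linarith

/-- A difference has the parity of the corresponding sum, so `sum_pairs_add` applies. The sign in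
the lattice sum is thus the product over pairs of (-1)^{p_ij}, which is the sign that the sines
acquire under translation. -/
theorem neg_one_zpow_sum_pairs (p : Fin m → ℤ) :
    pairProd (fun i i' : Fin (m + 1) => (-1 : ℝ) ^ (tailSum p i - tailSum p i')) =
      (-1) ^ (∑ j : Fin m, ((j.val : ℤ) + 1) * p j * (m : ℤ)) := by
  have h1 : pairProd (fun i i' : Fin (m + 1) => (-1 : ℝ) ^ (tailSum p i - tailSum p i')) =
      pairProd (fun i i' : Fin (m + 1) => (-1 : ℝ) ^ (tailSum p i + tailSum p i')) :=
    pairProd_congr fun i i' _ => by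
      rw [zpow_sub₀ (by norm_num), zpow_add₀ (by norm_num), div_eq_mul_inv, ← inv_zpow]
      norm_num
  have h2 : ∀ (s : Finset (Fin (m + 1))) (f : Fin (m + 1) → ℤ),
      ∏ i ∈ s, (-1 : ℝ) ^ f i = (-1) ^ ∑ i ∈ s, f i := by
    intro s f
    induction s using Finset.cons_induction with
    | empty => simp
    | cons a s ha ih => rw [Finset.prod_cons, Finset.sum_cons, ih, zpow_add₀ (by norm_num)]
  rw [h1, pairProd]
  simp_rw [h2]
  rw [sum_pairs_add, sum_tailSum, Finset.mul_sum]
  congr 1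
  exact Finset.sum_congr rfl fun j _ => by ring

theorem sinc_half (x : ℝ) (hx : x ≠ 0) : Real.sinc (x / 2) = 2 * Real.sin (x / 2) * x⁻¹ := by
  rw [Real.sinc_of_ne_zero (by simpa using hx)]
  field_simp

theorem sincProd_eq {u : Fin m → ℝ} (hu : ∀ i i' : Fin (m + 1), i < i' → pairSum u i i' ≠ 0) :
    sincProd u = varpi u * (vandU u)⁻¹ := by
  rw [sincProd, pairProd_congr fun i i' h => sinc_half _ (hu i i' h), pairProd_mul, varpi, vandU]
  simp [pairProd]

theorem varpi_shift (u : Fin m → ℝ) (p : Fin m → ℤ) : varpi (shift u p) =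
    (-1) ^ (∑ j : Fin m, ((j.val : ℤ) + 1) * p j * (m : ℤ)) * varpi u := by
  rw [← neg_one_zpow_sum_pairs, varpi_eq_pairProd, varpi_eq_pairProd, ← pairProd_mul]
  refine pairProd_congr fun i i' h => ?_
  rw [pairSum_shift u p h]
  have : (pairSum u i i' + 2 * Real.pi * ((tailSum p i - tailSum p i' : ℤ) : ℝ)) / 2 =
      pairSum u i i' / 2 + ((tailSum p i - tailSum p i' : ℤ) : ℝ) * Real.pi := by ring
  rw [this, Real.sin_add_int_mul_pi]
  ring

/-- The sign of the term and the sign of the translated ϖ cancel: the singular signed sum becomes an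
unsigned periodization of a continuous function. -/
theorem latticeTerm_mul_varpi {u : Fin m → ℝ} (hu : Regular u) (p : Fin m → ℤ) :
    latticeTerm u p * varpi u = sincProd (shift u p) := by
  rw [sincProd_eq fun i i' h => hu.shift_ne p h, varpi_shift, latticeTerm]
  change _ * (vandU (shift u p))⁻¹ * _ = _
  ring

theorem Regular.varpi_ne_zero {u : Fin m → ℝ} (hu : Regular u) : varpi u ≠ 0 := by
  refine Finset.prod_ne_zero_iff.2 fun i _ => Finset.prod_ne_zero_iff.2 fun i' hi' => ?_
  simp only [Finset.mem_filter, Finset.mem_univ, true_and] at hi'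
  refine mul_ne_zero two_ne_zero fun h => ?_
  rw [Real.sin_eq_zero_iff] at h
  obtain ⟨k, hk⟩ := h
  exact hu i i' hi' k (by linarith)

/-- Summation by parts for the exponents `A_j`. -/
theorem sum_mul_tvar (x : Fin (m + 1) → ℝ) (u : Fin m → ℝ) :
    ∑ j : Fin m, u j * ((∑ k : Fin (m + 1) with k.val ≤ j.val, x k) -
      ((j.val : ℝ) + 1) / ((m : ℝ) + 1) * ∑ k, x k) = ∑ k, x k * tvar u k := by
  have h1 : ∑ j : Fin m, u j * ∑ k : Fin (m + 1) with k.val ≤ j.val, x k =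
      ∑ k, x k * tailSum u k := by
    simp only [tailSum, Finset.mul_sum, Finset.sum_filter, mul_ite, mul_zero]
    rw [Finset.sum_comm]
    simp only [mul_comm]
  simp_rw [tvar_eq, mul_sub]
  rw [Finset.sum_sub_distrib, Finset.sum_sub_distrib, h1, ← Finset.sum_mul, Finset.sum_div,
    Finset.mul_sum]
  congr 1
  exact Finset.sum_congr rfl fun j _ => by ring

/-- In the variables t_k the symmetric group acts by permuting coordinates, which the exponents A_j
hide. -/
theorem planeWave_eq (x : Fin (m + 1) → ℝ) (u : Fin m → ℝ) :
    planeWave (fun j : Fin m => (∑ k : Fin (m + 1) with k.val ≤ j.val, x k) -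
      ((j.val : ℝ) + 1) / ((m : ℝ) + 1) * ∑ k, x k) u =
    Complex.exp (Complex.I * ((∑ k, x k * tvar u k : ℝ) : ℂ)) := by
  rw [planeWave, ← Complex.exp_sum, ← Finset.mul_sum, ← Complex.ofReal_sum, sum_mul_tvar]

end Lattice

end Horn

end

noncomputable section

namespace Horn

/-! ### Decay, summation and integration of products over pairs -/

/-- The product of the weights `(1 + |u_{ij}|)⁻¹`. -/
def decayProd {m : ℕ} (u : Fin m → ℝ) : ℝ := pairProd fun i i' => (1 + |pairSum u i i'|)⁻¹

/-- The product of the weights `(1 + |u_{in}|)^{-3/2}`. -/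
def starProd {m : ℕ} (u : Fin m → ℝ) : ℝ :=
  ∏ k : Fin m, (1 + |tailSum u k.castSucc|) ^ (-(3 / 2) : ℝ)

theorem pairProd_nonneg {m : ℕ} {F : Fin (m + 1) → Fin (m + 1) → ℝ}
    (h : ∀ i i', i < i' → 0 ≤ F i i') : 0 ≤ pairProd F :=
  Finset.prod_nonneg fun i _ => Finset.prod_nonneg fun i' hi' => h i i' (by simpa using hi')

theorem pairProd_mono {m : ℕ} {F G : Fin (m + 1) → Fin (m + 1) → ℝ}
    (h0 : ∀ i i', i < i' → 0 ≤ F i i') (h : ∀ i i', i < i' → F i i' ≤ G i i') :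
    pairProd F ≤ pairProd G :=
  Finset.prod_le_prod (fun i _ => Finset.prod_nonneg fun i' hi' => h0 i i' (by simpa using hi'))
    fun i _ => Finset.prod_le_prod (fun i' hi' => h0 i i' (by simpa using hi'))
      fun i' hi' => h i i' (by simpa using hi')

theorem abs_pairProd {m : ℕ} (F : Fin (m + 1) → Fin (m + 1) → ℝ) :
    |pairProd F| = pairProd fun i i' => |F i i'| := by
  simp [pairProd, Finset.abs_prod]

theorem decayProd_nonneg {m : ℕ} (u : Fin m → ℝ) : 0 ≤ decayProd u :=
  pairProd_nonneg fun i i' _ => by positivity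

theorem starProd_nonneg {m : ℕ} (u : Fin m → ℝ) : 0 ≤ starProd u :=
  Finset.prod_nonneg fun i _ => by positivity

theorem pairProd_sq_eq {m : ℕ} {F : Fin (m + 1) → Fin (m + 1) → ℝ} (hF : ∀ i j, F i j = F j i)
    (h1 : ∀ i, F i i = 1) : pairProd F ^ 2 = ∏ i, ∏ j, F i j := by
  have h := Finset.prod_prod_Ioi_mul_eq_prod_prod_off_diag F
  have h2 : ∀ i, ∏ j ∈ ({i}ᶜ : Finset (Fin (m + 1))), F j i = ∏ j, F i j := by
    intro i
    rw [← Finset.prod_compl_mul_prod {i} (fun j => F i j)]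
    simp [h1, hF i]
  simp_rw [h2] at h
  rw [← h, sq, ← pairProd_mul]
  simp only [pairProd, Finset.filter_lt_eq_Ioi]
  exact Finset.prod_congr rfl fun i _ => Finset.prod_congr rfl fun j _ => by rw [hF i j]

/-- A product over all pairs is bounded by one of its stars. -/
theorem decayProd_le_star {m : ℕ} (hm : 2 ≤ m) (u : Fin m → ℝ) :
    decayProd u ≤ ∑ i, starProd (permAct (Equiv.swap i (Fin.last m)) u) := by
  set F : Fin (m + 1) → Fin (m + 1) → ℝ := fun i j => (1 + |tailSum u i - tailSum u j|)⁻¹ with hFdef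
  have hF : ∀ i j, F i j = F j i := fun i j => by simp only [hFdef, abs_sub_comm]
  have hF0 : ∀ i j, 0 < F i j := fun i j => by simp only [hFdef]; positivity
  have hF1 : ∀ i j, F i j ≤ 1 := fun i j => by
    simp only [hFdef]
    exact inv_le_one_of_one_le₀ (by linarith [abs_nonneg (tailSum u i - tailSum u j)])
  have hP : decayProd u = pairProd F :=
    pairProd_congr fun i i' h => by simp only [hFdef, pairSum_eq h]
  have hsq := pairProd_sq_eq hF (fun i => by simp [hFdef])
  set s : Fin (m + 1) → ℝ := fun i => ∏ j, F i j with hs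
  have hs0 : ∀ i, 0 < s i := fun i => Finset.prod_pos fun j _ => hF0 i j
  have hs1 : ∀ i, s i ≤ 1 := fun i => Finset.prod_le_one (fun j _ => (hF0 i j).le) fun j _ => hF1 i j
  have hstar : ∀ i, starProd (permAct (Equiv.swap i (Fin.last m)) u) = s i ^ (3 / 2 : ℝ) := by
    intro i
    have h1 : s i = ∏ k : Fin m, F i (Equiv.swap i (Fin.last m) k.castSucc) := by
      simp only [hs]
      rw [← Equiv.prod_comp (Equiv.swap i (Fin.last m)), Fin.prod_univ_castSucc]
      simp [hFdef]
    rw [h1, ← Real.finsetProd_rpow _ _ (fun k _ => (hF0 _ _).le), starProd]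
    refine Finset.prod_congr rfl fun k _ => ?_
    rw [tailSum_permAct, Equiv.swap_apply_right]
    simp only [hFdef]
    rw [abs_sub_comm, Real.inv_rpow (by positivity), Real.rpow_neg (by positivity)]
  -- The product of all stars s i is the square of the pair product, so the largest star satisfies
  -- this. Since s i ≤ 1 and m + 1 ≥ 3, the pair product is at most s i ^ (3/2), and the exponent
  -- 3/2 > 1 gives convergence. This is where n ≥ 3 enters.
  obtain ⟨i, hi⟩ : ∃ i, pairProd F ^ 2 ≤ s i ^ (m + 1) := by
    by_contra! hcon
    have h1 : ∏ i, s i ^ (m + 1) < ∏ _i : Fin (m + 1), pairProd F ^ 2 :=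
      Finset.prod_lt_prod_of_nonempty (fun i _ => pow_pos (hs0 i) _) (fun i _ => hcon i)
        Finset.univ_nonempty
    rw [Finset.prod_pow, ← hsq] at h1
    simp at h1
  have h3 : pairProd F ^ 2 ≤ (s i ^ (3 / 2 : ℝ)) ^ 2 := by
    have : (s i ^ (3 / 2 : ℝ)) ^ 2 = s i ^ 3 := by
      rw [← Real.rpow_natCast, ← Real.rpow_mul (hs0 i).le, ← Real.rpow_natCast]
      norm_num
    rw [this]
    exact hi.trans (pow_le_pow_of_le_one (hs0 i).le (hs1 i) (by omega))
  have h4 := abs_le_of_sq_le_sq h3 (by have := hs0 i; positivity)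
  calc decayProd u ≤ s i ^ (3 / 2 : ℝ) := by rw [hP]; exact (le_abs_self _).trans h4
    _ = starProd (permAct (Equiv.swap i (Fin.last m)) u) := (hstar i).symm
    _ ≤ _ := Finset.single_le_sum
      (f := fun i => starProd (permAct (Equiv.swap i (Fin.last m)) u))
      (fun i _ => starProd_nonneg _) (Finset.mem_univ i)

/-- A finite set of tuples lies in a product of finite sets, over which the sum factors. -/
theorem summable_prod_pi {ι α : Type*} [Fintype ι] [DecidableEq ι] {f : α → ℝ} (hf0 : ∀ x, 0 ≤ f x)
    (hf : Summable f) : Summable fun q : ι → α => ∏ k, f (q k) := by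
  classical
  refine summable_of_sum_le (c := ∏ _k : ι, ∑' x, f x)
    (fun q => Finset.prod_nonneg fun k _ => hf0 _) fun u => ?_
  calc ∑ q ∈ u, ∏ k, f (q k)
      ≤ ∑ q ∈ Fintype.piFinset (fun k => u.image fun q => q k), ∏ k, f (q k) := by
        refine Finset.sum_le_sum_of_subset_of_nonneg (fun q hq => ?_)
          fun q _ _ => Finset.prod_nonneg fun k _ => hf0 _
        rw [Fintype.mem_piFinset]
        exact fun k => Finset.mem_image_of_mem _ hq
    _ = ∏ k, ∑ x ∈ u.image (fun q => q k), f x := (Finset.prod_univ_sum _ _).symm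
    _ ≤ _ := Finset.prod_le_prod (fun k _ => Finset.sum_nonneg fun x _ => hf0 x)
        fun k _ => hf.sum_le_tsum _ fun x _ => hf0 x

theorem summable_int_decay : Summable fun k : ℤ => (1 + |(k : ℝ)|) ^ (-(3 / 2) : ℝ) := by
  have h : Summable fun n : ℕ => (1 + (n : ℝ)) ^ (-(3 / 2) : ℝ) := by
    have := (summable_nat_add_iff 1).2
      (Real.summable_nat_rpow (p := -(3 / 2)) |>.2 (by norm_num))
    refine this.congr fun n => ?_
    push_cast
    rw [add_comm]
  refine Summable.of_nat_of_neg ?_ ?_ <;> simpa using h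

/-- In the tail sums as new lattice coordinates the star is a product of functions of one variable.
-/
theorem summable_starProd {m : ℕ} : Summable fun p : Fin m → ℤ => starProd fun k => (p k : ℝ) := by
  have h := summable_prod_pi (ι := Fin m) (f := fun k : ℤ => (1 + |(k : ℝ)|) ^ (-(3 / 2) : ℝ))
    (fun x => by positivity) summable_int_decay
  have hinj : Function.Injective fun (p : Fin m → ℤ) (k : Fin m) => tailSum p k.castSucc := by
    intro p q hpq
    apply tailSum_injective
    funext i
    induction i using Fin.lastCases with
    | last => simp
    | cast k => exact congrFun hpq k
  refine (h.comp_injective hinj).congr fun p => ?_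
  simp [starProd, tailSum_intCast]

theorem summable_decayProd {m : ℕ} (hm : 2 ≤ m) :
    Summable fun p : Fin m → ℤ => decayProd fun k => (p k : ℝ) := by
  have h : Summable fun p : Fin m → ℤ =>
      ∑ i, starProd (permAct (Equiv.swap i (Fin.last m)) fun k => (p k : ℝ)) := by
    refine summable_sum fun i _ => ?_
    simp_rw [permAct_intCast]
    exact summable_starProd.comp_injective (permActEquiv (Equiv.swap i (Fin.last m))).injective
  exact h.of_nonneg_of_le (fun p => decayProd_nonneg _) fun p => decayProd_le_star hm _

theorem measurable_pairSum {m : ℕ} (i i' : Fin (m + 1)) :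
    Measurable fun u : Fin m → ℝ => pairSum u i i' := by
  unfold pairSum; fun_prop

theorem continuous_pairSum {m : ℕ} (i i' : Fin (m + 1)) :
    Continuous fun u : Fin m → ℝ => pairSum u i i' := by
  unfold pairSum; fun_prop

theorem continuous_decayProd {m : ℕ} : Continuous (decayProd : (Fin m → ℝ) → ℝ) := by
  unfold decayProd pairProd
  refine continuous_finsetProd _ fun i _ => continuous_finsetProd _ fun i' _ => ?_
  refine Continuous.inv₀ (continuous_const.add (continuous_pairSum i i').abs) fun u => ?_
  positivity

/-- The same linear change of variables as for the lattice, with an invertible determinant. -/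
theorem integrable_starProd {m : ℕ} : Integrable (starProd : (Fin m → ℝ) → ℝ) := by
  let L : (Fin m → ℝ) →ₗ[ℝ] (Fin m → ℝ) :=
    { toFun := fun u k => tailSum u k.castSucc
      map_add' := fun u v => by funext k; simp [tailSum_add]
      map_smul' := fun c u => by funext k; simp [tailSum_smul] }
  have hinj : Function.Injective L := by
    intro p q hpq
    apply tailSum_injective
    funext i
    induction i using Fin.lastCases with
    | last => simp
    | cast k => exact congrFun hpq k
  have hdet : LinearMap.det L ≠ 0 := by
    have := (LinearEquiv.ofInjectiveEndo L hinj).isUnit_det'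
    exact this.ne_zero
  have hmap := Real.map_linearMap_volume_pi_eq_smul_volume_pi hdet
  have h1 : Integrable fun q : Fin m → ℝ => ∏ k, (1 + |q k|) ^ (-(3 / 2) : ℝ) := by
    refine Integrable.fintype_prod (f := fun _ x => (1 + |x|) ^ (-(3 / 2) : ℝ)) fun k => ?_
    have := integrable_one_add_norm (E := ℝ) (μ := volume) (r := 3 / 2) (by norm_num)
    simpa using this
  have h2 : Integrable (fun q : Fin m → ℝ => ∏ k, (1 + |q k|) ^ (-(3 / 2) : ℝ))
      (Measure.map L volume) := by
    rw [hmap]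
    exact h1.smul_measure (by simp)
  exact h2.comp_measurable (LinearMap.continuous_of_finiteDimensional L).measurable

theorem integrable_decayProd {m : ℕ} (hm : m ≠ 1) : Integrable (decayProd : (Fin m → ℝ) → ℝ) := by
  rcases Nat.lt_or_ge m 2 with h | h
  · obtain rfl : m = 0 := by omega
    have : (decayProd : (Fin 0 → ℝ) → ℝ) = fun _ => decayProd 0 :=
      funext fun u => congrArg _ (Subsingleton.elim _ _)
    rw [this]
    have : IsFiniteMeasure (volume : Measure (Fin 0 → ℝ)) := by
      rw [volume_pi, Measure.pi_of_empty (x := isEmptyElim)]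
      infer_instance
    exact integrable_const _
  · have h1 : Integrable fun u : Fin m → ℝ =>
        ∑ i, starProd (permAct (Equiv.swap i (Fin.last m)) u) :=
      integrable_finsetSum _ fun i _ =>
        (measurePreserving_permAct _).integrable_comp_of_integrable integrable_starProd
    refine h1.mono' continuous_decayProd.aestronglyMeasurable (ae_of_all _ fun u => ?_)
    rw [Real.norm_of_nonneg (decayProd_nonneg u)]
    exact decayProd_le_star h u

/-- The constant is 1 + 2: sinc is bounded by 1, and x sinc(x/2) = 2 sin(x/2) by 2. -/
theorem abs_sinc_half_le (x : ℝ) : |Real.sinc (x / 2)| ≤ 3 * (1 + |x|)⁻¹ := by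
  have hpos : 0 < 1 + |x| := by positivity
  rw [← div_eq_mul_inv, le_div_iff₀ hpos]
  have h1 := Real.abs_sinc_le_one (x / 2)
  have h2 : |Real.sinc (x / 2)| * |x| ≤ 2 := by
    rcases eq_or_ne x 0 with rfl | hx
    · simp
    · rw [sinc_half x hx, ← abs_mul, mul_assoc, inv_mul_cancel₀ hx, mul_one, abs_mul, abs_two]
      linarith [Real.abs_sin_le_one (x / 2)]
  nlinarith

theorem abs_sincProd_le {m : ℕ} (u : Fin m → ℝ) :
    |sincProd u| ≤ 3 ^ ((m + 1) * m / 2) * decayProd u := by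
  rw [sincProd, abs_pairProd, decayProd, ← pairProd_const, ← pairProd_mul]
  exact pairProd_mono (fun i i' _ => abs_nonneg _) fun i i' _ => abs_sinc_half_le _

/-- Factor by factor this is 1 + |k| ≤ (1 + |x|)(1 + |x + 2πk|), a Peetre-type inequality that
separates the lattice vector from the base point. -/
theorem decayProd_shift_le {m : ℕ} (u : Fin m → ℝ) (p : Fin m → ℤ) : decayProd (shift u p) ≤
    pairProd (fun i i' => 1 + |pairSum u i i'|) * decayProd fun k => (p k : ℝ) := by
  rw [decayProd, decayProd, ← pairProd_mul]
  refine pairProd_mono (fun i i' _ => by positivity) fun i i' h => ?_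
  rw [pairSum_shift u p h, pairSum_eq (u := fun k => (p k : ℝ)) h, tailSum_intCast, tailSum_intCast]
  push_cast
  set x := pairSum u i i'
  set k : ℝ := ((tailSum p i : ℤ) : ℝ) - ((tailSum p i' : ℤ) : ℝ)
  rw [← div_eq_mul_inv, inv_le_comm₀ (by positivity) (by positivity), inv_div,
    div_le_iff₀ (by positivity)]
  have h1 : |2 * Real.pi * k| ≤ |x + 2 * Real.pi * k| + |x| := by
    have := abs_sub (x + 2 * Real.pi * k) x
    rwa [add_sub_cancel_left] at this
  rw [abs_mul, abs_of_pos Real.two_pi_pos] at h1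
  have h2 := Real.pi_gt_three
  nlinarith [abs_nonneg k, abs_nonneg x, abs_nonneg (x + 2 * Real.pi * k),
    mul_nonneg (abs_nonneg x) (abs_nonneg (x + 2 * Real.pi * k))]

theorem summable_sincProd_shift {m : ℕ} (hm : 2 ≤ m) (u : Fin m → ℝ) :
    Summable fun p : Fin m → ℤ => sincProd (shift u p) := by
  refine Summable.of_norm_bounded (g := fun p : Fin m → ℤ => 3 ^ ((m + 1) * m / 2) *
    (pairProd (fun i i' => 1 + |pairSum u i i'|) * decayProd fun k => (p k : ℝ)))
    (((summable_decayProd hm).mul_left _).mul_left _) fun p => ?_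
  exact (abs_sincProd_le _).trans
    (mul_le_mul_of_nonneg_left (decayProd_shift_le u p) (by positivity))

theorem continuous_sincProd {m : ℕ} : Continuous (sincProd : (Fin m → ℝ) → ℝ) := by
  unfold sincProd pairProd
  refine continuous_finsetProd _ fun i _ => continuous_finsetProd _ fun i' _ => ?_
  exact Real.continuous_sinc.comp ((continuous_pairSum i i').div_const 2)

/-! ### Unfolding an integral over a lattice -/

/-- The half-open boxes tile the space, each point lying in exactly one. It serves with side 1 for
the Fourier coefficients of a periodization, and with side 2π for compactifying the principal
values. -/
theorem integral_Ioc_tsum_translates {m : ℕ} (a : Fin m → ℝ) {l : ℝ} (hl : 0 < l)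
    {h : (Fin m → ℝ) → ℂ} (hh : Integrable h) :
    ∫ x in {x : Fin m → ℝ | ∀ i, x i ∈ Set.Ioc (a i) (a i + l)},
      ∑' p : Fin m → ℤ, h (fun j => x j + l * (p j : ℝ)) = ∫ x, h x := by
  set S : Set (Fin m → ℝ) := {x : Fin m → ℝ | ∀ i, x i ∈ Set.Ioc (a i) (a i + l)} with hS
  have hSm : MeasurableSet S := by
    have : S = Set.pi Set.univ fun i => Set.Ioc (a i) (a i + l) := by
      ext x; simp [hS]
    rw [this]
    exact MeasurableSet.univ_pi fun i => measurableSet_Ioc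
  let tr : (Fin m → ℤ) → (Fin m → ℝ) := fun p j => l * (p j : ℝ)
  let T : (Fin m → ℤ) → Set (Fin m → ℝ) := fun p => (fun x => x + tr p) ⁻¹' S
  have hTm : ∀ p, MeasurableSet (T p) := fun p => (measurable_add_const (tr p)) hSm
  have hmem : ∀ p x, x ∈ T p ↔ ∀ i, x i + (p i) • l ∈ Set.Ioc (a i) (a i + l) := by
    intro p x
    simp [T, tr, hS, mul_comm]
  have hdisj : Pairwise (Function.onFun Disjoint T) := by
    intro p q hpq
    refine Set.disjoint_left.2 fun x hp hq => hpq (funext fun i => ?_)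
    rw [hmem] at hp hq
    exact (existsUnique_add_zsmul_mem_Ioc hl (x i) (a i)).unique (hp i) (hq i)
  have hunion : ⋃ p, T p = Set.univ := by
    refine Set.eq_univ_of_forall fun x => ?_
    choose p hp _ using fun i => existsUnique_add_zsmul_mem_Ioc hl (x i) (a i)
    exact Set.mem_iUnion.2 ⟨p, (hmem p x).2 hp⟩
  have hset : ∀ {E : Type} [NormedAddCommGroup E] [NormedSpace ℝ E] (g : (Fin m → ℝ) → E) p,
      ∫ x in S, g (x - tr p) = ∫ x in T p, g x := by
    intro E _ _ g p
    have := (measurePreserving_add_right volume (tr p)).setIntegral_preimage_emb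
      (measurableEmbedding_addRight (tr p)) (fun x => g (x - tr p)) S
    simpa using this.symm
  have h1 := hasSum_integral_iUnion hTm hdisj (f := h) (μ := volume) (by
    rw [hunion]; exact hh.integrableOn)
  have h2 := hasSum_integral_iUnion hTm hdisj (f := fun x => ‖h x‖) (μ := volume) (by
    rw [hunion]; exact hh.norm.integrableOn)
  rw [hunion, setIntegral_univ] at h1
  have hneg : ∀ x p, h (fun j => x j + l * (p j : ℝ)) = h (x - tr (-p)) := by
    intro x p; congr 1; funext j; simp [tr]
  simp_rw [hneg]
  have h3 := integral_tsum_of_summable_integral_norm (μ := volume.restrict S)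
    (F := fun (p : Fin m → ℤ) x => h (x - tr (-p)))
    (fun p => (hh.comp_sub_right (tr (-p))).integrableOn)
    (by
      simp_rw [fun p : Fin m → ℤ => hset (fun x => ‖h x‖) (-p)]
      exact h2.summable.comp_injective neg_injective)
  rw [← h3]
  simp_rw [fun p : Fin m → ℤ => hset h (-p)]
  rw [← h1.tsum_eq]
  exact (Equiv.neg (Fin m → ℤ)).tsum_eq fun p => ∫ x in T p, h x

end Horn

end

noncomputable section

namespace Horn

/-! ### Piecewise polynomial functions with rational coefficients -/

/-- The indicator of the positive half-line. -/
def step (x : ℝ) : ℝ := if 0 < x then 1 else 0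

theorem measurable_step : Measurable step :=
  Measurable.ite measurableSet_Ioi measurable_const measurable_const

theorem abs_step_le (x : ℝ) : |step x| ≤ 1 := by unfold step; split_ifs <;> simp

/-- Affine functions with rational coefficients. -/
def ratAff {m : ℕ} (c : Fin m → ℚ) (d : ℚ) (x : Fin m → ℝ) : ℝ := ∑ i, (c i : ℝ) * x i + d

/-- The algebra of piecewise polynomial functions with rational coefficients, whose pieces are cut
out by affine inequalities with rational coefficients. -/
def ratPiecewise (m : ℕ) : Subalgebra ℚ ((Fin m → ℝ) → ℝ) :=
  Algebra.adjoin ℚ ({f | ∃ i, f = fun x => x i} ∪ {f | ∃ c d, f = fun x => step (ratAff c d x)})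

section RatPiecewise

variable {m : ℕ}

theorem coord_mem (i : Fin m) : (fun x : Fin m → ℝ => x i) ∈ ratPiecewise m :=
  Algebra.subset_adjoin (Or.inl ⟨i, rfl⟩)

theorem step_mem (c : Fin m → ℚ) (d : ℚ) : (fun x => step (ratAff c d x)) ∈ ratPiecewise m :=
  Algebra.subset_adjoin (Or.inr ⟨c, d, rfl⟩)

theorem const_mem (q : ℚ) : (fun _ : Fin m → ℝ => (q : ℝ)) ∈ ratPiecewise m := by
  convert (ratPiecewise m).algebraMap_mem q using 1
  rfl

theorem mul_mem_pw {f g : (Fin m → ℝ) → ℝ} (hf : f ∈ ratPiecewise m) (hg : g ∈ ratPiecewise m) :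
    (fun x => f x * g x) ∈ ratPiecewise m := mul_mem hf hg

theorem add_mem_pw {f g : (Fin m → ℝ) → ℝ} (hf : f ∈ ratPiecewise m) (hg : g ∈ ratPiecewise m) :
    (fun x => f x + g x) ∈ ratPiecewise m := add_mem hf hg

theorem sub_mem_pw {f g : (Fin m → ℝ) → ℝ} (hf : f ∈ ratPiecewise m) (hg : g ∈ ratPiecewise m) :
    (fun x => f x - g x) ∈ ratPiecewise m := sub_mem hf hg

theorem pow_mem_pw {f : (Fin m → ℝ) → ℝ} (hf : f ∈ ratPiecewise m) (k : ℕ) :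
    (fun x => f x ^ k) ∈ ratPiecewise m := pow_mem hf k

theorem aff_mem (c : Fin m → ℚ) (d : ℚ) : ratAff c d ∈ ratPiecewise m := by
  refine add_mem_pw ?_ (const_mem d)
  have : (fun x : Fin m → ℝ => ∑ i, (c i : ℝ) * x i) = ∑ i, fun x : Fin m → ℝ => (c i : ℝ) * x i := by
    funext x; simp
  rw [this]
  exact sum_mem fun i _ => mul_mem_pw (const_mem _) (coord_mem i)

theorem ratAff_sub (c c' : Fin m → ℚ) (d d' : ℚ) (x : Fin m → ℝ) :
    ratAff (c - c') (d - d') x = ratAff c d x - ratAff c' d' x := by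
  simp only [ratAff, Pi.sub_apply, Rat.cast_sub, sub_mul, Finset.sum_sub_distrib]
  ring

theorem ratAff_div (c : Fin m → ℚ) (d e : ℚ) (x : Fin m → ℝ) :
    ratAff (fun i => c i / e) (d / e) x = ratAff c d x / e := by
  simp only [ratAff, Rat.cast_div, add_div, Finset.sum_div]
  congr 1
  exact Finset.sum_congr rfl fun i _ => by ring

theorem ratAff_zero (d : ℚ) (x : Fin m → ℝ) : ratAff 0 d x = d := by simp [ratAff]

/-- The source of rationality: the coefficients of R_n are values of a function in this algebra at
integer points. -/
theorem ratPiecewise_rat {f : (Fin m → ℝ) → ℝ} (hf : f ∈ ratPiecewise m) (q : Fin m → ℚ) :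
    ∃ r : ℚ, f (fun i => (q i : ℝ)) = r := by
  induction hf using Algebra.adjoin_induction with
  | mem f hf =>
    rcases hf with ⟨i, rfl⟩ | ⟨c, d, rfl⟩
    · exact ⟨q i, rfl⟩
    · simp only [step]
      split_ifs
      · exact ⟨1, by simp⟩
      · exact ⟨0, by simp⟩
  | algebraMap r => exact ⟨r, rfl⟩
  | add f g _ _ hf hg =>
    obtain ⟨a, ha⟩ := hf
    obtain ⟨b, hb⟩ := hg
    exact ⟨a + b, by simp [ha, hb]⟩
  | mul f g _ _ hf hg =>
    obtain ⟨a, ha⟩ := hf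
    obtain ⟨b, hb⟩ := hg
    exact ⟨a * b, by simp [ha, hb]⟩

theorem continuous_ratAff (c : Fin m → ℚ) (d : ℚ) : Continuous (ratAff c d) := by
  unfold ratAff; fun_prop

theorem ratPiecewise_measurable {f : (Fin m → ℝ) → ℝ} (hf : f ∈ ratPiecewise m) :
    Measurable f := by
  induction hf using Algebra.adjoin_induction with
  | mem f hf =>
    rcases hf with ⟨i, rfl⟩ | ⟨c, d, rfl⟩
    · exact measurable_pi_apply i
    · exact measurable_step.comp (continuous_ratAff c d).measurable
  | algebraMap r => exact measurable_const
  | add f g _ _ hf hg => exact hf.add hg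
  | mul f g _ _ hf hg => exact hf.mul hg

/-- Functions of `x` and a further variable `s` that are sums of `g(x) s^k 1_{s > a(x)}`. -/
inductive IsStepSum : ((Fin m → ℝ) → ℝ → ℝ) → Prop
  | basic (g : (Fin m → ℝ) → ℝ) (hg : g ∈ ratPiecewise m) (k : ℕ) (c : Fin m → ℚ) (d : ℚ) :
      IsStepSum fun x s => g x * s ^ k * step (s - ratAff c d x)
  | add (F G : (Fin m → ℝ) → ℝ → ℝ) (hF : IsStepSum F) (hG : IsStepSum G) :
      IsStepSum fun x s => F x s + G x s

/-- The product is the step at the larger threshold, and step (a - b) selects it. This keeps step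
sums closed under multiplication. -/
theorem step_mul_step (s a b : ℝ) :
    step (s - a) * step (s - b) = step (a - b) * step (s - a) + (1 - step (a - b)) * step (s - b) := by
  simp only [step, sub_pos]
  split_ifs <;> linarith

theorem IsStepSum.mul {F G : (Fin m → ℝ) → ℝ → ℝ} (hF : IsStepSum F) (hG : IsStepSum G) :
    IsStepSum fun x s => F x s * G x s := by
  induction hF with
  | basic g hg k c d =>
    induction hG with
    | basic g' hg' k' c' d' =>
      have h1 : (fun x => step (ratAff c d x - ratAff c' d' x)) ∈ ratPiecewise m := by
        simp_rw [← ratAff_sub]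
        exact step_mem _ _
      convert IsStepSum.add _ _
        (IsStepSum.basic _ (mul_mem_pw (mul_mem_pw hg hg') h1) (k + k') c d)
        (IsStepSum.basic _ (mul_mem_pw (mul_mem_pw hg hg') (sub_mem_pw (const_mem 1) h1)) (k + k') c' d')
        using 3 with x s
      have := step_mul_step s (ratAff c d x) (ratAff c' d' x)
      rw [pow_add]
      push_cast
      linear_combination (g x * g' x * s ^ k * s ^ k') * this
    | add F G _ _ hF hG =>
      convert IsStepSum.add _ _ hF hG using 3
      ring
  | add F G _ _ hF hG =>
    convert IsStepSum.add _ _ hF hG using 3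
    ring

/-- Truncation of the reals to `[-1/2, 1/2]`. -/
def clampHalf (a : ℝ) : ℝ := max (-(1 / 2)) (min a (1 / 2))

theorem integral_pow_mul_step (k : ℕ) (a : ℝ) :
    ∫ s in (-(1 / 2) : ℝ)..(1 / 2), s ^ k * step (s - a) =
      ((1 / 2) ^ (k + 1) - clampHalf a ^ (k + 1)) * (1 / ((k : ℝ) + 1)) := by
  have hc1 : -(1 / 2) ≤ clampHalf a := le_max_left _ _
  have hc2 : clampHalf a ≤ 1 / 2 := max_le (by norm_num) (min_le_right _ _)
  have h1 : ∀ s ∈ Set.Ioc (-(1 / 2) : ℝ) (1 / 2), s ^ k * step (s - a) =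
      (Set.Ioi (clampHalf a)).indicator (fun s => s ^ k) s := by
    intro s hs
    have : a < s ↔ clampHalf a < s := by
      simp only [clampHalf, max_lt_iff, min_lt_iff]
      constructor
      · exact fun h => ⟨hs.1, Or.inl h⟩
      · rintro ⟨_, h | h⟩
        · exact h
        · linarith [hs.2]
    simp only [step, sub_pos, Set.indicator, Set.mem_Ioi, this]
    split_ifs <;> simp
  rw [intervalIntegral.integral_of_le (by norm_num), setIntegral_congr_fun measurableSet_Ioc h1,
    setIntegral_indicator measurableSet_Ioi]
  have h2 : Set.Ioc (-(1 / 2) : ℝ) (1 / 2) ∩ Set.Ioi (clampHalf a) = Set.Ioc (clampHalf a) (1 / 2) := by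
    ext s
    simp only [Set.mem_inter_iff, Set.mem_Ioc, Set.mem_Ioi]
    constructor
    · rintro ⟨⟨_, h⟩, h'⟩; exact ⟨h', h⟩
    · rintro ⟨h, h'⟩; exact ⟨⟨by linarith, h'⟩, h⟩
  rw [h2, ← intervalIntegral.integral_of_le hc2, integral_pow]
  ring

theorem clampHalf_mem (c : Fin m → ℚ) (d : ℚ) :
    (fun x => clampHalf (ratAff c d x)) ∈ ratPiecewise m := by
  have h1 : (fun x : Fin m → ℝ => step (((-(1 / 2) : ℚ) : ℝ) - ratAff c d x)) ∈ ratPiecewise m := by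
    convert step_mem (0 - c) (-(1 / 2) - d) using 3
    rw [ratAff_sub, ratAff_zero]
  have h2 : (fun x : Fin m → ℝ => step (ratAff c d x - ((1 / 2 : ℚ) : ℝ))) ∈ ratPiecewise m := by
    convert step_mem (c - 0) (d - 1 / 2) using 3
    rw [ratAff_sub, ratAff_zero]
  convert add_mem_pw (add_mem_pw (mul_mem_pw (const_mem (-(1 / 2))) h1)
    (mul_mem_pw (const_mem (1 / 2)) h2)) (mul_mem_pw (aff_mem c d)
      (mul_mem_pw (sub_mem_pw (const_mem 1) h1) (sub_mem_pw (const_mem 1) h2))) using 2 with x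
  push_cast
  simp only [clampHalf, step, sub_pos]
  rcases le_total (ratAff c d x) (1 / 2) with h | h
  · rw [min_eq_left h]
    rcases lt_or_ge (ratAff c d x) (-(1 / 2)) with h' | h'
    · rw [max_eq_left h'.le]
      split_ifs <;> linarith
    · rw [max_eq_right h']
      split_ifs <;> linarith
  · rw [min_eq_right h, max_eq_right (by norm_num)]
    split_ifs <;> linarith

/-- Integrating s^k above a threshold gives a polynomial in the threshold truncated to the interval,
and truncation stays in the algebra. -/
theorem IsStepSum.integral {F : (Fin m → ℝ) → ℝ → ℝ} (hF : IsStepSum F) :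
    (∀ x, IntervalIntegrable (F x) volume (-(1 / 2)) (1 / 2)) ∧
      (fun x => ∫ s in (-(1 / 2) : ℝ)..(1 / 2), F x s) ∈ ratPiecewise m := by
  induction hF with
  | basic g hg k c d =>
    constructor
    · intro x
      simp_rw [mul_assoc]
      refine IntervalIntegrable.const_mul ?_ _
      refine IntervalIntegrable.continuousOn_mul ?_ (by fun_prop)
      rw [intervalIntegrable_iff, Set.uIoc_of_le (by norm_num)]
      refine Integrable.mono' (g := fun _ => (1 : ℝ)) (integrable_const _) ?_
        (ae_of_all _ fun s => abs_step_le _)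
      exact (measurable_step.comp (measurable_id.sub_const _)).aestronglyMeasurable
    · simp_rw [mul_assoc, intervalIntegral.integral_const_mul, integral_pow_mul_step]
      have h1 := const_mem (m := m) (1 / ((k : ℚ) + 1))
      have h2 := const_mem (m := m) ((1 / 2) ^ (k + 1))
      push_cast at h1 h2
      exact mul_mem_pw hg (mul_mem_pw (sub_mem_pw h2 (pow_mem_pw (clampHalf_mem c d) _)) h1)
  | add F G _ _ hF hG =>
    refine ⟨fun x => (hF.1 x).add (hG.1 x), ?_⟩
    simp_rw [fun x => intervalIntegral.integral_add (hF.1 x) (hG.1 x)]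
    exact add_mem_pw hF.2 hG.2

/-- Smoothing of `f` along the segment `[-α/2, α/2]`. -/
def smoothAlong (α : Fin m → ℝ) (f : (Fin m → ℝ) → ℝ) (x : Fin m → ℝ) : ℝ :=
  ∫ s in (-(1 / 2) : ℝ)..(1 / 2), f (x - s • α)

/-- Along the line, a step of an affine function becomes a step in s whose threshold is again
rational affine in x. When the slope e is positive the inequality reverses and 1 - step is used,
which is wrong only at the threshold itself; hence the exceptional null set. -/
theorem exists_isStepSum_line (α : Fin m → ℚ) {f : (Fin m → ℝ) → ℝ} (hf : f ∈ ratPiecewise m) :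
    ∃ F, IsStepSum F ∧ ∀ x, ∀ᵐ s : ℝ, s ∈ Set.Ioc (-(1 / 2) : ℝ) (1 / 2) →
      f (x - s • fun i => (α i : ℝ)) = F x s := by
  have hone : ∀ (g : (Fin m → ℝ) → ℝ), g ∈ ratPiecewise m → ∀ k : ℕ, ∃ F, IsStepSum F ∧
      ∀ x, ∀ s ∈ Set.Ioc (-(1 / 2) : ℝ) (1 / 2), g x * s ^ k = F x s := by
    intro g hg k
    -- The threshold -1 lies below the interval, so the step is identically 1 there.
    refine ⟨_, IsStepSum.basic g hg k 0 (-1), fun x s hs => ?_⟩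
    have : 0 < s - ratAff 0 (-1) x := by rw [ratAff_zero]; push_cast; linarith [hs.1]
    simp [step, this]
  induction hf using Algebra.adjoin_induction with
  | mem f hf =>
    rcases hf with ⟨i, rfl⟩ | ⟨c, d, rfl⟩
    · obtain ⟨F, hF, h1⟩ := hone _ (coord_mem i) 0
      obtain ⟨G, hG, h2⟩ := hone _ (const_mem (-α i)) 1
      refine ⟨_, hF.add _ _ hG, fun x => ae_of_all _ fun s hs => ?_⟩
      rw [← h1 x s hs, ← h2 x s hs]
      simp
      ring
    · set e : ℚ := ∑ i, c i * α i with he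
      have hline : ∀ x s, ratAff c d (x - s • fun i => (α i : ℝ)) = ratAff c d x - s * e := by
        intro x s
        simp only [ratAff, he, Pi.sub_apply, Pi.smul_apply, smul_eq_mul, mul_sub,
          Finset.sum_sub_distrib]
        push_cast
        rw [Finset.mul_sum]
        have : ∀ i, (c i : ℝ) * (s * α i) = s * (c i * α i) := fun i => by ring
        simp_rw [this]
        ring
      rcases lt_trichotomy e 0 with h | h | h
      · refine ⟨_, IsStepSum.basic _ (const_mem 1) 0 (fun i => c i / e) (d / e),
          fun x => ae_of_all _ fun s _ => ?_⟩
        change step (ratAff c d _) = _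
        rw [hline, ratAff_div]
        have h' : (e : ℝ) < 0 := by exact_mod_cast h
        have : 0 < ratAff c d x - s * e ↔ 0 < s - ratAff c d x / e := by
          rw [sub_pos, sub_pos, div_lt_iff_of_neg h']
        simp [step, this]
      · obtain ⟨F, hF, h1⟩ := hone _ (step_mem c d) 0
        refine ⟨F, hF, fun x => ae_of_all _ fun s hs => ?_⟩
        change step (ratAff c d _) = _
        rw [← h1 x s hs, hline, h]
        simp
      · obtain ⟨F, hF, h1⟩ := hone _ (const_mem 1) 0
        refine ⟨_, hF.add _ _ (IsStepSum.basic _ (const_mem (-1)) 0 (fun i => c i / e) (d / e)),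
          fun x => ?_⟩
        have hne : ∀ᵐ s : ℝ, s ≠ ratAff c d x / e := by
          simp [ae_iff]
        filter_upwards [hne] with s hs hs'
        rw [hline, ratAff_div, ← h1 x s hs']
        have h' : (0 : ℝ) < e := by exact_mod_cast h
        have h2 : 0 < ratAff c d x - s * e ↔ ¬ 0 < s - ratAff c d x / e := by
          rw [sub_pos, sub_pos, ← lt_div_iff₀ h', not_lt]
          exact ⟨le_of_lt, fun h => lt_of_le_of_ne h hs⟩
        simp only [step, h2]
        split_ifs <;> simp_all
  | algebraMap r =>
    obtain ⟨F, hF, h1⟩ := hone _ (const_mem r) 0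
    refine ⟨F, hF, fun x => ae_of_all _ fun s hs => ?_⟩
    rw [← h1 x s hs, pow_zero, mul_one]
    rfl
  | add f g _ _ hf hg =>
    obtain ⟨F, hF, h1⟩ := hf
    obtain ⟨G, hG, h2⟩ := hg
    refine ⟨_, hF.add _ _ hG, fun x => ?_⟩
    filter_upwards [h1 x, h2 x] with s hs1 hs2 hs
    rw [← hs1 hs, ← hs2 hs]
    rfl
  | mul f g _ _ hf hg =>
    obtain ⟨F, hF, h1⟩ := hf
    obtain ⟨G, hG, h2⟩ := hg
    refine ⟨_, hF.mul hG, fun x => ?_⟩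
    filter_upwards [h1 x, h2 x] with s hs1 hs2 hs
    rw [← hs1 hs, ← hs2 hs]
    rfl

theorem smoothAlong_mem (α : Fin m → ℚ) {f : (Fin m → ℝ) → ℝ} (hf : f ∈ ratPiecewise m) :
    smoothAlong (fun i => (α i : ℝ)) f ∈ ratPiecewise m := by
  obtain ⟨F, hF, h⟩ := exists_isStepSum_line α hf
  convert hF.integral.2 using 1
  funext x
  refine intervalIntegral.integral_congr_ae ?_
  rw [Set.uIoc_of_le (by norm_num)]
  exact h x

end RatPiecewise

end Horn

end

noncomputable section

namespace Horn

/-! ### Box splines -/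

/-- A bounded compactly supported rational piecewise polynomial with Fourier transform `Φ`. -/
structure IsSpline {m : ℕ} (f Φ : (Fin m → ℝ) → ℝ) : Prop where
  mem : f ∈ ratPiecewise m
  bdd : ∃ C, ∀ x, |f x| ≤ C
  supp : ∃ R, ∀ x i, R < |x i| → f x = 0
  fourier : ∀ w, ∫ x, (f x : ℂ) * Complex.exp (2 * Real.pi * Complex.I * ((∑ k, x k * w k : ℝ) : ℂ)) =
    (Φ w : ℂ)

theorem norm_exp_two_pi_I (r : ℝ) : ‖Complex.exp (2 * Real.pi * Complex.I * (r : ℂ))‖ = 1 := by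
  have : 2 * (Real.pi : ℂ) * Complex.I * (r : ℂ) = ((2 * Real.pi * r : ℝ) : ℂ) * Complex.I := by
    push_cast; ring
  rw [this, Complex.norm_exp_ofReal_mul_I]

theorem integral_exp_two_pi_eq_sinc (b : ℝ) :
    ∫ s in (-(1 / 2) : ℝ)..(1 / 2), Complex.exp (2 * Real.pi * Complex.I * ((s * b : ℝ) : ℂ)) =
      (Real.sinc (Real.pi * b) : ℂ) := by
  rcases eq_or_ne b 0 with rfl | hb
  · simp
    norm_num
  have h2 : (2 * Real.pi * b : ℝ) ≠ 0 := mul_ne_zero Real.two_pi_pos.ne' hb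
  have h1 := intervalIntegral.integral_comp_mul_left (a := -(1 / 2)) (b := 1 / 2)
    (fun x : ℝ => Complex.exp (x * Complex.I)) h2
  have h3 : ∀ s : ℝ, Complex.exp (2 * Real.pi * Complex.I * ((s * b : ℝ) : ℂ)) =
      Complex.exp (((2 * Real.pi * b * s : ℝ) : ℂ) * Complex.I) := fun s => by
    congr 1; push_cast; ring
  simp_rw [h3]
  rw [h1]
  have h4 : 2 * Real.pi * b * -(1 / 2) = -(Real.pi * b) := by ring
  have h5 : 2 * Real.pi * b * (1 / 2) = Real.pi * b := by ring
  rw [h4, h5, integral_exp_mul_I_eq_sinc, Complex.real_smul]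
  have hpi : (Real.pi : ℂ) ≠ 0 := by exact_mod_cast Real.pi_ne_zero
  have hb' : (b : ℂ) ≠ 0 := by exact_mod_cast hb
  push_cast
  field_simp

section Spline

variable {m : ℕ}

theorem continuous_smoothAlong (α : Fin m → ℝ) {f : (Fin m → ℝ) → ℝ} (hf : Continuous f) :
    Continuous (smoothAlong α f) := by
  unfold smoothAlong
  fun_prop

theorem IsSpline.integrable {f Φ : (Fin m → ℝ) → ℝ} (hf : IsSpline f Φ) : Integrable f := by
  obtain ⟨C, hC⟩ := hf.bdd
  obtain ⟨R, hR⟩ := hf.supp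
  have h1 : IntegrableOn f (Set.Icc (fun _ => -R) fun _ => R) :=
    Integrable.mono' (g := fun _ => C) (integrableOn_const (by simpa using measure_Icc_lt_top.ne))
      (ratPiecewise_measurable hf.mem).aestronglyMeasurable (ae_of_all _ hC)
  refine h1.integrable_of_forall_notMem_eq_zero fun x hx => ?_
  by_contra h0
  refine hx ⟨fun i => ?_, fun i => ?_⟩ <;>
  · have := not_lt.1 fun h => h0 (hR x i h)
    have := abs_le.1 this
    simp only
    linarith

/-- Smoothing is convolution with the uniform measure on a segment, whose Fourier transform is a
sinc. Each positive root thus contributes one factor. -/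
theorem IsSpline.smoothAlong {f Φ : (Fin m → ℝ) → ℝ} (hf : IsSpline f Φ) (α : Fin m → ℚ) :
    IsSpline (smoothAlong (fun i => (α i : ℝ)) f)
      fun w => Real.sinc (Real.pi * ∑ i, (α i : ℝ) * w i) * Φ w := by
  set β : Fin m → ℝ := fun i => (α i : ℝ) with hβ
  have hmeas := ratPiecewise_measurable hf.mem
  have hint := hf.integrable
  obtain ⟨C, hC⟩ := hf.bdd
  obtain ⟨R, hR⟩ := hf.supp
  refine ⟨smoothAlong_mem α hf.mem, ⟨C, fun x => ?_⟩, ⟨R + ∑ i, |β i|, fun x i hi => ?_⟩,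
    fun w => ?_⟩
  · have := intervalIntegral.norm_integral_le_of_norm_le_const (a := -(1 / 2)) (b := 1 / 2)
      (f := fun s : ℝ => f (x - s • β)) (C := C) fun s _ => hC _
    norm_num at this
    exact this
  · have h1 : ∀ s ∈ Set.uIcc (-(1 / 2) : ℝ) (1 / 2), f (x - s • β) = 0 := by
      intro s hs
      rw [Set.uIcc_of_le (by norm_num)] at hs
      refine hR _ i ?_
      have hs' : |s| ≤ 1 := abs_le.2 ⟨by linarith [hs.1], by linarith [hs.2]⟩
      have h2 : |β i| ≤ ∑ i, |β i| :=
        Finset.single_le_sum (f := fun i => |β i|) (fun _ _ => abs_nonneg _) (Finset.mem_univ i)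
      have h3 : |x i| ≤ |x i - s * β i| + |s * β i| := by
        have := abs_add_le (x i - s * β i) (s * β i)
        rwa [sub_add_cancel] at this
      rw [abs_mul] at h3
      simp only [Pi.sub_apply, Pi.smul_apply, smul_eq_mul]
      nlinarith [abs_nonneg (β i)]
    rw [Horn.smoothAlong, intervalIntegral.integral_congr h1]
    simp
  · set e : (Fin m → ℝ) → ℂ := fun x =>
      Complex.exp (2 * Real.pi * Complex.I * ((∑ k, x k * w k : ℝ) : ℂ)) with he
    have hec : Continuous e := by simp only [he]; fun_prop
    have hen : ∀ x, ‖e x‖ = 1 := fun x => norm_exp_two_pi_I _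
    have hadd : ∀ x y, e (x + y) = e x * e y := by
      intro x y
      simp only [he, ← Complex.exp_add]
      congr 1
      simp only [Pi.add_apply, add_mul, Finset.sum_add_distrib]
      push_cast
      ring
    have hshift : ∀ s : ℝ, ∫ x, (f (x - s • β) : ℂ) * e x = e (s • β) * (Φ w : ℂ) := by
      intro s
      rw [← hf.fourier w, ← integral_const_mul,
        ← integral_sub_right_eq_self (fun x => e (s • β) * ((f x : ℂ) * e x)) (s • β)]
      congr 1
      funext x
      have : e x = e (x - s • β) * e (s • β) := by rw [← hadd, sub_add_cancel]
      rw [this]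
      ring
    have hprod : Integrable (fun z : (Fin m → ℝ) × ℝ => (f (z.1 - z.2 • β) : ℂ) * e z.1)
        (volume.prod (volume.restrict (Set.Ioc (-(1 / 2) : ℝ) (1 / 2)))) := by
      have hm1 : Measurable fun z : (Fin m → ℝ) × ℝ => (f (z.1 - z.2 • β) : ℂ) * e z.1 := by
        refine Measurable.mul (Complex.measurable_ofReal.comp (hmeas.comp ?_))
          (hec.measurable.comp measurable_fst)
        fun_prop
      refine (integrable_prod_iff' hm1.aestronglyMeasurable).2 ⟨ae_of_all _ fun s => ?_, ?_⟩
      · refine ((hint.comp_sub_right (s • β)).ofReal (𝕜 := ℂ)).mul_bdd (c := 1)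
          hec.aestronglyMeasurable (ae_of_all _ fun x => (hen x).le)
      · have : ∀ s : ℝ, ∫ x, ‖(f (x - s • β) : ℂ) * e x‖ = ∫ x, |f x| := by
          intro s
          simp_rw [norm_mul, hen, mul_one, Complex.norm_real, Real.norm_eq_abs]
          exact integral_sub_right_eq_self (fun x => |f x|) (s • β)
        simp_rw [this]
        exact integrable_const _
    have h1 : ∀ x, ((Horn.smoothAlong β f x : ℝ) : ℂ) * e x =
        ∫ s in Set.Ioc (-(1 / 2) : ℝ) (1 / 2), (f (x - s • β) : ℂ) * e x := by
      intro x
      rw [Horn.smoothAlong, intervalIntegral.integral_of_le (by norm_num), integral_mul_const,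
        integral_complex_ofReal]
    change ∫ x, ((Horn.smoothAlong β f x : ℝ) : ℂ) * e x = _
    simp_rw [h1]
    rw [integral_integral_swap hprod]
    simp_rw [hshift]
    rw [integral_mul_const, ← intervalIntegral.integral_of_le (by norm_num)]
    push_cast
    congr 1
    rw [← integral_exp_two_pi_eq_sinc]
    congr 1
    funext s
    simp only [he]
    congr 3
    rw [Finset.mul_sum]
    exact Finset.sum_congr rfl fun k _ => by simp; ring

/-- The indicator of the unit cube centred at the origin. -/
def cubeInd (x : Fin m → ℝ) : ℝ := ∏ k, (Set.Icc (-(1 / 2) : ℝ) (1 / 2)).indicator (fun _ => 1) (x k)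

/-- The starting point of the construction: the cube accounts for the simple roots, which are the
coordinate vectors. -/
theorem isSpline_cubeInd :
    IsSpline (cubeInd (m := m)) fun w => ∏ k, Real.sinc (Real.pi * w k) := by
  refine ⟨?_, ⟨1, fun x => ?_⟩, ⟨1 / 2, fun x i hi => ?_⟩, fun w => ?_⟩
  · have : (cubeInd : (Fin m → ℝ) → ℝ) = ∏ k, fun x : Fin m → ℝ =>
        (((1 : ℚ) : ℝ) - step (ratAff (Pi.single k 1) (-(1 / 2)) x)) *
          (((1 : ℚ) : ℝ) - step (ratAff (Pi.single k (-1)) (-(1 / 2)) x)) := by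
      funext x
      rw [Finset.prod_apply, cubeInd]
      refine Finset.prod_congr rfl fun k _ => ?_
      have hs : ∀ a : ℚ, ratAff (Pi.single k a) (-(1 / 2)) x = a * x k - 1 / 2 := by
        intro a
        rw [ratAff, Finset.sum_eq_single k]
        · simp; ring
        · intro j _ hj; simp [Pi.single_eq_of_ne hj]
        · simp
      simp only [hs, Set.indicator, Set.mem_Icc, step, Rat.cast_one, Rat.cast_neg]
      by_cases h1 : x k ≤ 1 / 2
      · by_cases h2 : -(1 / 2) ≤ x k
        · rw [if_pos ⟨h2, h1⟩, if_neg (by linarith), if_neg (by linarith)]; norm_num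
        · rw [if_neg (fun h => h2 h.1), if_neg (by linarith), if_pos (by linarith)]; norm_num
      · rw [if_neg (fun h => h1 h.2), if_pos (by linarith)]; norm_num
    rw [this]
    exact prod_mem fun k _ => mul_mem_pw (sub_mem_pw (const_mem 1) (step_mem _ _))
      (sub_mem_pw (const_mem 1) (step_mem _ _))
  · rw [cubeInd, Finset.abs_prod]
    refine Finset.prod_le_one (fun _ _ => abs_nonneg _) fun k _ => ?_
    simp only [Set.indicator]
    split_ifs <;> simp
  · refine Finset.prod_eq_zero (Finset.mem_univ i) (Set.indicator_of_notMem ?_ _)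
    rintro ⟨h1, h2⟩
    exact absurd (abs_le.2 ⟨h1, h2⟩) (not_le.2 hi)
  · have h1 : ∀ x : Fin m → ℝ, (cubeInd x : ℂ) *
        Complex.exp (2 * Real.pi * Complex.I * ((∑ k, x k * w k : ℝ) : ℂ)) =
        ∏ k, (Set.Icc (-(1 / 2) : ℝ) (1 / 2)).indicator
          (fun s => Complex.exp (2 * Real.pi * Complex.I * ((s * w k : ℝ) : ℂ))) (x k) := by
      intro x
      rw [Complex.ofReal_sum, Finset.mul_sum, Complex.exp_sum, cubeInd, Complex.ofReal_prod,
        ← Finset.prod_mul_distrib]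
      refine Finset.prod_congr rfl fun k _ => ?_
      simp only [Set.indicator]
      split_ifs <;> simp
    simp_rw [h1]
    rw [integral_fintype_prod_volume_eq_prod (fun k => (Set.Icc (-(1 / 2) : ℝ) (1 / 2)).indicator
          (fun s => Complex.exp (2 * Real.pi * Complex.I * ((s * w k : ℝ) : ℂ))))]
    rw [Complex.ofReal_prod]
    refine Finset.prod_congr rfl fun k _ => ?_
    rw [integral_indicator measurableSet_Icc, integral_Icc_eq_integral_Ioc,
      ← intervalIntegral.integral_of_le (by norm_num), integral_exp_two_pi_eq_sinc]

/-- The diagonal direction (1, …, 1), the highest root, is transversal to every face of the cube.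
For a fixed point only finitely many s meet the boundary, so dominated convergence applies. -/
theorem continuous_smoothAlong_cubeInd :
    Continuous (smoothAlong (fun _ : Fin m => (1 : ℝ)) cubeInd) := by
  rw [continuous_iff_continuousAt]
  intro x₀
  have hmeas := ratPiecewise_measurable (isSpline_cubeInd (m := m)).mem
  obtain ⟨C, hC⟩ := (isSpline_cubeInd (m := m)).bdd
  unfold smoothAlong
  refine intervalIntegral.continuousAt_of_dominated_interval (bound := fun _ => C)
    (Eventually.of_forall fun x => ?_) (Eventually.of_forall fun x => ae_of_all _ fun s _ => hC _)
    intervalIntegrable_const ?_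
  · exact (hmeas.comp (by fun_prop)).aestronglyMeasurable
  · have hne : ∀ᵐ s : ℝ, ∀ k, s ≠ x₀ k - 1 / 2 ∧ s ≠ x₀ k + 1 / 2 := by
      rw [ae_all_iff]
      intro k
      rw [eventually_and]
      constructor <;> simp [ae_iff]
    filter_upwards [hne] with s hs _
    unfold cubeInd
    refine tendsto_finsetProd _ fun k _ => ?_
    have hc : ContinuousAt (fun x : Fin m → ℝ => x k - s) x₀ :=
      ((continuous_apply k).sub continuous_const).continuousAt
    simp only [Pi.sub_apply, Pi.smul_apply, smul_eq_mul, mul_one]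
    suffices hq : ContinuousAt ((Set.Icc (-(1 / 2) : ℝ) (1 / 2)).indicator fun _ => (1 : ℝ))
      (x₀ k - s) from Tendsto.comp hq hc
    have hfr : x₀ k - s ∉ frontier (Set.Icc (-(1 / 2) : ℝ) (1 / 2)) := by
      rw [frontier_Icc (by norm_num)]
      rintro (h | h)
      · exact (hs k).2 (by linarith)
      · exact (hs k).1 (by rw [Set.mem_singleton_iff] at h; linarith)
    by_cases hin : x₀ k - s ∈ Set.Icc (-(1 / 2) : ℝ) (1 / 2)
    · have h1 : Set.Icc (-(1 / 2) : ℝ) (1 / 2) ∈ 𝓝 (x₀ k - s) := by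
        exact mem_interior_iff_mem_nhds.1 (by_contra fun h => hfr ⟨subset_closure hin, h⟩)
      refine ContinuousAt.congr (f := fun _ => (1 : ℝ)) continuousAt_const ?_
      filter_upwards [h1] with y hy
      rw [Set.indicator_of_mem hy]
    · have h1 : (Set.Icc (-(1 / 2) : ℝ) (1 / 2))ᶜ ∈ 𝓝 (x₀ k - s) := isClosed_Icc.isOpen_compl.mem_nhds hin
      refine ContinuousAt.congr (f := fun _ => (0 : ℝ)) continuousAt_const ?_
      filter_upwards [h1] with y hy
      rw [Set.indicator_of_notMem hy]

theorem sum_indicator_eq_pairSum (w : Fin m → ℝ) (i i' : Fin (m + 1)) :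
    ∑ k : Fin m, ((if i.val ≤ k.val ∧ k.val < i'.val then 1 else 0 : ℚ) : ℝ) * w k =
      pairSum w i i' := by
  rw [pairSum, Finset.sum_filter]
  refine Finset.sum_congr rfl fun k _ => ?_
  split_ifs <;> simp

/-- The cube and the highest root come first because they already give a continuous function; every
further smoothing preserves continuity, which Poisson summation requires. -/
theorem exists_spline_of_pairs (S : Finset (Fin (m + 1) × Fin (m + 1))) :
    ∃ B : (Fin m → ℝ) → ℝ, Continuous B ∧ IsSpline B fun w =>
      (∏ p ∈ S, Real.sinc (Real.pi * pairSum w p.1 p.2)) *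
        (Real.sinc (Real.pi * ∑ k, w k) * ∏ k, Real.sinc (Real.pi * w k)) := by
  classical
  induction S using Finset.induction_on with
  | empty =>
    refine ⟨_, continuous_smoothAlong_cubeInd, ?_⟩
    convert (isSpline_cubeInd (m := m)).smoothAlong (fun _ => 1) using 2 <;> simp
  | insert p S hp ih =>
    obtain ⟨B, hB, hs⟩ := ih
    refine ⟨_, continuous_smoothAlong
      (fun k : Fin m => ((if p.1.val ≤ k.val ∧ k.val < p.2.val then 1 else 0 : ℚ) : ℝ)) hB, ?_⟩
    convert hs.smoothAlong (fun k : Fin m => if p.1.val ≤ k.val ∧ k.val < p.2.val then 1 else 0)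
      using 2 with w
    rw [Finset.prod_insert hp, mul_assoc, sum_indicator_eq_pairSum]

/-- Separates the simple roots and the highest root from the others; for m ≥ 2 the highest root is
not simple, so it is not counted twice. -/
theorem prod_pairs_split (hm : 2 ≤ m) :
    ∃ S : Finset (Fin (m + 1) × Fin (m + 1)), ∀ F : Fin (m + 1) → Fin (m + 1) → ℝ,
      pairProd F = (∏ p ∈ S, F p.1 p.2) * (F 0 (Fin.last m) * ∏ k : Fin m, F k.castSucc k.succ) := by
  classical
  set E : Finset (Fin (m + 1) × Fin (m + 1)) := Finset.univ.filter fun p => p.1 < p.2 with hE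
  set I : Finset (Fin (m + 1) × Fin (m + 1)) :=
    Finset.univ.image fun k : Fin m => (k.castSucc, k.succ) with hI
  have hnot : ((0 : Fin (m + 1)), Fin.last m) ∉ I := by
    simp only [hI, Finset.mem_image, Finset.mem_univ, true_and, not_exists, Prod.mk.injEq,
      Fin.ext_iff, Fin.val_castSucc, Fin.val_succ, Fin.val_last, Fin.val_zero]
    omega
  have hsub : insert ((0 : Fin (m + 1)), Fin.last m) I ⊆ E := by
    intro p hp
    rw [Finset.mem_insert] at hp
    rcases hp with rfl | hp
    · simp only [hE, Finset.mem_filter, Finset.mem_univ, true_and, Fin.lt_def, Fin.val_zero,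
        Fin.val_last]
      omega
    · simp only [hI, Finset.mem_image, Finset.mem_univ, true_and] at hp
      obtain ⟨k, rfl⟩ := hp
      simp [hE]
  refine ⟨E \ insert ((0 : Fin (m + 1)), Fin.last m) I, fun F => ?_⟩
  have h1 : pairProd F = ∏ p ∈ E, F p.1 p.2 := by
    rw [pairProd, hE, Finset.prod_filter, ← Finset.univ_product_univ, Finset.prod_product]
    simp_rw [Finset.prod_filter]
  rw [h1, ← Finset.prod_sdiff hsub, Finset.prod_insert hnot, hI,
    Finset.prod_image fun a _ b _ h => by simpa using h]

theorem pairSum_castSucc_succ (w : Fin m → ℝ) (k : Fin m) : pairSum w k.castSucc k.succ = w k := by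
  rw [pairSum_eq (Fin.castSucc_lt_succ), tailSum_castSucc_sub]

theorem pairSum_zero_last (w : Fin m → ℝ) : pairSum w 0 (Fin.last m) = ∑ k, w k := by
  simp [pairSum]

/-- The box spline of the positive roots. -/
theorem exists_boxSpline (hm : 2 ≤ m) : ∃ B : (Fin m → ℝ) → ℝ, Continuous B ∧
    IsSpline B fun w => sincProd fun k => 2 * Real.pi * w k := by
  obtain ⟨S, hS⟩ := prod_pairs_split hm
  obtain ⟨B, hB, hs⟩ := exists_spline_of_pairs S
  refine ⟨B, hB, ?_⟩
  convert hs using 2 with w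
  have h1 : sincProd (fun k => 2 * Real.pi * w k) =
      pairProd fun i i' => Real.sinc (Real.pi * pairSum w i i') := by
    refine pairProd_congr fun i i' h => ?_
    have : (fun k => 2 * Real.pi * w k) = (2 * Real.pi) • w := rfl
    rw [pairSum_eq h, pairSum_eq h, this, tailSum_smul, tailSum_smul]
    congr 1
    ring
  rw [h1, hS]
  simp only [pairSum_castSucc_succ, pairSum_zero_last]

end Spline

end Horn

end

noncomputable section

namespace Horn

/-! ### Poisson summation -/

/-- The points of `ℤ^m` with entries in `{-L, …, L}`. -/
def latticeBox (m L : ℕ) : Finset (Fin m → ℤ) :=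
  Fintype.piFinset fun _ : Fin m => Finset.Icc (-(L : ℤ)) (L : ℤ)

theorem notMem_latticeBox {m L : ℕ} {p : Fin m → ℤ} (hp : p ∉ latticeBox m L) :
    ∃ i, (L : ℝ) < |(p i : ℝ)| := by
  simp only [latticeBox, Fintype.mem_piFinset, Finset.mem_Icc, not_forall] at hp
  obtain ⟨i, hi⟩ := hp
  refine ⟨i, ?_⟩
  have : (L : ℤ) < |p i| := by
    by_contra! h
    exact hi (abs_le.1 h)
  exact_mod_cast this

/-- Bounded support makes the periodization a locally finite sum, hence a continuous function on the
torus. Unfolding identifies its Fourier coefficients with the integrals, and summability of the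
coefficients lets the Fourier series be evaluated at the origin. -/
theorem poisson_summation {m : ℕ} {h : (Fin m → ℝ) → ℂ} (hc : Continuous h) (hi : Integrable h)
    {L : ℕ} (hL : ∀ x i, (L : ℝ) < |x i| → h x = 0)
    (hs : Summable fun n : Fin m → ℤ =>
      ∫ x : Fin m → ℝ, Complex.exp (2 * Real.pi * Complex.I * ((-∑ k, x k * n k : ℝ) : ℂ)) * h x) :
    HasSum (fun n : Fin m → ℤ =>
      ∫ x : Fin m → ℝ, Complex.exp (2 * Real.pi * Complex.I * ((-∑ k, x k * n k : ℝ) : ℂ)) * h x)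
      (∑ A ∈ latticeBox m L, h fun k => (A k : ℝ)) := by
  set Φ : (Fin m → ℝ) → ℂ := fun x => ∑' p : Fin m → ℤ, h (fun j => x j + 1 * (p j : ℝ)) with hΦ
  have hfin : ∀ (x : Fin m → ℝ) (M : ℕ), (∀ i, |x i| ≤ M) →
      Φ x = ∑ p ∈ latticeBox m (L + M), h (fun j => x j + 1 * (p j : ℝ)) := by
    intro x M hx
    refine tsum_eq_sum fun p hp => ?_
    obtain ⟨i, hi⟩ := notMem_latticeBox hp
    refine hL _ i ?_
    push_cast at hi
    have h1 : |(p i : ℝ)| ≤ |x i + p i| + |x i| := by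
      have := abs_sub (x i + p i) (x i)
      rwa [add_sub_cancel_left] at this
    rw [one_mul]
    linarith [hx i]
  have hΦc : Continuous Φ := by
    rw [continuous_iff_continuousAt]
    intro x₀
    obtain ⟨M, hM⟩ := exists_nat_ge (‖x₀‖ + 1)
    have hev : ∀ᶠ x : Fin m → ℝ in 𝓝 x₀, ∀ i, |x i| ≤ (M : ℝ) := by
      filter_upwards [Metric.ball_mem_nhds x₀ one_pos] with x hx i
      have h1 : ‖x - x₀‖ < 1 := by rwa [Metric.mem_ball, dist_eq_norm] at hx
      have h2 := norm_le_pi_norm x i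
      have h3 : ‖x‖ ≤ ‖x - x₀‖ + ‖x₀‖ := by simpa using norm_add_le (x - x₀) x₀
      rw [Real.norm_eq_abs] at h2
      linarith
    refine ContinuousAt.congr (f := fun x : Fin m → ℝ => ∑ p ∈ latticeBox m (L + M),
      h (fun j => x j + 1 * (p j : ℝ))) 
      (Continuous.continuousAt (by fun_prop)) ?_
    filter_upwards [hev] with x hx using (hfin x M hx).symm
  have hper : ∀ (x : Fin m → ℝ) (q : Fin m → ℤ), Φ (fun j => x j + q j) = Φ x := by
    intro x q
    simp only [hΦ]
    rw [← (Equiv.addLeft q).tsum_eq fun p => h fun j => x j + 1 * (p j : ℝ)]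
    refine tsum_congr fun p => ?_
    congr 1
    funext j
    simp
    ring
  let mk : (Fin m → ℝ) → UnitAddTorus (Fin m) := fun x i => (x i : UnitAddCircle)
  have hmk : IsOpenQuotientMap mk :=
    IsOpenQuotientMap.piMap fun _ => QuotientAddGroup.isOpenQuotientMap_mk
  -- A discontinuous section suffices: by periodicity the composite with Φ pulls back to Φ itself,
  -- and the quotient topology then gives continuity.
  let sec : UnitAddTorus (Fin m) → (Fin m → ℝ) := fun y i => (AddCircle.equivIoc 1 0 (y i)).1
  have hsec : ∀ x, Φ (sec (mk x)) = Φ x := by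
    intro x
    have : ∀ i, ∃ q : ℤ, sec (mk x) i = x i + q := by
      intro i
      have h1 : ((sec (mk x) i : ℝ) : UnitAddCircle) = (x i : UnitAddCircle) :=
        (AddCircle.equivIoc 1 0).symm_apply_apply (mk x i)
      rw [← sub_eq_zero, ← AddCircle.coe_sub, AddCircle.coe_eq_zero_iff] at h1
      obtain ⟨q, hq⟩ := h1
      refine ⟨q, ?_⟩
      rw [zsmul_eq_mul, mul_one] at hq
      linarith
    choose q hq using this
    rw [← hper x q]
    congr 1
    funext j
    exact hq j
  let F : C(UnitAddTorus (Fin m), ℂ) := ⟨fun y => Φ (sec y), by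
    rw [hmk.isQuotientMap.continuous_iff]
    have : (fun y => Φ (sec y)) ∘ mk = Φ := funext hsec
    rw [this]
    exact hΦc⟩
  have hF : ∀ x, F (mk x) = Φ x := hsec
  have hmF : ∀ (n : Fin m → ℤ) (x : Fin m → ℝ), UnitAddTorus.mFourier (-n) (mk x) =
      Complex.exp (2 * Real.pi * Complex.I * ((-∑ k, x k * n k : ℝ) : ℂ)) := by
    intro n x
    rw [← Finset.sum_neg_distrib, Complex.ofReal_sum, Finset.mul_sum, Complex.exp_sum]
    change ∏ i, fourier (-n i) (x i : UnitAddCircle) = _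
    refine Finset.prod_congr rfl fun i _ => ?_
    rw [fourier_coe_apply]
    congr 1
    push_cast
    ring
  have hcoeff : ∀ n : Fin m → ℤ, UnitAddTorus.mFourierCoeff F n =
      ∫ x : Fin m → ℝ, Complex.exp (2 * Real.pi * Complex.I * ((-∑ k, x k * n k : ℝ) : ℂ)) * h x := by
    intro n
    set e : (Fin m → ℝ) → ℂ := fun x =>
      Complex.exp (2 * Real.pi * Complex.I * ((-∑ k, x k * n k : ℝ) : ℂ)) with he
    have hec : Continuous e := by simp only [he]; fun_prop
    have hint : Integrable fun x => e x * h x := by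
      refine hi.bdd_mul (c := 1) hec.aestronglyMeasurable (ae_of_all _ fun x => ?_)
      exact (norm_exp_two_pi_I _).le
    have heper : ∀ (x : Fin m → ℝ) (p : Fin m → ℤ), e (fun j => x j + 1 * (p j : ℝ)) = e x := by
      intro x p
      simp only [he]
      have h1 : (-∑ k, (x k + 1 * (p k : ℝ)) * n k : ℝ) =
          (-∑ k, x k * n k : ℝ) + ((-∑ k, p k * n k : ℤ) : ℝ) := by
        push_cast
        rw [← neg_add, ← Finset.sum_add_distrib]
        congr 2
        funext k
        ring
      rw [h1]
      have h2 : 2 * (Real.pi : ℂ) * Complex.I *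
          (((-∑ k, x k * n k : ℝ) + ((-∑ k, p k * n k : ℤ) : ℝ) : ℝ) : ℂ) =
          2 * Real.pi * Complex.I * ((-∑ k, x k * n k : ℝ) : ℂ) +
            ((-∑ k, p k * n k : ℤ) : ℂ) * (2 * Real.pi * Complex.I) := by
        push_cast; ring
      rw [h2, Complex.exp_add, Complex.exp_int_mul_two_pi_mul_I, mul_one]
    rw [UnitAddTorus.mFourierCoeff_eq_integral F n 0,
      ← integral_Ioc_tsum_translates (0 : Fin m → ℝ) one_pos hint]
    congr 1
    funext x
    change UnitAddTorus.mFourier (-n) (mk x) • F (mk x) = _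
    rw [hmF, hF, smul_eq_mul, ← tsum_mul_left]
    exact tsum_congr fun p => by rw [heper]
  have hsum : Summable (UnitAddTorus.mFourierCoeff F) := by
    rwa [show UnitAddTorus.mFourierCoeff F = _ from funext hcoeff]
  have hfinal := UnitAddTorus.hasSum_mFourier_series_apply_of_summable hsum (mk 0)
  rw [hF, hfin 0 0 (by simp)] at hfinal
  convert hfinal using 1
  · funext n
    rw [hcoeff]
    have : UnitAddTorus.mFourier n (mk 0) = 1 := by
      have := hmF (-n) 0
      rw [neg_neg] at this
      rw [this]
      simp
    rw [this, smul_eq_mul, mul_one]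
  · simp

/-- The periodization of the sinc product is a trigonometric polynomial with rational coefficients. -/
theorem exists_trig_polynomial {m : ℕ} (hm : 2 ≤ m) : ∃ (L : ℕ) (b : (Fin m → ℤ) → ℚ),
    ∀ u : Fin m → ℝ, HasSum (fun p : Fin m → ℤ => (sincProd (shift u p) : ℂ))
      (∑ A ∈ latticeBox m L, (b A : ℂ) * Complex.exp (Complex.I * ((∑ k, A k * u k : ℝ) : ℂ))) := by
  obtain ⟨B, hB, hs⟩ := exists_boxSpline hm
  obtain ⟨R, hR⟩ := hs.supp
  obtain ⟨L, hL⟩ := exists_nat_ge R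
  have hrat : ∀ A : Fin m → ℤ, ∃ r : ℚ, B (fun k => (A k : ℝ)) = r := by
    intro A
    obtain ⟨r, hr⟩ := ratPiecewise_rat hs.mem fun k => (A k : ℚ)
    exact ⟨r, by simpa using hr⟩
  choose b hb using hrat
  refine ⟨L, b, fun u => ?_⟩
  set w : Fin m → ℝ := fun k => u k / (2 * Real.pi) with hw
  have huw : ∀ k, u k = 2 * Real.pi * w k := fun k => by
    simp only [hw]; field_simp
  -- Modulating the spline by the frequency w = u/2π shifts its transform, so that the coefficient
  -- of index n is S(u - 2πn).
  set h : (Fin m → ℝ) → ℂ := fun x =>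
    (B x : ℂ) * Complex.exp (2 * Real.pi * Complex.I * ((∑ k, x k * w k : ℝ) : ℂ)) with hh
  have hcoeff : ∀ n : Fin m → ℤ,
      ∫ x : Fin m → ℝ, Complex.exp (2 * Real.pi * Complex.I * ((-∑ k, x k * n k : ℝ) : ℂ)) * h x =
        (sincProd (shift u (-n)) : ℂ) := by
    intro n
    have h1 : (fun k => 2 * Real.pi * (w k - n k)) = shift u (-n) := by
      funext k
      simp only [shift, huw, Pi.neg_apply]
      push_cast
      ring
    rw [← h1, ← hs.fourier fun k => w k - n k]
    congr 1
    funext x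
    simp only [hh]
    rw [mul_left_comm, ← Complex.exp_add]
    congr 2
    rw [← mul_add]
    congr 1
    rw [← Complex.ofReal_add]
    congr 1
    rw [neg_add_eq_sub, ← Finset.sum_sub_distrib]
    exact Finset.sum_congr rfl fun k _ => by ring
  have hsum := (Complex.hasSum_ofReal.2 (summable_sincProd_shift hm u).hasSum).summable.comp_injective
    (neg_injective (G := Fin m → ℤ))
  have hp := poisson_summation (h := h) (L := L) (by simp only [hh]; fun_prop)
    ((hs.integrable.ofReal (𝕜 := ℂ)).mul_bdd (c := 1)
      (Continuous.aestronglyMeasurable (by fun_prop)) (ae_of_all _ fun x => (norm_exp_two_pi_I _).le))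
    (fun x i hx => by simp [hh, hR x i (hL.trans_lt hx)]) (by simp_rw [hcoeff]; exact hsum)
  simp_rw [hcoeff] at hp
  rw [← (Equiv.neg (Fin m → ℤ)).hasSum_iff]
  convert hp using 1
  · rfl
  refine Finset.sum_congr rfl fun A _ => ?_
  simp only [hh]
  rw [hb]
  congr 2
  simp_rw [huw]
  push_cast
  rw [Finset.mul_sum, Finset.mul_sum]
  exact Finset.sum_congr rfl fun k _ => by ring

end Horn

end

noncomputable section

namespace Horn

/-! ### The conditionally convergent sum in one variable -/

theorem sum_Icc_symm (f : ℤ → ℝ) (N : ℕ) : ∑ p ∈ Finset.Icc (-(N : ℤ)) N, f p =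
    f 0 + ∑ k ∈ Finset.range N, (f ((k : ℤ) + 1) + f (-((k : ℤ) + 1))) := by
  induction N with
  | zero => simp
  | succ N ih =>
    have : Finset.Icc (-((N + 1 : ℕ) : ℤ)) ((N + 1 : ℕ) : ℤ) =
        insert ((N : ℤ) + 1) (insert (-((N : ℤ) + 1)) (Finset.Icc (-(N : ℤ)) N)) := by
      ext p
      simp only [Finset.mem_Icc, Finset.mem_insert]
      push_cast
      omega
    rw [this, Finset.sum_insert, Finset.sum_insert, ih, Finset.sum_range_succ]
    · ring
    · simp
    · simp only [Finset.mem_insert, Finset.mem_Icc]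
      omega

/-- The symmetric partial sums of `sinc (v + πp)`. -/
def sincSum (N : ℕ) (v : ℝ) : ℝ := ∑ p ∈ Finset.Icc (-(N : ℤ)) N, Real.sinc (v + Real.pi * (p : ℝ))

theorem sinc_add_int {v : ℝ} (p : ℤ) (hv : v + Real.pi * (p : ℝ) ≠ 0) :
    Real.sinc (v + Real.pi * (p : ℝ)) = (-1) ^ p * Real.sin v / (v + Real.pi * p) := by
  rw [Real.sinc_of_ne_zero hv, mul_comm Real.pi, Real.sin_add_int_mul_pi]

/-- Pairing p with -p turns terms of order 1/p into 2v sin v/(v² - π²p²) up to sign, a summable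
bound uniform in v. It is the dominating constant for the rank one integrals. -/
theorem abs_sincSum_le (N : ℕ) {v : ℝ} (hv : |v| ≤ Real.pi / 2) :
    |sincSum N v| ≤ 1 + ∑' k : ℕ, 1 / ((k : ℝ) + 1) ^ 2 := by
  have hpi := Real.pi_gt_three
  have hv' := abs_le.1 hv
  have hs : Summable fun k : ℕ => 1 / ((k : ℝ) + 1) ^ 2 := by
    have := (summable_nat_add_iff 1).2 (Real.summable_one_div_nat_pow.2 (one_lt_two))
    simpa using this
  have hterm : ∀ k : ℕ, |Real.sinc (v + Real.pi * (((k : ℤ) + 1 : ℤ) : ℝ)) +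
      Real.sinc (v + Real.pi * ((-((k : ℤ) + 1) : ℤ) : ℝ))| ≤ 1 / ((k : ℝ) + 1) ^ 2 := by
    intro k
    set q : ℝ := (k : ℝ) + 1 with hq
    have hq1 : 1 ≤ q := by rw [hq]; linarith [(Nat.cast_nonneg k : (0 : ℝ) ≤ k)]
    have e1 : (((k : ℤ) + 1 : ℤ) : ℝ) = q := by push_cast [hq]; rfl
    have e2 : ((-((k : ℤ) + 1) : ℤ) : ℝ) = -q := by push_cast [hq]; ring
    have n1 : v + Real.pi * q ≠ 0 := by nlinarith
    have n2 : v - Real.pi * q ≠ 0 := by nlinarith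
    have e3 : v + Real.pi * -q = v - Real.pi * q := by ring
    rw [sinc_add_int _ (by rw [e1]; exact n1), sinc_add_int _ (by rw [e2, e3]; exact n2), e1, e2,
      zpow_neg, ← inv_zpow, e3]
    norm_num only
    have h1 : (-1 : ℝ) ^ ((k : ℤ) + 1) * Real.sin v / (v + Real.pi * q) +
        (-1 : ℝ) ^ ((k : ℤ) + 1) * Real.sin v / (v - Real.pi * q) =
        (-1 : ℝ) ^ ((k : ℤ) + 1) * Real.sin v * (2 * v / (v ^ 2 - Real.pi ^ 2 * q ^ 2)) := by
      have n3 : v ^ 2 - Real.pi ^ 2 * q ^ 2 ≠ 0 := by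
        have : v ^ 2 - Real.pi ^ 2 * q ^ 2 = (v + Real.pi * q) * (v - Real.pi * q) := by ring
        rw [this]; exact mul_ne_zero n1 n2
      field_simp
      ring
    rw [h1, abs_mul, abs_mul, abs_zpow, abs_neg, abs_one, one_zpow, one_mul, abs_div]
    have hv2 : v ^ 2 ≤ Real.pi ^ 2 / 4 := by nlinarith
    have hq2 : 1 ≤ q ^ 2 := one_le_pow₀ hq1
    have hq3 : Real.pi ^ 2 ≤ Real.pi ^ 2 * q ^ 2 := le_mul_of_one_le_right (by positivity) hq2
    have hq4 : 3 * (Real.pi * q ^ 2) ≤ Real.pi * (Real.pi * q ^ 2) :=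
      mul_le_mul_of_nonneg_right hpi.le (by positivity)
    have hneg : v ^ 2 - Real.pi ^ 2 * q ^ 2 < 0 := by nlinarith
    have h2 : |2 * v| / |v ^ 2 - Real.pi ^ 2 * q ^ 2| ≤ 1 / q ^ 2 := by
      rw [abs_of_neg hneg, div_le_div_iff₀ (by linarith) (by positivity), abs_mul, abs_two]
      have : |v| * q ^ 2 ≤ Real.pi / 2 * q ^ 2 := by gcongr
      nlinarith
    calc |Real.sin v| * (|2 * v| / |v ^ 2 - Real.pi ^ 2 * q ^ 2|) ≤ 1 * (1 / q ^ 2) :=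
          mul_le_mul (Real.abs_sin_le_one v) h2 (by positivity) zero_le_one
      _ = 1 / q ^ 2 := one_mul _
  rw [sincSum, sum_Icc_symm fun p => Real.sinc (v + Real.pi * (p : ℝ))]
  refine (abs_add_le _ _).trans (add_le_add (Real.abs_sinc_le_one _) ?_)
  refine (Finset.abs_sum_le_sum_abs _ _).trans ?_
  exact (Finset.sum_le_sum fun k _ => hterm k).trans (hs.sum_le_tsum _ fun k _ => by positivity)

/-- In the cotangent series, the terms at even integers form half of the series at x/2. The
alternating sum is twice that part minus the whole, and cot(y/2) - cot y = 1/sin y. -/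
theorem hasSum_alternating_cotTerm {x : ℂ} (hx : x ∈ Complex.integerComplement) :
    HasSum (fun n : ℕ => (-1 : ℂ) ^ (n + 1) * (1 / (x - (n + 1)) + 1 / (x + (n + 1))))
      (Real.pi / Complex.sin (Real.pi * x) - 1 / x) := by
  have hx2 : x / 2 ∈ Complex.integerComplement := by
    rintro ⟨k, hk⟩
    exact hx ⟨2 * k, by push_cast; rw [hk]; ring⟩
  set c : ℕ → ℂ := fun n => 1 / (x - (n + 1)) + 1 / (x + (n + 1)) with hc
  have hsum : Summable c := summable_cotTerm hx
  have hT : HasSum c (Real.pi * Complex.cot (Real.pi * x) - 1 / x) := by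
    rw [cot_series_rep' hx]; exact hsum.hasSum
  have hO : HasSum (fun k : ℕ => c (2 * k + 1))
      (1 / 2 * (Real.pi * Complex.cot (Real.pi * (x / 2)) - 1 / (x / 2))) := by
    rw [cot_series_rep' hx2]
    have h := (summable_cotTerm hx2).hasSum.mul_left (1 / 2)
    suffices hfun : (fun k : ℕ => c (2 * k + 1)) = fun k => 1 / 2 * cotTerm (x / 2) k by
      rw [hfun]; exact h
    funext k
    have h1 : ∀ y : ℂ, 1 / (2 * y) = 1 / 2 * (1 / y) := fun y => by rw [one_div_mul_one_div]
    simp only [hc, cotTerm]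
    rw [mul_add, ← h1, ← h1]
    congr 2 <;> push_cast <;> ring
  have hEsum : Summable fun k : ℕ => c (2 * k) :=
    hsum.comp_injective fun a b h => by simpa using h
  obtain ⟨E, hE⟩ := hEsum
  have hEO := hE.even_add_odd hO
  have hEeq := hEO.unique hT
  have hfin := HasSum.even_add_odd (f := fun n : ℕ => (-1 : ℂ) ^ (n + 1) * c n)
    (m := -E) (m' := 1 / 2 * (Real.pi * Complex.cot (Real.pi * (x / 2)) - 1 / (x / 2)))
    (by
      have : (fun k : ℕ => (-1 : ℂ) ^ (2 * k + 1) * c (2 * k)) = fun k => -c (2 * k) := by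
        funext k; simp [pow_succ, pow_mul]
      rw [this]; exact hE.neg)
    (by
      have : (fun k : ℕ => (-1 : ℂ) ^ (2 * k + 1 + 1) * c (2 * k + 1)) = fun k => c (2 * k + 1) := by
        funext k; simp [pow_succ, pow_mul]
      rw [this]; exact hO)
  convert hfin using 1
  have hx0 : x ≠ 0 := Complex.integerComplement.ne_zero hx
  have hs2 : Complex.sin (Real.pi * (x / 2)) ≠ 0 := sin_pi_mul_ne_zero hx2
  have hs1 : Complex.sin (Real.pi * x) ≠ 0 := sin_pi_mul_ne_zero hx
  have hcot : Complex.cot (Real.pi * (x / 2)) - Complex.cot (Real.pi * x) =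
      1 / Complex.sin (Real.pi * x) := by
    have e : (Real.pi : ℂ) * x = 2 * (Real.pi * (x / 2)) := by ring
    rw [e, Complex.sin_two_mul] at hs1
    have hc2 : Complex.cos (Real.pi * (x / 2)) ≠ 0 := fun h => hs1 (by rw [h, mul_zero])
    rw [e, Complex.cot_eq_cos_div_sin, Complex.cot_eq_cos_div_sin, Complex.sin_two_mul,
      Complex.cos_two_mul]
    field_simp
    ring
  have h3 : (1 : ℂ) / (x / 2) = 2 * (1 / x) := by field_simp
  rw [h3] at hEeq ⊢
  have h4 : (Real.pi : ℂ) / Complex.sin (Real.pi * x) =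
      Real.pi * (Complex.cot (Real.pi * (x / 2)) - Complex.cot (Real.pi * x)) := by
    rw [hcot]; ring
  rw [h4]
  linear_combination hEeq

/-- With x = v/π the partial sums are sin v/π times those of the cosecant series, plus the central
term sin v/v. This is the statement R_2 = 1. -/
theorem tendsto_sincSum {v : ℝ} (hv : Real.sin v ≠ 0) :
    Tendsto (fun N => sincSum N v) atTop (𝓝 1) := by
  have hne : ∀ p : ℤ, v + Real.pi * (p : ℝ) ≠ 0 := by
    intro p h
    apply hv
    rw [Real.sin_eq_zero_iff]
    exact ⟨-p, by push_cast; linarith⟩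
  set x : ℂ := ((v / Real.pi : ℝ) : ℂ) with hx
  have hxc : x ∈ Complex.integerComplement := by
    rintro ⟨k, hk⟩
    rw [hx] at hk
    have h1 : (k : ℝ) = v / Real.pi := by exact_mod_cast hk
    apply hne (-k)
    push_cast
    rw [h1]
    field_simp
    ring
  have hpi := Real.pi_ne_zero
  have hpic : (Real.pi : ℂ) ≠ 0 := by exact_mod_cast hpi
  have hsvc : Complex.sin v ≠ 0 := by exact_mod_cast hv
  have hv0 : v ≠ 0 := fun h => hv (by rw [h, Real.sin_zero])
  have h1 := (hasSum_alternating_cotTerm hxc).mul_left (Complex.sin v / Real.pi)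
  have hpx : (Real.pi : ℂ) * x = v := by rw [hx]; push_cast; field_simp
  rw [hpx] at h1
  have h2 := h1.tendsto_sum_nat
  have h3 : ∀ N, ((sincSum N v : ℝ) : ℂ) = Complex.sin v / v + ∑ k ∈ Finset.range N,
      Complex.sin v / Real.pi * ((-1 : ℂ) ^ (k + 1) * (1 / (x - (k + 1)) + 1 / (x + (k + 1)))) := by
    intro N
    rw [sincSum, sum_Icc_symm fun p => Real.sinc (v + Real.pi * (p : ℝ))]
    push_cast
    congr 1
    · rw [mul_zero, add_zero, Real.sinc_of_ne_zero hv0]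
      push_cast
      rfl
    · refine Finset.sum_congr rfl fun k _ => ?_
      have n1 := hne ((k : ℤ) + 1)
      have n2 := hne (-((k : ℤ) + 1))
      have s1 := sinc_add_int _ n1
      have s2 := sinc_add_int _ n2
      push_cast at n1 n2 s1 s2
      rw [s1, s2]
      have n1' : (v : ℂ) + Real.pi * (k + 1) ≠ 0 := by exact_mod_cast n1
      have n2' : (v : ℂ) - Real.pi * (k + 1) ≠ 0 := by
        intro h
        apply n2
        have : v - Real.pi * (k + 1) = 0 := by exact_mod_cast h
        linarith
      have e1 : x - (k + 1) = (v - Real.pi * (k + 1)) / Real.pi := by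
        rw [← hpx]; field_simp
      have e2 : x + (k + 1) = (v + Real.pi * (k + 1)) / Real.pi := by
        rw [← hpx]; field_simp
      have e3 : (-1 : ℂ) ^ (-((k : ℤ) + 1)) = (-1) ^ (k + 1) := by
        rw [zpow_neg, ← inv_zpow]; norm_num; exact_mod_cast rfl
      have e4 : (-1 : ℂ) ^ ((k : ℤ) + 1) = (-1) ^ (k + 1) := by exact_mod_cast rfl
      push_cast
      have e5 : (v : ℂ) + Real.pi * (-1 + -k) = v - Real.pi * (k + 1) := by ring
      rw [e1, e2]
      simp only [neg_add_rev] at *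
      rw [e5]
      simp only [e3, e4]
      field_simp
      ring
  have h4 : Tendsto (fun N => ((sincSum N v : ℝ) : ℂ)) atTop (𝓝 ((1 : ℝ) : ℂ)) := by
    simp_rw [h3]
    have := h2.const_add (Complex.sin v / v)
    convert this using 2
    have hvc : (v : ℂ) ≠ 0 := by exact_mod_cast hv0
    rw [← hpx] at hvc ⊢
    have hxc0 : x ≠ 0 := right_ne_zero_of_mul hvc
    rw [← hpx] at hsvc
    push_cast
    field_simp
    ring
  simpa [Function.comp_def] using (Complex.continuous_re.tendsto _).comp h4

end Horn

end

noncomputable section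

namespace Horn

/-! ### The symmetric polynomial -/

theorem tvar_castSucc_sub {m : ℕ} (u : Fin m → ℝ) (k : Fin m) :
    tvar u k.castSucc - tvar u k.succ = u k := by
  rw [tvar_eq, tvar_eq, sub_sub_sub_cancel_right, tailSum_castSucc_sub]

theorem torusEntry_zero {m : ℕ} : torusEntry (0 : Fin m → ℝ) = fun _ => 1 := by
  funext i
  simp [torusEntry, tvar]

theorem exp_sum_tvar {m : ℕ} (e : Fin (m + 1) → ℕ) (u : Fin m → ℝ) :
    ∏ i, torusEntry u i ^ e i = Complex.exp (Complex.I * ((∑ i, (e i : ℝ) * tvar u i : ℝ) : ℂ)) := by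
  simp only [torusEntry, ← Complex.exp_nat_mul, ← Complex.exp_sum]
  push_cast
  rw [Finset.mul_sum]
  congr 1
  exact Finset.sum_congr rfl fun i _ => by ring

/-- Exponents of the torus coordinates in the character `u ↦ e^{i ∑ A_k u_k}`, made nonnegative. -/
def laurentExp {m : ℕ} (L : ℕ) (A : Fin m → ℤ) : Fin (m + 1) →₀ ℕ :=
  Finsupp.equivFunOnFinite.symm fun i =>
    (Fin.snoc (α := fun _ => ℤ) A 0 i - Fin.cons (α := fun _ => ℤ) 0 A i + 2 * L).toNat

/-- As u_k = t_k - t_{k+1}, the exponent of e^{i t_i} is A_i - A_{i-1}, which is at least -2L on the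
box; so `toNat` truncates nothing. The shift by 2L is invisible on the torus, where the coordinates
have product 1, and it gives all monomials the same degree. -/
theorem laurentExp_cast {m L : ℕ} {A : Fin m → ℤ} (hA : A ∈ latticeBox m L) (i : Fin (m + 1)) :
    (laurentExp L A i : ℤ) =
      Fin.snoc (α := fun _ => ℤ) A 0 i - Fin.cons (α := fun _ => ℤ) 0 A i + 2 * L := by
  have h : ∀ k, -(L : ℤ) ≤ A k ∧ A k ≤ L := by
    simpa [latticeBox, Fintype.mem_piFinset] using hA
  refine Int.toNat_of_nonneg ?_
  have h1 : -(L : ℤ) ≤ Fin.snoc (α := fun _ => ℤ) A 0 i := by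
    refine Fin.lastCases ?_ (fun k => ?_) i
    · simp
    · simpa using (h k).1
  have h2 : Fin.cons (α := fun _ => ℤ) 0 A i ≤ L := by
    refine Fin.cases ?_ (fun k => ?_) i
    · simp
    · simpa using (h k).2
  linarith

theorem sum_laurentExp {m L : ℕ} {A : Fin m → ℤ} (hA : A ∈ latticeBox m L) :
    ∑ i, laurentExp L A i = (m + 1) * (2 * L) := by
  zify
  simp_rw [laurentExp_cast hA]
  rw [Finset.sum_add_distrib, Finset.sum_sub_distrib, Fin.sum_univ_castSucc, Fin.sum_univ_succ (n := m)]
  simp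

theorem sum_laurentExp_tvar {m L : ℕ} {A : Fin m → ℤ} (hA : A ∈ latticeBox m L) (u : Fin m → ℝ) :
    ∑ i, (laurentExp L A i : ℝ) * tvar u i = ∑ k, (A k : ℝ) * u k := by
  have h : ∀ i, (laurentExp L A i : ℝ) = (Fin.snoc (α := fun _ => ℤ) A 0 i : ℤ) -
      (Fin.cons (α := fun _ => ℤ) 0 A i : ℤ) + 2 * L := by
    intro i
    have := laurentExp_cast hA i
    exact_mod_cast this
  simp_rw [h, add_mul, sub_mul]
  rw [Finset.sum_add_distrib, Finset.sum_sub_distrib, ← Finset.mul_sum, sum_tvar,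
    Fin.sum_univ_castSucc, Fin.sum_univ_succ (n := m)]
  simp only [Fin.snoc_castSucc, Fin.snoc_last, Fin.cons_zero, Fin.cons_succ]
  simp only [Int.cast_zero, zero_mul, add_zero, zero_add, mul_zero]
  rw [← Finset.sum_sub_distrib]
  exact Finset.sum_congr rfl fun k _ => by rw [← mul_sub, tvar_castSucc_sub]

/-- A permutation acts bijectively on the lattice and fixes the sinc product, so the periodization
is invariant. -/
theorem hasSum_sincProd_permAct {m : ℕ} {u : Fin m → ℝ} {s : ℂ} (w : Equiv.Perm (Fin (m + 1)))
    (h : HasSum (fun p : Fin m → ℤ => (sincProd (shift (permAct w u) p) : ℂ)) s) :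
    HasSum (fun p : Fin m → ℤ => (sincProd (shift u p) : ℂ)) s := by
  rw [← (permActEquiv (R := ℤ) w).toEquiv.hasSum_iff] at h
  convert h using 2 with p
  simp only [Function.comp_apply, LinearEquiv.coe_toEquiv, permActEquiv_apply]
  rw [← permAct_shift, sincProd_permAct]

/-- Off the conditionally convergent case, the periodized sinc product is a symmetric homogeneous
polynomial with rational coefficients in the torus coordinates. -/
theorem exists_periodization_polynomial {m : ℕ} (hm : m ≠ 1) :
    ∃ (N : ℕ) (R : MvPolynomial (Fin (m + 1)) ℚ), R.IsSymmetric ∧ R.IsHomogeneous N ∧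
      ∀ u : Fin m → ℝ, HasSum (fun p : Fin m → ℤ => (sincProd (shift u p) : ℂ))
        (MvPolynomial.aeval (torusEntry u) R) := by
  rcases Nat.eq_zero_or_pos m with rfl | hpos
  · refine ⟨0, 1, MvPolynomial.IsSymmetric.one, MvPolynomial.isHomogeneous_one _ _, fun u => ?_⟩
    rw [map_one]
    convert hasSum_unique (fun p : Fin 0 → ℤ => (sincProd (shift u p) : ℂ)) using 1
    simp [sincProd, pairProd, Finset.filter_singleton]
  obtain ⟨L, b, hb⟩ := exists_trig_polynomial (m := m) (by omega)
  set R₀ : MvPolynomial (Fin (m + 1)) ℚ :=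
    ∑ A ∈ latticeBox m L, MvPolynomial.monomial (laurentExp L A) (b A) with hR₀
  have hval : ∀ u : Fin m → ℝ, MvPolynomial.aeval (torusEntry u) R₀ =
      ∑ A ∈ latticeBox m L, (b A : ℂ) * Complex.exp (Complex.I * ((∑ k, A k * u k : ℝ) : ℂ)) := by
    intro u
    rw [hR₀, map_sum]
    refine Finset.sum_congr rfl fun A hA => ?_
    rw [MvPolynomial.aeval_monomial, Finsupp.prod_fintype _ _ (by simp), exp_sum_tvar,
      sum_laurentExp_tvar hA]
    simp
  -- The values of R₀ on the torus are already invariant. Averaging over renamings makes the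
  -- polynomial itself symmetric and leaves these values unchanged.
  set G := ∑ w : Equiv.Perm (Fin (m + 1)), MvPolynomial.rename w R₀ with hG
  refine ⟨(m + 1) * (2 * L), MvPolynomial.C (1 / ((m + 1).factorial : ℚ)) * G, ?_, ?_, ?_⟩
  · refine MvPolynomial.IsSymmetric.mul (MvPolynomial.IsSymmetric.C _) fun e => ?_
    rw [hG, map_sum]
    simp_rw [MvPolynomial.rename_rename]
    exact Fintype.sum_equiv (Equiv.mulLeft e) _ _ fun w => rfl
  · rw [← zero_add ((m + 1) * (2 * L))]
    refine (MvPolynomial.isHomogeneous_C _ _).mul (MvPolynomial.IsHomogeneous.sum _ _ _ fun w _ => ?_)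
    refine MvPolynomial.IsHomogeneous.rename_isHomogeneous
      (MvPolynomial.IsHomogeneous.sum _ _ _ fun A hA => MvPolynomial.isHomogeneous_monomial _ ?_)
    rw [Finsupp.degree_eq_sum]
    exact sum_laurentExp hA
  · intro u
    have hw : ∀ w : Equiv.Perm (Fin (m + 1)),
        MvPolynomial.aeval (torusEntry u) (MvPolynomial.rename w R₀) =
          MvPolynomial.aeval (torusEntry u) R₀ := by
      intro w
      have h1 : (torusEntry u) ∘ w = torusEntry (permAct w u) := by
        funext i; simp [torusEntry_permAct]
      rw [MvPolynomial.aeval_rename, h1, hval, hval]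
      exact (hasSum_sincProd_permAct w (hb (permAct w u))).unique (hb u)
    have hf : ((m + 1).factorial : ℂ) ≠ 0 := by exact_mod_cast (m + 1).factorial_ne_zero
    have h2 : MvPolynomial.aeval (torusEntry u) (MvPolynomial.C (1 / ((m + 1).factorial : ℚ)) * G) =
        MvPolynomial.aeval (torusEntry u) R₀ := by
      rw [map_mul, hG, map_sum, Finset.sum_congr rfl fun w _ => hw w, Finset.sum_const,
        Finset.card_univ, Fintype.card_perm, Fintype.card_fin, MvPolynomial.aeval_C, nsmul_eq_mul]
      simp only [eq_ratCast]
      push_cast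
      field_simp
    rw [h2, hval]
    exact hb u

theorem monotone_latticeBox (m : ℕ) : Monotone (latticeBox m) := by
  intro a b hab
  refine Fintype.piFinset_subset _ _ fun _ => Finset.Icc_subset_Icc ?_ ?_ <;> simpa using hab

theorem tendsto_latticeBox (m : ℕ) : Tendsto (latticeBox m) atTop atTop := by
  refine tendsto_atTop_finset_of_monotone (monotone_latticeBox m) fun p => ?_
  refine ⟨∑ i, (p i).natAbs, ?_⟩
  simp only [latticeBox, Fintype.mem_piFinset, Finset.mem_Icc]
  intro i
  have := Finset.single_le_sum (f := fun i => (p i).natAbs) (fun _ _ => Nat.zero_le _)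
    (Finset.mem_univ i)
  push_cast
  have h2 : ((p i).natAbs : ℤ) ≤ ∑ i, ((p i).natAbs : ℤ) := by exact_mod_cast this
  simp only [Int.natCast_natAbs] at h2
  exact abs_le.1 h2

theorem hasLatticeSum_of_hasSum {m : ℕ} {u : Fin m → ℝ} (hu : Regular u) {s : ℝ}
    (h : HasSum (fun p : Fin m → ℤ => sincProd (shift u p)) s) : HasLatticeSum u (s / varpi u) := by
  have h1 : HasSum (latticeTerm u) (s / varpi u) := by
    refine (h.div_const (varpi u)).congr_fun fun p => ?_
    rw [← latticeTerm_mul_varpi hu, mul_div_cancel_right₀ _ hu.varpi_ne_zero]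
  exact ⟨fun _ => h1.summable, h1.comp (tendsto_latticeBox m)⟩

/-- Some simple root takes a nonzero multiple of 2π as value, where sinc of the half vanishes. Only
p = 0 contributes at the identity, which gives the normalization. -/
theorem sincProd_shift_zero {m : ℕ} {p : Fin m → ℤ} (hp : p ≠ 0) :
    sincProd (shift (0 : Fin m → ℝ) p) = 0 := by
  obtain ⟨k, hk⟩ := Function.ne_iff.1 hp
  refine Finset.prod_eq_zero (Finset.mem_univ k.castSucc)
    (Finset.prod_eq_zero (i := k.succ) (by simp [Fin.lt_def]) ?_)
  beta_reduce
  rw [pairSum_shift _ _ Fin.castSucc_lt_succ, tailSum_castSucc_sub]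
  have h0 : pairSum (0 : Fin m → ℝ) k.castSucc k.succ = 0 := by simp [pairSum]
  have hk' : (p k : ℝ) ≠ 0 := by exact_mod_cast hk
  rw [h0, sinc_half _ (by simp [hk', Real.pi_ne_zero])]
  have : (0 + 2 * Real.pi * (p k : ℝ)) / 2 = p k * Real.pi := by ring
  rw [this, Real.sin_int_mul_pi]
  simp

theorem sincProd_shift_zero_zero {m : ℕ} : sincProd (shift (0 : Fin m → ℝ) 0) = 1 := by
  simp [sincProd, pairProd, pairSum, shift]

theorem sincProd_fin_one (u : Fin 1 → ℝ) : sincProd u = Real.sinc (u 0 / 2) := by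
  have h : ∀ i : Fin 2, Finset.univ.filter (fun i' : Fin 2 => i < i') = if i = 0 then {1} else ∅ := by
    decide
  simp [sincProd, pairProd, h, Fin.prod_univ_two, pairSum_eq, tailSum]

/-- The sum over boxes in rank one. -/
theorem sum_latticeBox_one (u : Fin 1 → ℝ) (N : ℕ) :
    ∑ p ∈ latticeBox 1 N, sincProd (shift u p) = sincSum N (u 0 / 2) := by
  refine Finset.sum_nbij' (fun p => p 0) (fun k _ => k) ?_ ?_ ?_ ?_ ?_
  · intro p hp
    simp only [latticeBox, Fintype.mem_piFinset] at hp
    exact hp 0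
  · intro k hk
    simpa [latticeBox] using hk
  · intro p _
    funext i
    rw [Subsingleton.elim i 0]
  · intro k _
    rfl
  · intro p _
    rw [sincProd_fin_one, shift]
    congr 1
    ring

/-- Collects what the rest needs about the polynomial in every rank. For m = 1 the periodization is
only conditionally summable, so R = 1 is taken outright there and the `HasSum` clause is restricted
to m ≠ 1. -/
theorem exists_core (m : ℕ) :
    ∃ (N : ℕ) (R : MvPolynomial (Fin (m + 1)) ℚ), R.IsSymmetric ∧ R.IsHomogeneous N ∧
      (m ≠ 1 → ∀ u : Fin m → ℝ, HasSum (fun p : Fin m → ℤ => (sincProd (shift u p) : ℂ))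
        (MvPolynomial.aeval (torusEntry u) R)) ∧ (m = 1 → R = 1) ∧
      (∀ u : Fin m → ℝ, (starRingEnd ℂ) (MvPolynomial.aeval (torusEntry u) R) =
        MvPolynomial.aeval (torusEntry u) R) ∧
      (∀ u : Fin m → ℝ, Regular u → ∃ D : ℝ, HasLatticeSum u D ∧
        MvPolynomial.aeval (torusEntry u) R = ((D * varpi u : ℝ) : ℂ)) ∧
      MvPolynomial.eval (fun _ => (1 : ℚ)) R = 1 := by
  by_cases hm : m = 1
  · subst hm
    refine ⟨0, 1, MvPolynomial.IsSymmetric.one, MvPolynomial.isHomogeneous_one _ _,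
      fun h => absurd rfl h, fun _ => rfl, by simp, fun u hu => ?_, by simp⟩
    refine ⟨1 / varpi u, ⟨fun h => absurd rfl h, ?_⟩, ?_⟩
    · have hs : Real.sin (u 0 / 2) ≠ 0 := by
        intro h
        rw [Real.sin_eq_zero_iff] at h
        obtain ⟨k, hk⟩ := h
        apply hu 0 1 (by simp) k
        rw [pairSum_eq (by simp)]
        simp [tailSum]
        linarith
      have h1 := (tendsto_sincSum hs).div_const (varpi u)
      convert h1 using 2 with N
      rw [← sum_latticeBox_one, Finset.sum_div]
      refine Finset.sum_congr rfl fun p _ => ?_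
      rw [← latticeTerm_mul_varpi hu, mul_div_cancel_right₀ _ hu.varpi_ne_zero]
    · rw [map_one, one_div, inv_mul_cancel₀ hu.varpi_ne_zero]
      simp
  obtain ⟨N, R, hsym, hhom, hsum⟩ := exists_periodization_polynomial hm
  have hreal : ∀ u : Fin m → ℝ, ∃ s : ℝ, HasSum (fun p : Fin m → ℤ => sincProd (shift u p)) s ∧
      MvPolynomial.aeval (torusEntry u) R = (s : ℂ) := by
    intro u
    have h1 := Complex.hasSum_re (hsum u)
    simp only [Complex.ofReal_re] at h1
    exact ⟨_, h1, (hsum u).unique (Complex.hasSum_ofReal.2 h1)⟩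
  refine ⟨N, R, hsym, hhom, fun _ => hsum, fun h => absurd h hm, fun u => ?_, fun u hu => ?_, ?_⟩
  · obtain ⟨s, _, hs⟩ := hreal u
    rw [hs, Complex.conj_ofReal]
  · obtain ⟨s, h1, hs⟩ := hreal u
    exact ⟨s / varpi u, hasLatticeSum_of_hasSum hu h1, by
      rw [hs, div_mul_cancel₀ _ hu.varpi_ne_zero]⟩
  · obtain ⟨s, h1, hs⟩ := hreal 0
    have h2 : s = 1 := by
      rw [← sincProd_shift_zero_zero (m := m)]
      exact h1.unique (hasSum_single 0 fun p hp => sincProd_shift_zero hp)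
    rw [h2, torusEntry_zero] at hs
    have h3 : MvPolynomial.aeval (fun _ => (1 : ℂ)) R =
        ((MvPolynomial.eval (fun _ => (1 : ℚ)) R : ℚ) : ℂ) := by
      have := MvPolynomial.aeval_algebraMap_apply ℂ (fun _ : Fin (m + 1) => (1 : ℚ)) R
      have e : MvPolynomial.aeval (fun _ : Fin (m + 1) => (1 : ℚ)) R =
          MvPolynomial.eval (fun _ => (1 : ℚ)) R := by
        rw [← MvPolynomial.coe_aeval_eq_eval]; rfl
      rw [e] at this
      simpa [Function.comp_def] using this
    rw [h3] at hs
    exact_mod_cast hs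

end Horn

end

noncomputable section

namespace Horn

/-! ### Alternants -/

section Alternants

open MvPolynomial

variable {m : ℕ}

theorem irreducible_X_sub_X {i j : Fin (m + 1)} (h : i ≠ j) :
    Irreducible (X i - X j : MvPolynomial (Fin (m + 1)) ℂ) := by
  have hc : coeff (Finsupp.single i 1) (X i - X j : MvPolynomial (Fin (m + 1)) ℂ) = 1 := by
    rw [coeff_sub, coeff_X, coeff_X, if_pos rfl, if_neg, sub_zero]
    intro h2
    exact h (Finsupp.single_left_injective one_ne_zero h2).symm
  refine irreducible_of_totalDegree_eq_one ?_ fun x hx => ?_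
  · refine ((isHomogeneous_X ℂ i).sub (isHomogeneous_X ℂ j)).totalDegree ?_
    intro h0
    rw [h0] at hc
    simp at hc
  · have := hx (Finsupp.single i 1)
    rw [hc] at this
    exact isUnit_of_dvd_one this

/-- At a point where X_i = X_j = 0 and the other coordinates are distinct and nonzero, the second
factor does not vanish, so the irreducible first one cannot divide it. -/
theorem isRelPrime_X_sub_X {i j k l : Fin (m + 1)} (h : i < j) (h' : k < l) (hne : i ≠ k ∨ j ≠ l) :
    IsRelPrime (X i - X j : MvPolynomial (Fin (m + 1)) ℂ) (X k - X l) := by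
  rw [(irreducible_X_sub_X h.ne).isRelPrime_iff_not_dvd]
  rintro ⟨q, hq⟩
  have h1 := congrArg (eval fun t : Fin (m + 1) =>
    if t = i ∨ t = j then (0 : ℂ) else ((t : ℕ) : ℂ) + 1) hq
  simp only [map_sub, map_mul, eval_X, true_or, or_true, if_true, sub_self, zero_mul] at h1
  rw [sub_eq_zero] at h1
  have hp : ∀ n : ℕ, (n : ℂ) + 1 ≠ 0 := fun n => by exact_mod_cast n.succ_ne_zero
  split_ifs at h1 with h2 h3 h3
  · rcases h2 with rfl | rfl <;> rcases h3 with rfl | rfl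
    · exact lt_irrefl _ h'
    · simp at hne
    · exact lt_asymm h h'
    · exact lt_irrefl _ h'
  · exact hp _ h1.symm
  · exact hp _ h1
  · have : (k : ℕ) = l := by exact_mod_cast add_right_cancel h1
    exact h'.ne (Fin.ext this)

/-- Modulo X_i - X_j two rows of the matrix coincide. -/
theorem X_sub_X_dvd_alternant (e : Fin (m + 1) → ℕ) {i j : Fin (m + 1)} (h : i ≠ j) :
    (X i - X j : MvPolynomial (Fin (m + 1)) ℂ) ∣ (Matrix.of fun i k => X i ^ e k).det := by
  rw [← Ideal.mem_span_singleton, ← Ideal.Quotient.eq_zero_iff_mem, RingHom.map_det]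
  refine Matrix.det_zero_of_row_eq h ?_
  funext k
  simp only [RingHom.mapMatrix_apply, Matrix.map_apply, Matrix.of_apply, map_pow]
  congr 1
  rw [Ideal.Quotient.eq, Ideal.mem_span_singleton]

theorem vandermonde_dvd_alternant (e : Fin (m + 1) → ℕ) :
    pairProd (fun i j => (X i - X j : MvPolynomial (Fin (m + 1)) ℂ)) ∣
      (Matrix.of fun i k => X i ^ e k).det := by
  rw [pairProd, Finset.prod_sigma']
  refine Finset.prod_dvd_of_isRelPrime ?_ ?_
  · rintro ⟨i, j⟩ hij ⟨k, l⟩ hkl hne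
    simp only [Finset.coe_sigma, Set.mem_sigma_iff, Finset.coe_filter, Set.mem_ofPred_eq,
      Finset.mem_univ, true_and, Finset.coe_univ, Set.mem_univ] at hij hkl
    refine isRelPrime_X_sub_X hij hkl ?_
    by_contra! h
    exact hne (Sigma.ext h.1 (heq_of_eq h.2))
  · rintro ⟨i, j⟩ hij
    simp only [Finset.mem_sigma, Finset.mem_univ, true_and, Finset.mem_filter] at hij
    exact X_sub_X_dvd_alternant e hij.ne

theorem norm_aeval_torusEntry_le (q : MvPolynomial (Fin (m + 1)) ℂ) (u : Fin m → ℝ) :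
    ‖aeval (torusEntry u) q‖ ≤ ∑ d ∈ q.support, ‖coeff d q‖ := by
  rw [aeval_def, eval₂_eq']
  refine (norm_sum_le _ _).trans (Finset.sum_le_sum fun d _ => ?_)
  rw [norm_mul, norm_prod]
  simp [norm_torusEntry]

theorem continuous_torusEntry (i : Fin (m + 1)) : Continuous fun u : Fin m → ℝ => torusEntry u i := by
  unfold torusEntry tvar
  fun_prop

theorem continuous_aeval_torusEntry {R : Type*} [CommRing R] [Algebra R ℂ]
    (q : MvPolynomial (Fin (m + 1)) R) :
    Continuous fun u : Fin m → ℝ => aeval (torusEntry u) q := by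
  simp_rw [aeval_def, eval₂_eq']
  have := continuous_torusEntry (m := m)
  fun_prop

/-- The alternating sum of a monomial in the torus coordinates is a bounded multiple of the
Vandermonde determinant. -/
theorem exists_alternant_quotient (e : Fin (m + 1) → ℕ) :
    ∃ χ : (Fin m → ℝ) → ℂ, Continuous χ ∧ (∃ C, ∀ u, ‖χ u‖ ≤ C) ∧ ∀ u,
      ∑ w : Equiv.Perm (Fin (m + 1)), ((Equiv.Perm.sign w : ℤ) : ℂ) *
        ∏ k, torusEntry u (w k) ^ e k = χ u * vandExp u := by
  obtain ⟨q, hq⟩ := vandermonde_dvd_alternant (m := m) e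
  refine ⟨fun u => aeval (torusEntry u) q, continuous_aeval_torusEntry q,
    ⟨_, norm_aeval_torusEntry_le q⟩, fun u => ?_⟩
  have h := congrArg (aeval (torusEntry u)) hq
  rw [Matrix.det_apply, map_sum, map_mul, pairProd] at h
  simp only [map_prod, map_sub, aeval_X, Units.smul_def, zsmul_eq_mul, map_mul, Matrix.of_apply,
    map_pow, map_intCast] at h
  rw [h, mul_comm]
  rfl

end Alternants

/-! ### Plane waves attached to compatible weights -/

theorem sum_young {m : ℕ} (wt : Fin (m + 1) → ℤ) :
    ∑ i, young wt i = ∑ k : Fin (m + 1), ((k.val : ℤ) + 1) * wt k := by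
  simp only [young, Finset.sum_filter]
  rw [Finset.sum_comm]
  refine Finset.sum_congr rfl fun k _ => ?_
  rw [← Finset.sum_filter, Finset.sum_const, nsmul_eq_mul, Finset.filter_ge_eq_Iic, Fin.card_Iic]
  push_cast
  rfl

theorem two_mul_sum_weylVector (m : ℕ) :
    2 * ∑ k : Fin (m + 1), ((k.val : ℤ) + 1) * weylVector m k = (m + 1) * m := by
  rw [Fin.sum_univ_castSucc]
  simp only [weylVector, Fin.snoc_castSucc, Fin.snoc_last, mul_one, mul_zero, add_zero,
    Fin.val_castSucc]
  rw [Fin.sum_univ_eq_sum_range (fun k => (k : ℤ) + 1)]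
  induction m with
  | zero => simp
  | succ m ih => rw [Finset.sum_range_succ, mul_add, ih]; push_cast; ring

/-- The properties of the plane waves used for the principal values. -/
structure AlternatingWave {m : ℕ} (W : (Fin m → ℝ) → ℂ) : Prop where
  cont : Continuous W
  norm_eq : ∀ u, ‖W u‖ = 1
  shift_eq : ∀ u p, W (shift u p) =
    (-1) ^ (∑ j : Fin m, ((j.val : ℤ) + 1) * p j * (m : ℤ)) * W u
  alt : ∃ χ : (Fin m → ℝ) → ℂ, Continuous χ ∧ (∃ C, ∀ u, ‖χ u‖ ≤ C) ∧ ∀ u,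
    ∑ w : Equiv.Perm (Fin (m + 1)), ((Equiv.Perm.sign w : ℤ) : ℂ) * W (permAct w u) =
      χ u * vandExp u

theorem tvar_shift {m : ℕ} (u : Fin m → ℝ) (p : Fin m → ℤ) (i : Fin (m + 1)) :
    tvar (shift u p) i = tvar u i + 2 * Real.pi * ((tailSum p i : ℤ) -
      ((∑ k : Fin m, ((k.val : ℤ) + 1) * p k : ℤ) : ℝ) / ((m : ℝ) + 1)) := by
  have h : ∑ k : Fin m, ((k.val : ℝ) + 1) * shift u p k = ∑ k : Fin m, ((k.val : ℝ) + 1) * u k +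
      2 * Real.pi * ∑ k : Fin m, ((k.val : ℝ) + 1) * p k := by
    rw [Finset.mul_sum, ← Finset.sum_add_distrib]
    exact Finset.sum_congr rfl fun k _ => by rw [shift]; ring
  rw [tvar_eq, tvar_eq, tailSum_shift, h]
  push_cast
  ring

/-- Translation by 2πp changes the phase by 2π times an integer minus 2π (∑ x_k) S/n, where S = ∑ j
p_j. The condition on the total turns the last term into π(n-1)S, that is, into the sign of the
lattice sum. -/
theorem alternatingWave_exp {m : ℕ} (x : Fin (m + 1) → ℤ) (hx : 2 * ∑ k, x k = (m + 1) * m) :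
    AlternatingWave fun u : Fin m → ℝ =>
      Complex.exp (Complex.I * ((∑ k, (x k : ℝ) * tvar u k : ℝ) : ℂ)) where
  cont := by unfold tvar; fun_prop
  norm_eq u := by rw [mul_comm, Complex.norm_exp_ofReal_mul_I]
  shift_eq u p := by
    set S : ℤ := ∑ k : Fin m, ((k.val : ℤ) + 1) * p k with hS
    have hx' : (∑ k, (x k : ℝ)) = (m + 1) * m / 2 := by
      have : 2 * ∑ k, (x k : ℝ) = (m + 1) * m := by exact_mod_cast hx
      linarith
    have hm : (m : ℝ) + 1 ≠ 0 := by positivity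
    have h1 : ∑ k, (x k : ℝ) * tvar (shift u p) k = ∑ k, (x k : ℝ) * tvar u k +
        (2 * Real.pi * ((∑ k, x k * tailSum p k : ℤ) : ℝ) - Real.pi * ((m * S : ℤ) : ℝ)) := by
      simp_rw [tvar_shift, ← hS]
      have : ∀ k, (x k : ℝ) * (tvar u k + 2 * Real.pi * ((tailSum p k : ℤ) - (S : ℝ) / (m + 1))) =
          x k * tvar u k + (2 * Real.pi * (x k * (tailSum p k : ℤ)) -
            x k * (2 * Real.pi * (S / (m + 1)))) := fun k => by ring
      simp_rw [this]
      rw [Finset.sum_add_distrib, Finset.sum_sub_distrib, ← Finset.mul_sum, ← Finset.sum_mul, hx']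
      push_cast
      field_simp
    have h2 : ∑ j : Fin m, ((j.val : ℤ) + 1) * p j * (m : ℤ) = m * S := by
      rw [hS, ← Finset.sum_mul, mul_comm]
    rw [h1, h2, Complex.ofReal_add, mul_add, Complex.exp_add, mul_comm]
    congr 1
    have h3 : Complex.I * ((2 * Real.pi * ((∑ k, x k * tailSum p k : ℤ) : ℝ) -
        Real.pi * ((m * S : ℤ) : ℝ) : ℝ) : ℂ) = ((∑ k, x k * tailSum p k : ℤ) : ℂ) *
        (2 * Real.pi * Complex.I) + ((-(m * S) : ℤ) : ℂ) * (Real.pi * Complex.I) := by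
      push_cast; ring
    rw [h3, Complex.exp_add, Complex.exp_int_mul_two_pi_mul_I, one_mul, Complex.exp_int_mul,
      Complex.exp_pi_mul_I, zpow_neg, ← inv_zpow]
    norm_num
  alt := by
    -- Adding a constant to all exponents makes them natural numbers and changes nothing, as ∑ t_k =
    -- 0.
    set c : ℕ := ∑ k, (x k).natAbs with hc
    have hnn : ∀ k, 0 ≤ x k + c := by
      intro k
      have h1 : (x k).natAbs ≤ c :=
        Finset.single_le_sum (f := fun k => (x k).natAbs) (fun _ _ => Nat.zero_le _) (Finset.mem_univ k)
      omega
    obtain ⟨χ, h1, h2, h3⟩ := exists_alternant_quotient fun k => (x k + c).toNat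
    refine ⟨χ, h1, h2, fun u => ?_⟩
    rw [← h3 u]
    refine Finset.sum_congr rfl fun w _ => ?_
    congr 1
    have h4 : ∏ k, torusEntry u (w k) ^ (x k + c).toNat =
        ∏ k, torusEntry (permAct w u) k ^ (x k + c).toNat := by
      simp_rw [torusEntry_permAct]
    have h5 : ∀ k, (((x k + c).toNat : ℕ) : ℝ) = x k + c := by
      intro k
      have := Int.toNat_of_nonneg (hnn k)
      exact_mod_cast congrArg (Int.cast : ℤ → ℝ) this
    rw [h4, exp_sum_tvar]
    simp_rw [h5, add_mul]
    rw [Finset.sum_add_distrib, ← Finset.mul_sum, sum_tvar, mul_zero, add_zero]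

/-- By compatibility the weights cancel in the total of the exponents, leaving ρ + ρ - ρ: one Weyl
vector, of total n(n-1)/2. -/
theorem alternatingWave_planeWave {m : ℕ} {wl wm wn : Fin (m + 1) → ℤ} (h : Compatible wl wm wn)
    (P P' P'' : Equiv.Perm (Fin (m + 1))) :
    AlternatingWave (planeWave (expA
      (fun i => (young (wl + weylVector m) i : ℝ)) (fun i => (young (wm + weylVector m) i : ℝ))
      (fun i => (young (wn + weylVector m) i : ℝ)) P P' P'')) := by
  set x : Fin (m + 1) → ℤ := fun k => young (wl + weylVector m) (P k) +
    young (wm + weylVector m) (P' k) - young (wn + weylVector m) (P'' k) with hx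
  have hsum : ∀ {R : Type} [CommRing R] (a b c : Fin (m + 1) → R),
      ∑ k, (a (P k) + b (P' k) - c (P'' k)) = ∑ k, (a k + b k - c k) := by
    intro R _ a b c
    rw [Finset.sum_sub_distrib, Finset.sum_add_distrib, Equiv.sum_comp P a, Equiv.sum_comp P' b,
      Equiv.sum_comp P'' c, Finset.sum_sub_distrib, Finset.sum_add_distrib]
  have h1 : 2 * ∑ k, x k = (m + 1) * m := by
    rw [hx, hsum, Finset.sum_sub_distrib, Finset.sum_add_distrib, sum_young, sum_young, sum_young,
      ← two_mul_sum_weylVector]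
    congr 1
    rw [← sub_eq_zero, ← h, ← Finset.sum_add_distrib, ← Finset.sum_sub_distrib,
      ← Finset.sum_sub_distrib]
    refine Finset.sum_congr rfl fun k _ => ?_
    simp only [Pi.add_apply]
    ring
  convert alternatingWave_exp x h1 using 1
  funext u
  rw [← planeWave_eq]
  congr 1
  funext j
  rw [expA, ← hsum]
  simp [hx]

end Horn

end

noncomputable section

namespace Horn

/-! ### Symmetrization of the singular integrands -/

section

variable {m : ℕ}

theorem ae_pairSum_ne {i i' : Fin (m + 1)} (h : i < i') (c : ℝ) :
    ∀ᵐ u : Fin m → ℝ, pairSum u i i' ≠ c := by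
  let φ : (Fin m → ℝ) →ₗ[ℝ] ℝ :=
    { toFun := fun u => tailSum u i - tailSum u i'
      map_add' := fun u v => by rw [tailSum_add, tailSum_add]; ring
      map_smul' := fun a u => by
        rw [tailSum_smul, tailSum_smul, RingHom.id_apply, smul_eq_mul]; ring }
  have hφ : ∀ u, pairSum u i i' = φ u := fun u => pairSum_eq h
  by_cases hex : ∃ u₀ : Fin m → ℝ, pairSum u₀ i i' = c
  swap
  · exact ae_of_all _ fun u hu => hex ⟨u, hu⟩
  obtain ⟨u₀, hu₀⟩ := hex
  have hker : LinearMap.ker φ ≠ ⊤ := by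
    rw [Ne, LinearMap.ker_eq_top]
    intro h0
    have hlt : (i : ℕ) < i' := h
    have h1 := hφ (Pi.single ⟨i, by omega⟩ 1)
    rw [h0, pairSum, Finset.sum_eq_single ⟨i, by omega⟩] at h1
    · simp at h1
    · intro b _ hb
      simp [hb]
    · simp [hlt]
  have hs := Measure.addHaar_affineSubspace (volume : Measure (Fin m → ℝ))
    (AffineSubspace.mk' u₀ (LinearMap.ker φ)) (fun htop => hker (by
      rw [← AffineSubspace.direction_mk' u₀ (LinearMap.ker φ), htop, AffineSubspace.direction_top]))
  refine measure_mono_null (fun u hu => ?_) hs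
  simp only [ne_eq, Set.mem_compl_iff, Set.mem_ofPred_eq, not_not] at hu
  rw [SetLike.mem_coe, AffineSubspace.mem_mk', LinearMap.mem_ker, vsub_eq_sub, map_sub, ← hφ, ← hφ,
    hu, hu₀, sub_self]

theorem ae_regular : ∀ᵐ u : Fin m → ℝ, Regular u := by
  simp only [Regular, ae_all_iff]
  exact fun i i' h k => ae_pairSum_ne h _

theorem Regular.pairSum_ne_zero {u : Fin m → ℝ} (hu : Regular u) {i i' : Fin (m + 1)} (h : i < i') :
    pairSum u i i' ≠ 0 := by
  simpa using hu i i' h 0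

theorem measurable_vandU : Measurable (vandU : (Fin m → ℝ) → ℝ) := by
  unfold vandU
  have := measurable_pairSum (m := m)
  fun_prop

/-- Invariance under permutations of the `t_i`. -/
def PermInvariant (S : Set (Fin m → ℝ)) : Prop := ∀ w u, u ∈ S → permAct w u ∈ S

theorem PermInvariant.preimage_eq {S : Set (Fin m → ℝ)} (hS : PermInvariant S)
    (w : Equiv.Perm (Fin (m + 1))) : permAct w ⁻¹' S = S := by
  ext u
  refine ⟨fun h => ?_, fun h => hS w u h⟩
  have := hS w⁻¹ _ h
  rwa [permAct_permAct, mul_inv_cancel, permAct_one] at this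

theorem setIntegral_symmetrize {S : Set (Fin m → ℝ)} (hS : PermInvariant S)
    {f : (Fin m → ℝ) → ℂ} (hf : IntegrableOn f S) :
    ∫ u in S, f u = ∫ u in S, ((m + 1).factorial : ℂ)⁻¹ *
      ∑ w : Equiv.Perm (Fin (m + 1)), f (permAct w u) := by
  have h1 : ∀ w : Equiv.Perm (Fin (m + 1)), ∫ u in S, f (permAct w u) = ∫ u in S, f u := by
    intro w
    have := (measurePreserving_permAct w).setIntegral_preimage_emb (measurableEmbedding_permAct w) f S
    rwa [hS.preimage_eq] at this
  have h2 : ∀ w : Equiv.Perm (Fin (m + 1)), IntegrableOn (fun u => f (permAct w u)) S := by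
    intro w
    have := (measurePreserving_permAct w).integrableOn_comp_preimage (measurableEmbedding_permAct w)
      (f := f) (s := S)
    rw [hS.preimage_eq] at this
    exact this.2 hf
  rw [integral_const_mul, integral_finsetSum _ fun w _ => h2 w, Finset.sum_congr rfl fun w _ => h1 w,
    Finset.sum_const, Finset.card_univ, Fintype.card_perm, Fintype.card_fin, nsmul_eq_mul]
  have : ((m + 1).factorial : ℂ) ≠ 0 := by exact_mod_cast (m + 1).factorial_ne_zero
  field_simp

variable {W χ : (Fin m → ℝ) → ℂ}

/-- The symmetrized integrand. -/
def symKernel (χ : (Fin m → ℝ) → ℂ) (u : Fin m → ℝ) : ℂ :=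
  Complex.I ^ ((m + 1) * m / 2) * ((m + 1).factorial : ℂ)⁻¹ * χ u * sincProd u

/-- Since Δ̃ is alternating, averaging over the group produces χ Δ(e^{it})/Δ̃, a constant times χ S:
the poles disappear. The invariant weight g is 1 except in the compact integral of rank one. -/
theorem setIntegral_wave_eq (hχ : ∀ u, ∑ w : Equiv.Perm (Fin (m + 1)),
      ((Equiv.Perm.sign w : ℤ) : ℂ) * W (permAct w u) = χ u * vandExp u)
    {S : Set (Fin m → ℝ)} (hSm : MeasurableSet S) (hS : PermInvariant S)
    (h0 : ∀ u ∈ S, ∀ i i' : Fin (m + 1), i < i' → pairSum u i i' ≠ 0) {g : (Fin m → ℝ) → ℂ}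
    (hg : ∀ w u, g (permAct w u) = g u) (hf : IntegrableOn (fun u => g u * (W u / (vandU u : ℂ))) S) :
    ∫ u in S, g u * (W u / (vandU u : ℂ)) = ∫ u in S, g u * symKernel χ u := by
  rw [setIntegral_symmetrize hS hf]
  refine setIntegral_congr_fun hSm fun u hu => ?_
  have h1 : ∀ w : Equiv.Perm (Fin (m + 1)), g (permAct w u) * (W (permAct w u) /
      (vandU (permAct w u) : ℂ)) = (((Equiv.Perm.sign w : ℤ) : ℂ) * W (permAct w u)) *
        (g u * (vandU u : ℂ)⁻¹) := by
    intro w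
    rw [hg, vandU_permAct]
    rcases Int.units_eq_one_or (Equiv.Perm.sign w) with h | h <;> simp [h] <;> ring
  simp_rw [h1]
  rw [← Finset.sum_mul, hχ, vandExp_eq, symKernel, sincProd_eq (h0 u hu)]
  push_cast
  ring

theorem norm_div_vandU_le (hW : ∀ u, ‖W u‖ = 1) {ε : ℝ} (hε : 0 < ε) {u : Fin m → ℝ}
    (hu : ∀ i i' : Fin (m + 1), i < i' → ε < |pairSum u i i'|) :
    ‖W u / (vandU u : ℂ)‖ ≤ (ε ^ ((m + 1) * m / 2))⁻¹ := by
  rw [norm_div, hW, Complex.norm_real, Real.norm_eq_abs, one_div]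
  refine inv_anti₀ (by positivity) ?_
  rw [vandU_eq_pairProd, abs_pairProd, ← pairProd_const]
  exact pairProd_mono (fun _ _ _ => hε.le) fun i i' h => (hu i i' h).le

/-- The truncated Weyl-invariant regions. -/
def cutRegion (m : ℕ) (ε M : ℝ) : Set (Fin m → ℝ) :=
  {u | ∀ i i' : Fin (m + 1), i < i' → ε < |pairSum u i i'| ∧ |pairSum u i i'| < M}

theorem measurableSet_cutRegion (ε M : ℝ) : MeasurableSet (cutRegion m ε M) := by
  have h := measurable_pairSum (m := m)
  simp only [cutRegion, Set.ofPred_forall]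
  refine MeasurableSet.iInter fun i => MeasurableSet.iInter fun i' => MeasurableSet.iInter fun _ => ?_
  exact (measurableSet_lt measurable_const (h i i').abs).inter
    (measurableSet_lt (h i i').abs measurable_const)

theorem permInvariant_cutRegion (ε M : ℝ) : PermInvariant (cutRegion m ε M) := fun w _ hu =>
  forall_pairs_permAct (S := fun x => ε < |x| ∧ |x| < M) (fun x => by simp) w hu

theorem cutRegion_ne_zero {ε M : ℝ} (hε : 0 ≤ ε) {u : Fin m → ℝ} (hu : u ∈ cutRegion m ε M)
    (i i' : Fin (m + 1)) (h : i < i') : pairSum u i i' ≠ 0 :=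
  abs_pos.1 (hε.trans_lt (hu i i' h).1)

theorem pairSum_succ (u : Fin m → ℝ) (k : Fin m) : pairSum u k.castSucc k.succ = u k := by
  rw [pairSum_eq Fin.castSucc_lt_succ, tailSum_castSucc_sub]

theorem volume_cutRegion_lt_top (ε M : ℝ) : volume (cutRegion m ε M) < ⊤ := by
  refine (measure_mono (t := Set.univ.pi fun _ : Fin m => Set.Icc (-M) M) fun u hu => ?_).trans_lt
    (isCompact_univ_pi fun _ => isCompact_Icc).measure_lt_top
  intro k _
  have := (hu k.castSucc k.succ Fin.castSucc_lt_succ).2.le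
  rw [pairSum_succ] at this
  exact abs_le.1 this

theorem integrableOn_cutRegion (hW : AlternatingWave W) {ε M : ℝ} (hε : 0 < ε) :
    IntegrableOn (fun u => W u / (vandU u : ℂ)) (cutRegion m ε M) := by
  refine Measure.integrableOn_of_bounded (M := (ε ^ ((m + 1) * m / 2))⁻¹)
    (volume_cutRegion_lt_top ε M).ne ?_ ?_
  · exact (hW.cont.measurable.div
      (Complex.measurable_ofReal.comp measurable_vandU)).aestronglyMeasurable
  · exact (ae_restrict_iff' (measurableSet_cutRegion ε M)).2
      (ae_of_all _ fun u hu => norm_div_vandU_le hW.norm_eq hε fun i i' h => (hu i i' h).1)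

theorem setIntegral_cutRegion (hW : AlternatingWave W)
    (hχ : ∀ u, ∑ w : Equiv.Perm (Fin (m + 1)),
      ((Equiv.Perm.sign w : ℤ) : ℂ) * W (permAct w u) = χ u * vandExp u) {ε M : ℝ} (hε : 0 < ε) :
    ∫ u in cutRegion m ε M, W u / (vandU u : ℂ) = ∫ u in cutRegion m ε M, symKernel χ u := by
  have := setIntegral_wave_eq hχ (measurableSet_cutRegion ε M) (permInvariant_cutRegion ε M)
    (fun u hu => cutRegion_ne_zero hε.le hu) (g := 1) (fun _ _ => rfl)
    (by simpa using integrableOn_cutRegion hW hε)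
  simpa using this

/-- With an integrable kernel every cut-off exhausting almost all points gives the same limit, so
both principal values can be compared with the integral over the whole space. -/
theorem integrable_symKernel (hm : m ≠ 1) (hc : Continuous χ) {C : ℝ} (hC : ∀ u, ‖χ u‖ ≤ C) :
    Integrable (symKernel χ) := by
  have hs : Integrable fun u : Fin m → ℝ => (sincProd u : ℂ) := by
    refine Integrable.ofReal ?_
    exact ((integrable_decayProd hm).const_mul (3 ^ ((m + 1) * m / 2))).mono'
      continuous_sincProd.aestronglyMeasurable (ae_of_all _ abs_sincProd_le)
  have := (hs.bdd_mul hc.aestronglyMeasurable (ae_of_all _ hC)).const_mul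
    (Complex.I ^ ((m + 1) * m / 2) * ((m + 1).factorial : ℂ)⁻¹)
  refine this.congr (ae_of_all _ fun u => ?_)
  simp only [symKernel]
  ring

theorem tendsto_setIntegral_of_ae {α ι : Type*} [MeasurableSpace α] {μ : Measure α} {l : Filter ι}
    [l.IsCountablyGenerated] {s : ι → Set α} (hs : ∀ i, MeasurableSet (s i)) {f : α → ℂ}
    (hf : Integrable f μ) (h : ∀ᵐ x ∂μ, ∀ᶠ i in l, x ∈ s i) :
    Tendsto (fun i => ∫ x in s i, f x ∂μ) l (𝓝 (∫ x, f x ∂μ)) := by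
  simp_rw [← integral_indicator (hs _)]
  refine tendsto_integral_filter_of_dominated_convergence (fun x => ‖f x‖)
    (Eventually.of_forall fun i => (hf.1.indicator (hs i)))
    (Eventually.of_forall fun i => ae_of_all _ fun x => norm_indicator_le_norm_self _ _) hf.norm ?_
  filter_upwards [h] with x hx
  refine tendsto_const_nhds.congr' ?_
  filter_upwards [hx] with i hi
  rw [Set.indicator_of_mem hi]

theorem eventually_mem_cutRegion {u : Fin m → ℝ}
    (hu : ∀ i i' : Fin (m + 1), i < i' → pairSum u i i' ≠ 0) :
    ∀ᶠ q : ℝ × ℝ in 𝓝[>] 0 ×ˢ atTop, u ∈ cutRegion m q.1 q.2 := by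
  simp only [cutRegion, Set.mem_ofPred_eq, eventually_all]
  intro i i' h
  have h1 : ∀ᶠ ε : ℝ in 𝓝[>] 0, ε < |pairSum u i i'| :=
    nhdsWithin_le_nhds (Iio_mem_nhds (abs_pos.2 (hu i i' h)))
  exact h1.prod_mk (eventually_gt_atTop _)

/-- The principal value over the whole space, off rank one. -/
theorem hasPV_wave (hm : m ≠ 1) (hW : AlternatingWave W) (hc : Continuous χ) {C : ℝ}
    (hC : ∀ u, ‖χ u‖ ≤ C) (hχ : ∀ u, ∑ w : Equiv.Perm (Fin (m + 1)),
      ((Equiv.Perm.sign w : ℤ) : ℂ) * W (permAct w u) = χ u * vandExp u) :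
    HasPV (fun u => W u / (vandU u : ℂ)) (∫ u, symKernel χ u) := by
  have h1 : Tendsto (fun q : ℝ × ℝ => ∫ u in cutRegion m q.1 q.2, symKernel χ u)
      (𝓝[>] 0 ×ˢ atTop) (𝓝 (∫ u, symKernel χ u)) :=
    tendsto_setIntegral_of_ae (fun q : ℝ × ℝ => measurableSet_cutRegion q.1 q.2)
      (integrable_symKernel hm hc hC)
      (ae_regular.mono fun u hu => eventually_mem_cutRegion fun i i' h => hu.pairSum_ne_zero h)
  refine h1.congr' ?_
  have h2 : ∀ᶠ q : ℝ × ℝ in 𝓝[>] 0 ×ˢ atTop, 0 < q.1 :=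
    (eventually_mem_nhdsWithin (a := (0 : ℝ)) (s := Set.Ioi 0)).prod_inl _
  filter_upwards [h2] with q hq
  exact (setIntegral_cutRegion hW hχ hq).symm

/-! ### The principal value over the compact domain. -/

/-- The periodic regions away from the poles. -/
def sinRegion (m : ℕ) (ε : ℝ) : Set (Fin m → ℝ) :=
  {u | ∀ i i' : Fin (m + 1), i < i' → ε < 2 * |Real.sin (pairSum u i i' / 2)|}

theorem measurableSet_sinRegion (ε : ℝ) : MeasurableSet (sinRegion m ε) := by
  have h := measurable_pairSum (m := m)
  simp only [sinRegion, Set.ofPred_forall]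
  refine MeasurableSet.iInter fun i => MeasurableSet.iInter fun i' => MeasurableSet.iInter fun _ => ?_
  refine measurableSet_lt measurable_const (Measurable.const_mul ?_ 2)
  exact (Real.measurable_sin.comp ((h i i').div_const 2)).abs

theorem permInvariant_sinRegion (ε : ℝ) : PermInvariant (sinRegion m ε) := fun w _ hu =>
  forall_pairs_permAct (S := fun x => ε < 2 * |Real.sin (x / 2)|)
    (fun x => by simp [neg_div]) w hu

theorem sinRegion_ne_zero {ε : ℝ} (hε : 0 ≤ ε) {u : Fin m → ℝ} (hu : u ∈ sinRegion m ε)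
    (i i' : Fin (m + 1)) (h : i < i') : pairSum u i i' ≠ 0 := by
  intro h0
  have := hu i i' h
  rw [h0] at this
  simp at this
  linarith

theorem shift_mem_sinRegion {ε : ℝ} {u : Fin m → ℝ} (p : Fin m → ℤ) :
    shift u p ∈ sinRegion m ε ↔ u ∈ sinRegion m ε := by
  simp only [sinRegion, Set.mem_ofPred_eq]
  refine forall_congr' fun i => forall_congr' fun i' => forall_congr' fun h => ?_
  rw [pairSum_shift u p h]
  have : (pairSum u i i' + 2 * Real.pi * ((tailSum p i - tailSum p i' : ℤ) : ℝ)) / 2 =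
      pairSum u i i' / 2 + ((tailSum p i - tailSum p i' : ℤ) : ℝ) * Real.pi := by ring
  rw [this, Real.sin_add_int_mul_pi, abs_mul, abs_zpow]
  simp

theorem regular_of_mem_sinRegion {ε : ℝ} (hε : 0 ≤ ε) {u : Fin m → ℝ} (hu : u ∈ sinRegion m ε) :
    Regular u := by
  intro i i' h k hk
  have := hu i i' h
  rw [hk, show 2 * Real.pi * (k : ℝ) / 2 = k * Real.pi by ring, Real.sin_int_mul_pi] at this
  simp at this
  linarith

/-- On this region ϖ is bounded below and 1/Δ̃ = S/ϖ, so the singular integrand inherits the decay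
of S and is integrable over the unbounded periodic region. -/
theorem norm_div_vandU_le_sincProd (hW : ∀ u, ‖W u‖ = 1) {ε : ℝ} (hε : 0 < ε) {u : Fin m → ℝ}
    (hu : u ∈ sinRegion m ε) :
    ‖W u / (vandU u : ℂ)‖ ≤ (ε ^ ((m + 1) * m / 2))⁻¹ * |sincProd u| := by
  have h1 : ε ^ ((m + 1) * m / 2) ≤ |varpi u| := by
    rw [varpi_eq_pairProd, abs_pairProd, ← pairProd_const]
    refine pairProd_mono (fun _ _ _ => hε.le) fun i i' h => ?_
    rw [abs_mul, abs_two]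
    exact (hu i i' h).le
  have h2 : 0 < ε ^ ((m + 1) * m / 2) := by positivity
  rw [norm_div, hW, Complex.norm_real, Real.norm_eq_abs, one_div,
    sincProd_eq (sinRegion_ne_zero hε.le hu), abs_mul, abs_inv, ← mul_assoc]
  refine le_mul_of_one_le_left (by positivity) ?_
  rw [← div_eq_inv_mul, one_le_div h2]
  exact h1

theorem integrableOn_sinRegion (hm : m ≠ 1) (hW : AlternatingWave W) {ε : ℝ} (hε : 0 < ε) :
    IntegrableOn (fun u => W u / (vandU u : ℂ)) (sinRegion m ε) := by
  refine Integrable.mono' (g := fun u => (ε ^ ((m + 1) * m / 2))⁻¹ *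
    (3 ^ ((m + 1) * m / 2) * decayProd u)) ?_ ?_ ?_
  · exact (((integrable_decayProd hm).const_mul _).const_mul _).integrableOn
  · exact (hW.cont.measurable.div
      (Complex.measurable_ofReal.comp measurable_vandU)).aestronglyMeasurable
  · refine (ae_restrict_iff' (measurableSet_sinRegion ε)).2 (ae_of_all _ fun u hu => ?_)
    refine (norm_div_vandU_le_sincProd hW.norm_eq hε hu).trans ?_
    gcongr
    exact abs_sincProd_le u

theorem compactRegion_eq (ε : ℝ) : {u : Fin m → ℝ | (∀ j, u j ∈ Set.Ioo (-Real.pi) Real.pi) ∧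
      ∀ i i' : Fin (m + 1), i < i' → ε < ‖torusEntry u i - torusEntry u i'‖} =
    (Set.univ.pi fun _ => Set.Ioo (-Real.pi) Real.pi) ∩ sinRegion m ε := by
  ext u
  simp only [Set.mem_ofPred_eq, Set.mem_inter_iff, Set.mem_univ_pi, sinRegion]
  refine and_congr_right fun _ => forall_congr' fun i => forall_congr' fun i' =>
    forall_congr' fun h => ?_
  rw [norm_torusEntry_sub u h]

theorem eventually_mem_sinRegion {u : Fin m → ℝ} (hu : Regular u) :
    ∀ᶠ ε : ℝ in 𝓝[>] 0, u ∈ sinRegion m ε := by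
  simp only [sinRegion, Set.mem_ofPred_eq, eventually_all]
  intro i i' h
  refine nhdsWithin_le_nhds (Iio_mem_nhds (mul_pos two_pos (abs_pos.2 fun h0 => ?_)))
  rw [Real.sin_eq_zero_iff] at h0
  obtain ⟨k, hk⟩ := h0
  exact hu i i' h k (by linarith)

/-- The wave acquires exactly the sign in the lattice sum, so periodizing W/Δ̃ yields W times D_n.
-/
theorem wave_shift_div (hW : AlternatingWave W) (u : Fin m → ℝ) (p : Fin m → ℤ) :
    W (shift u p) / (vandU (shift u p) : ℂ) = W u * (latticeTerm u p : ℂ) := by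
  rw [hW.shift_eq, latticeTerm]
  push_cast
  change _ = W u * (_ * ((vandU (shift u p) : ℝ) : ℂ)⁻¹)
  ring

/-- The principal value over the compact domain, off rank one. -/
theorem hasCompactPV_wave (hm : m ≠ 1) (hW : AlternatingWave W) (hc : Continuous χ) {C : ℝ}
    (hC : ∀ u, ‖χ u‖ ≤ C) (hχ : ∀ u, ∑ w : Equiv.Perm (Fin (m + 1)),
      ((Equiv.Perm.sign w : ℤ) : ℂ) * W (permAct w u) = χ u * vandExp u) {R : (Fin m → ℝ) → ℂ}
    (hR : ∀ u, HasSum (fun p : Fin m → ℤ => (sincProd (shift u p) : ℂ)) (R u)) :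
    HasCompactPV (fun u => W u * (R u / vandExp u))
      ((Complex.I ^ ((m + 1) * m / 2))⁻¹ * ∫ u, symKernel χ u) := by
  set c : ℂ := (Complex.I ^ ((m + 1) * m / 2))⁻¹ with hcdef
  have h1 : Tendsto (fun ε : ℝ => c * ∫ u in sinRegion m ε, symKernel χ u) (𝓝[>] 0)
      (𝓝 (c * ∫ u, symKernel χ u)) :=
    (tendsto_setIntegral_of_ae (fun q => measurableSet_sinRegion q) (integrable_symKernel hm hc hC)
      (ae_regular.mono fun u hu => eventually_mem_sinRegion hu)).const_mul c
  refine h1.congr' ?_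
  filter_upwards [self_mem_nhdsWithin] with ε hε
  have hε' : 0 < ε := hε
  rw [compactRegion_eq]
  set f : (Fin m → ℝ) → ℂ := fun u => W u / (vandU u : ℂ) with hf
  have hfi : IntegrableOn f (sinRegion m ε) := integrableOn_sinRegion hm hW hε'
  have h2 : ∫ u in sinRegion m ε, symKernel χ u = ∫ u, (sinRegion m ε).indicator f u := by
    have := setIntegral_wave_eq hχ (measurableSet_sinRegion ε) (permInvariant_sinRegion ε)
      (fun u hu => sinRegion_ne_zero hε'.le hu) (g := 1) (fun _ _ => rfl)
      (by simpa using hfi)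
    simp only [Pi.one_apply, one_mul] at this
    rw [← this, integral_indicator (measurableSet_sinRegion ε)]
  -- In general the cube is not invariant under the symmetric group, so the symmetrization takes
  -- place on the full periodic region, to which the integral over the cube unfolds.
  have h3 := integral_Ioc_tsum_translates (fun _ : Fin m => -Real.pi) Real.two_pi_pos
    (hfi.integrable_indicator (measurableSet_sinRegion ε))
  have hbox : {x : Fin m → ℝ | ∀ i, x i ∈ Set.Ioc (-Real.pi) (-Real.pi + 2 * Real.pi)} =ᵐ[volume]
      Set.univ.pi fun _ : Fin m => Set.Ioo (-Real.pi) Real.pi := by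
    have e1 : {x : Fin m → ℝ | ∀ i, x i ∈ Set.Ioc (-Real.pi) (-Real.pi + 2 * Real.pi)} =
        Set.univ.pi fun _ : Fin m => Set.Ioc (-Real.pi) Real.pi := by
      ext x
      have : -Real.pi + 2 * Real.pi = Real.pi := by ring
      simp [this]
    rw [e1]
    exact Measure.univ_pi_Ioc_ae_eq_Icc.trans Measure.univ_pi_Ioo_ae_eq_Icc.symm
  rw [h2, ← h3, setIntegral_congr_set hbox, ← integral_const_mul,
    ← setIntegral_indicator (measurableSet_sinRegion ε)]
  refine setIntegral_congr_fun (MeasurableSet.univ_pi fun _ => measurableSet_Ioo) fun u _ => ?_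
  have h4 : (fun p : Fin m → ℤ => (sinRegion m ε).indicator f fun j => u j + 2 * Real.pi * (p j : ℝ)) =
      fun p => (sinRegion m ε).indicator (fun _ => f (shift u p)) u := by
    funext p
    change (sinRegion m ε).indicator f (shift u p) = _
    by_cases hu : u ∈ sinRegion m ε
    · rw [Set.indicator_of_mem hu, Set.indicator_of_mem ((shift_mem_sinRegion p).2 hu)]
    · rw [Set.indicator_of_notMem hu, Set.indicator_of_notMem fun h => hu ((shift_mem_sinRegion p).1 h)]
  rw [h4]
  by_cases hu : u ∈ sinRegion m ε
  · simp only [Set.indicator_of_mem hu]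
    have hreg := regular_of_mem_sinRegion hε'.le hu
    have h5 : ∀ p, f (shift u p) = W u * (varpi u : ℂ)⁻¹ * (sincProd (shift u p) : ℂ) := by
      intro p
      have hv : (varpi u : ℂ) ≠ 0 := by exact_mod_cast hreg.varpi_ne_zero
      rw [hf]
      beta_reduce
      rw [wave_shift_div hW, ← latticeTerm_mul_varpi hreg]
      push_cast
      field_simp
    simp_rw [h5]
    rw [tsum_mul_left, (hR u).tsum_eq, vandExp_eq, hcdef]
    rw [div_eq_mul_inv, mul_inv]
    ring
  · simp [Set.indicator_of_notMem hu]

end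

end Horn

end

noncomputable section

namespace Horn

/-! ### Principal values in rank one -/

theorem zpow_shift_permAct {m : ℕ} (w : Equiv.Perm (Fin (m + 1))) (p : Fin m → ℤ) :
    (-1 : ℝ) ^ (∑ j : Fin m, ((j.val : ℤ) + 1) * permAct w p j * (m : ℤ)) =
      (-1) ^ (∑ j : Fin m, ((j.val : ℤ) + 1) * p j * (m : ℤ)) := by
  rw [← neg_one_zpow_sum_pairs, ← neg_one_zpow_sum_pairs,
    ← pairProd_perm_symm w (F := fun i i' => (-1 : ℝ) ^ (tailSum p i - tailSum p i'))]
  · refine pairProd_congr fun i i' _ => ?_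
    rw [tailSum_permAct, tailSum_permAct, sub_sub_sub_cancel_right]
  · intro i j
    rw [← neg_sub, zpow_neg, ← inv_zpow]
    norm_num

/-- The alternating sum and Δ(e^{it}) pick up the same sign, so χ is periodic where Δ ≠ 0, and
everywhere by density and continuity. -/
theorem alternant_quotient_shift {m : ℕ} {W χ : (Fin m → ℝ) → ℂ} (hW : AlternatingWave W)
    (hc : Continuous χ) (hχ : ∀ u, ∑ w : Equiv.Perm (Fin (m + 1)),
      ((Equiv.Perm.sign w : ℤ) : ℂ) * W (permAct w u) = χ u * vandExp u) (p : Fin m → ℤ)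
    (u : Fin m → ℝ) : χ (shift u p) = χ u := by
  have hd : Dense {u : Fin m → ℝ | Regular u} := Measure.dense_of_ae ae_regular
  have hcs : Continuous fun u : Fin m → ℝ => shift u p := by unfold shift; fun_prop
  refine congrFun (Continuous.ext_on hd (hc.comp hcs) hc fun u hu => ?_) u
  set s : ℝ := (-1) ^ (∑ j : Fin m, ((j.val : ℤ) + 1) * p j * (m : ℤ)) with hs
  have hs0 : (s : ℂ) ≠ 0 := by
    rw [Ne, Complex.ofReal_eq_zero, hs]
    exact zpow_ne_zero _ (by norm_num)
  have hv : vandExp u ≠ 0 := by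
    rw [vandExp_eq]
    exact mul_ne_zero (pow_ne_zero _ Complex.I_ne_zero) (by exact_mod_cast hu.varpi_ne_zero)
  have h1 := hχ (shift u p)
  have h2 : ∀ w : Equiv.Perm (Fin (m + 1)), W (permAct w (shift u p)) = s * W (permAct w u) := by
    intro w
    rw [permAct_shift, hW.shift_eq, hs, ← zpow_shift_permAct w p]
    push_cast
    rfl
  have h3 : vandExp (shift u p) = s * vandExp u := by
    rw [vandExp_eq, vandExp_eq, varpi_shift, hs]
    push_cast
    ring
  simp_rw [h2, mul_left_comm _ (s : ℂ)] at h1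
  rw [← Finset.mul_sum, hχ, h3, mul_left_comm (χ (shift u p))] at h1
  exact (mul_right_cancel₀ hv (mul_left_cancel₀ hs0 h1)).symm

/-! ### Integrals of periodic functions against the sinc kernel on the line. -/

section Line

variable {f : ℝ → ℂ} {C : ℝ}

theorem sincSum_succ (N : ℕ) (v : ℝ) : sincSum (N + 1) v = sincSum N v +
    (Real.sinc (v + Real.pi * (N + 1)) + Real.sinc (v - Real.pi * (N + 1))) := by
  rw [sincSum, sincSum, sum_Icc_symm, sum_Icc_symm, Finset.sum_range_succ, ← add_assoc]
  push_cast
  congr 3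
  ring

theorem continuous_sincSum (N : ℕ) : Continuous (sincSum N) := by
  unfold sincSum
  have := Real.continuous_sinc
  fun_prop

/-- The interval consists of 2N + 1 full periods; each step of the induction adds one at either end.
-/
theorem integral_sinc_eq_sincSum (hf : Continuous f) (hp : ∀ (x : ℝ) (k : ℤ), f (x + 2 * Real.pi * k) = f x)
    (N : ℕ) : ∫ x in (-((2 * N + 1) * Real.pi))..((2 * N + 1) * Real.pi), f x * Real.sinc (x / 2) =
      ∫ x in (-Real.pi)..Real.pi, f x * sincSum N (x / 2) := by
  have hs := Real.continuous_sinc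
  have hF : Continuous fun x => f x * (Real.sinc (x / 2) : ℂ) := by fun_prop
  induction N with
  | zero => simp [sincSum]
  | succ N ih =>
    have hpiece : ∀ k : ℤ, ∫ x in (-Real.pi + 2 * Real.pi * k)..(Real.pi + 2 * Real.pi * k),
        f x * (Real.sinc (x / 2) : ℂ) =
        ∫ x in (-Real.pi)..Real.pi, f x * Real.sinc (x / 2 + Real.pi * k) := by
      intro k
      rw [← intervalIntegral.integral_comp_add_right (fun x => f x * (Real.sinc (x / 2) : ℂ))]
      refine intervalIntegral.integral_congr fun x _ => ?_
      rw [hp]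
      congr 3
      ring
    have h1 := hpiece (N + 1)
    have h2 := hpiece (-(N + 1))
    have hii : ∀ a b, IntervalIntegrable (fun x => f x * (Real.sinc (x / 2) : ℂ)) volume a b :=
      fun a b => hF.intervalIntegrable a b
    have e1 : -Real.pi + 2 * Real.pi * ((N + 1 : ℤ) : ℝ) = (2 * N + 1) * Real.pi := by
      push_cast; ring
    have e2 : Real.pi + 2 * Real.pi * ((N + 1 : ℤ) : ℝ) = (2 * ((N + 1 : ℕ) : ℝ) + 1) * Real.pi := by
      push_cast; ring
    have e3 : -Real.pi + 2 * Real.pi * ((-(N + 1) : ℤ) : ℝ) =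
      -((2 * ((N + 1 : ℕ) : ℝ) + 1) * Real.pi) := by push_cast; ring
    have e4 : Real.pi + 2 * Real.pi * ((-(N + 1) : ℤ) : ℝ) = -((2 * N + 1) * Real.pi) := by
      push_cast; ring
    rw [e1, e2] at h1
    rw [e3, e4] at h2
    rw [← intervalIntegral.integral_add_adjacent_intervals (hii _ ((2 * N + 1) * Real.pi)) (hii _ _),
      ← intervalIntegral.integral_add_adjacent_intervals (hii _ (-((2 * N + 1) * Real.pi))) (hii _ _),
      h1, h2, ih, ← intervalIntegral.integral_add, ← intervalIntegral.integral_add]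
    · refine intervalIntegral.integral_congr fun x _ => ?_
      rw [sincSum_succ]
      push_cast
      have : x / 2 + Real.pi * (-1 + -(N : ℝ)) = x / 2 - Real.pi * (N + 1) := by ring
      simp only [neg_add_rev]
      rw [this]
      ring
    all_goals
      refine Continuous.intervalIntegrable ?_ _ _
      have := continuous_sincSum N
      fun_prop

theorem tendsto_integral_sincSum (hf : Continuous f) (hC : ∀ x, ‖f x‖ ≤ C) :
    Tendsto (fun N : ℕ => ∫ x in (-Real.pi)..Real.pi, f x * (sincSum N (x / 2) : ℂ)) atTop
      (𝓝 (∫ x in (-Real.pi)..Real.pi, f x)) := by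
  refine intervalIntegral.tendsto_integral_filter_of_dominated_convergence
    (fun _ => C * (1 + ∑' k : ℕ, 1 / ((k : ℝ) + 1) ^ 2)) ?_ ?_ ?_ ?_
  · refine Eventually.of_forall fun N => Continuous.aestronglyMeasurable ?_
    have := continuous_sincSum N
    fun_prop
  · refine Eventually.of_forall fun N => ae_of_all _ fun x hx => ?_
    rw [Set.uIoc_of_le (by linarith [Real.pi_pos])] at hx
    rw [norm_mul, Complex.norm_real, Real.norm_eq_abs]
    have h1 : |x / 2| ≤ Real.pi / 2 := by
      rw [abs_le]
      constructor <;> linarith [hx.1, hx.2]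
    exact mul_le_mul (hC x) (abs_sincSum_le N h1) (abs_nonneg _) ((norm_nonneg _).trans (hC x))
  · exact intervalIntegrable_const
  · have h0 : ∀ᵐ x : ℝ, x ≠ 0 := by
      simp [ae_iff]
    filter_upwards [h0] with x hx0 hx
    rw [Set.uIoc_of_le (by linarith [Real.pi_pos])] at hx
    have hsin : Real.sin (x / 2) ≠ 0 := by
      intro h
      rw [Real.sin_eq_zero_iff_of_lt_of_lt (by linarith [hx.1, Real.pi_pos])
        (by linarith [hx.2, Real.pi_pos])] at h
      exact hx0 (by linarith)
    have := (Complex.continuous_ofReal.tendsto _).comp (tendsto_sincSum hsin)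
    simpa using this.const_mul (f x)

/-- A real cut-off M is within π of the odd multiple (2N+1)π of π, where N = ⌊M/2π⌋. The discrepancy
consists of two intervals of length at most π on which the kernel is O(1/N). -/
theorem tendsto_integral_sinc (hf : Continuous f) (hC : ∀ x, ‖f x‖ ≤ C)
    (hp : ∀ (x : ℝ) (k : ℤ), f (x + 2 * Real.pi * k) = f x) :
    Tendsto (fun M : ℝ => ∫ x in (-M)..M, f x * (Real.sinc (x / 2) : ℂ)) atTop
      (𝓝 (∫ x in (-Real.pi)..Real.pi, f x)) := by
  have hs := Real.continuous_sinc
  have hF : Continuous fun x => f x * (Real.sinc (x / 2) : ℂ) := by fun_prop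
  have hii : ∀ a b, IntervalIntegrable (fun x => f x * (Real.sinc (x / 2) : ℂ)) volume a b :=
    fun a b => hF.intervalIntegrable a b
  have hpi := Real.pi_pos
  have hC0 : 0 ≤ C := (norm_nonneg _).trans (hC 0)
  have hNat : Tendsto (fun M : ℝ => ⌊M / (2 * Real.pi)⌋₊) atTop atTop :=
    tendsto_nat_floor_atTop.comp (tendsto_id.atTop_div_const (by positivity))
  have h1 := (tendsto_integral_sincSum hf hC).comp hNat
  simp_rw [Function.comp_def, ← integral_sinc_eq_sincSum hf hp] at h1
  have hbound : ∀ (N : ℕ) (x : ℝ), 1 ≤ N → 2 * Real.pi * N ≤ |x| →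
      ‖f x * (Real.sinc (x / 2) : ℂ)‖ ≤ C / (Real.pi * N) := by
    intro N x hN hx
    have hN' : (1 : ℝ) ≤ N := by exact_mod_cast hN
    have hpos : 0 < |x| := lt_of_lt_of_le (by positivity) hx
    have hx0 : x / 2 ≠ 0 := by simpa using abs_pos.1 hpos
    rw [norm_mul, Complex.norm_real, Real.norm_eq_abs, Real.sinc_of_ne_zero hx0, abs_div, div_eq_mul_inv C]
    refine mul_le_mul (hC x) ?_ (by positivity) hC0
    rw [← one_div]
    refine div_le_div₀ zero_le_one (Real.abs_sin_le_one _) (by positivity) ?_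
    rw [abs_div, abs_two]
    linarith
  have h2 : Tendsto (fun M : ℝ => 2 * C / (⌊M / (2 * Real.pi)⌋₊ : ℝ)) atTop (𝓝 0) :=
    (tendsto_const_nhds.div_atTop (tendsto_natCast_atTop_atTop.comp hNat))
  have h3 : Tendsto (fun M : ℝ => (∫ x in (-M)..M, f x * (Real.sinc (x / 2) : ℂ)) -
      ∫ x in (-((2 * (⌊M / (2 * Real.pi)⌋₊ : ℝ) + 1) * Real.pi))..((2 * (⌊M / (2 * Real.pi)⌋₊ : ℝ) + 1) * Real.pi),
        f x * (Real.sinc (x / 2) : ℂ)) atTop (𝓝 0) := by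
    refine squeeze_zero_norm' ?_ h2
    filter_upwards [hNat.eventually_ge_atTop 1, eventually_gt_atTop 0] with M hN hM
    set N := ⌊M / (2 * Real.pi)⌋₊ with hNdef
    have hN' : (1 : ℝ) ≤ N := by exact_mod_cast hN
    have hle : 2 * Real.pi * N ≤ M := by
      have := Nat.floor_le (a := M / (2 * Real.pi)) (by positivity)
      rw [le_div_iff₀ (by positivity)] at this
      linarith
    have hlt : M < 2 * Real.pi * N + 2 * Real.pi := by
      have := Nat.lt_floor_add_one (M / (2 * Real.pi))
      rw [div_lt_iff₀ (by positivity)] at this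
      rw [← hNdef] at this
      linarith
    set K := (2 * (N : ℝ) + 1) * Real.pi with hK
    have hK2 : 2 * Real.pi * N ≤ K := by rw [hK]; nlinarith
    have hKM : |M - K| ≤ Real.pi := by
      rw [abs_le, hK]
      constructor <;> nlinarith
    have hsplit : (∫ x in (-M)..M, f x * (Real.sinc (x / 2) : ℂ)) -
        ∫ x in (-K)..K, f x * (Real.sinc (x / 2) : ℂ) =
        (∫ x in (-M)..(-K), f x * (Real.sinc (x / 2) : ℂ)) +
          ∫ x in K..M, f x * (Real.sinc (x / 2) : ℂ) := by
      rw [← intervalIntegral.integral_add_adjacent_intervals (hii (-M) (-K)) (hii _ _),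
        ← intervalIntegral.integral_add_adjacent_intervals (hii (-K) K) (hii _ _)]
      ring
    rw [hsplit]
    have b1 : ‖∫ x in K..M, f x * (Real.sinc (x / 2) : ℂ)‖ ≤ C / (Real.pi * N) * |M - K| := by
      refine intervalIntegral.norm_integral_le_of_norm_le_const fun x hx => hbound N x hN ?_
      have : min K M < x := hx.1
      exact (le_min hK2 hle).trans (this.le.trans (le_abs_self x))
    have b2 : ‖∫ x in (-M)..(-K), f x * (Real.sinc (x / 2) : ℂ)‖ ≤
        C / (Real.pi * N) * |-K - -M| := by
      refine intervalIntegral.norm_integral_le_of_norm_le_const fun x hx => hbound N x hN ?_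
      have : x ≤ max (-M) (-K) := hx.2
      have h4 : max (-M) (-K) ≤ -(2 * Real.pi * N) := max_le (by linarith) (by linarith)
      exact (by linarith : 2 * Real.pi * N ≤ -x).trans (neg_le_abs x)
    have e : -K - -M = M - K := by ring
    rw [e] at b2
    have hc : 0 ≤ C / (Real.pi * N) := by positivity
    calc _ ≤ C / (Real.pi * N) * |M - K| + C / (Real.pi * N) * |M - K| :=
          (norm_add_le _ _).trans (add_le_add b2 b1)
      _ ≤ C / (Real.pi * N) * Real.pi + C / (Real.pi * N) * Real.pi := by gcongr
      _ = 2 * C / N := by field_simp; ring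
  simpa using h3.add h1

theorem tendsto_integral_cut (hf : Continuous f) (hC : ∀ x, ‖f x‖ ≤ C) {L : ℂ}
    (h : Tendsto (fun M : ℝ => ∫ x in (-M)..M, f x) atTop (𝓝 L)) :
    Tendsto (fun q : ℝ × ℝ => ∫ x in {x : ℝ | q.1 < |x| ∧ |x| < q.2}, f x)
      (𝓝[>] 0 ×ˢ atTop) (𝓝 L) := by
  have hii : ∀ a b, IntervalIntegrable f volume a b := fun a b => hf.intervalIntegrable a b
  have h1 : Tendsto (fun ε : ℝ => ∫ x in (-ε)..ε, f x) (𝓝[>] 0) (𝓝 0) := by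
    refine squeeze_zero_norm (a := fun ε => C * |ε - -ε|)
      (fun ε => intervalIntegral.norm_integral_le_of_norm_le_const fun x _ => hC x) ?_
    have : Tendsto (fun ε : ℝ => C * |ε - -ε|) (𝓝 0) (𝓝 (C * |(0 : ℝ) - -0|)) :=
      Continuous.tendsto (by fun_prop) 0
    simp only [neg_zero, sub_zero, abs_zero, mul_zero] at this
    exact this.mono_left nhdsWithin_le_nhds
  have h2 := (h.comp tendsto_snd).sub (h1.comp (tendsto_fst (f := 𝓝[>] (0 : ℝ)) (g := (atTop : Filter ℝ))))
  rw [sub_zero] at h2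
  refine h2.congr' ?_
  have e1 : ∀ᶠ q : ℝ × ℝ in 𝓝[>] 0 ×ˢ atTop, 0 < q.1 ∧ q.1 < 1 :=
    Eventually.prod_inl (la := 𝓝[>] (0 : ℝ)) (p := fun x => 0 < x ∧ x < 1)
      (Ioo_mem_nhdsGT one_pos) _
  have e2 : ∀ᶠ q : ℝ × ℝ in 𝓝[>] 0 ×ˢ atTop, 1 < q.2 := (eventually_gt_atTop 1).prod_inr _
  filter_upwards [e1, e2] with q hq1 hq2
  have hset : {x : ℝ | q.1 < |x| ∧ |x| < q.2} = Set.Ioo (-q.2) q.2 \ Set.Icc (-q.1) q.1 := by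
    ext x
    simp only [Set.mem_ofPred_eq, Set.mem_sdiff, Set.mem_Ioo, Set.mem_Icc, ← abs_le, ← abs_lt, not_le]
    exact and_comm
  rw [hset, setIntegral_sdiff measurableSet_Icc (hf.integrableOn_Icc.mono_set Set.Ioo_subset_Icc_self)
    (fun x hx => ⟨by linarith [hx.1], by linarith [hx.2]⟩), integral_Icc_eq_integral_Ioc,
    ← integral_Ioc_eq_integral_Ioo, ← intervalIntegral.integral_of_le (by linarith),
    ← intervalIntegral.integral_of_le (by linarith)]
  rfl

end Line

theorem setIntegral_fin_one (S : Set (Fin 1 → ℝ)) (F : (Fin 1 → ℝ) → ℂ) :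
    ∫ u in S, F u = ∫ x in {x : ℝ | (fun _ => x) ∈ S}, F fun _ => x := by
  have := (volume_preserving_funUnique (Fin 1) ℝ).symm.setIntegral_preimage_emb
    (MeasurableEquiv.funUnique (Fin 1) ℝ).symm.measurableEmbedding F S
  exact this.symm

theorem forall_pairs_fin_one {S : ℝ → Prop} (u : Fin 1 → ℝ) :
    (∀ i i' : Fin 2, i < i' → S (pairSum u i i')) ↔ S (u 0) := by
  have h : pairSum u 0 1 = u 0 := pairSum_succ u 0
  constructor
  · intro H
    rw [← h]
    exact H 0 1 (by simp)
  · intro H i i' hi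
    have h0 : i = 0 := by omega
    have h1 : i' = 1 := by omega
    rw [h0, h1, h]
    exact H

/-! ### The two principal values for n = 2. -/

section RankOne

variable {W χ : (Fin 1 → ℝ) → ℂ} {C : ℝ}

theorem hasPV_wave_one (hW : AlternatingWave W) (hc : Continuous χ)
    (hC : ∀ u, ‖χ u‖ ≤ C) (hχ : ∀ u, ∑ w : Equiv.Perm (Fin (1 + 1)),
      ((Equiv.Perm.sign w : ℤ) : ℂ) * W (permAct w u) = χ u * vandExp u) :
    HasPV (fun u => W u / (vandU u : ℂ))
      (Complex.I * (2⁻¹ * ∫ x in (-Real.pi)..Real.pi, χ fun _ => x)) := by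
  set f : ℝ → ℂ := fun x => Complex.I * 2⁻¹ * χ fun _ => x with hf
  have hfc : Continuous f := by rw [hf]; fun_prop
  have hfC : ∀ x, ‖f x‖ ≤ C := fun x => by
    rw [hf]
    beta_reduce
    rw [norm_mul, norm_mul, Complex.norm_I, norm_inv]
    have := hC fun _ => x
    have h0 := norm_nonneg (χ fun _ => x)
    norm_num
    linarith
  have hper : ∀ (x : ℝ) (k : ℤ), f (x + 2 * Real.pi * k) = f x := fun x k => by
    rw [hf]
    beta_reduce
    rw [← alternant_quotient_shift hW hc hχ (fun _ => k) fun _ => x]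
    rfl
  have hs := Real.continuous_sinc
  have h1 := tendsto_integral_cut (f := fun x => f x * (Real.sinc (x / 2) : ℂ)) (C := C)
    (by fun_prop) (fun x => by
      rw [norm_mul, Complex.norm_real]
      exact (mul_le_of_le_one_right (norm_nonneg _) (Real.abs_sinc_le_one _)).trans (hfC x))
    (tendsto_integral_sinc hfc hfC hper)
  rw [hf, intervalIntegral.integral_const_mul, mul_assoc] at h1
  refine h1.congr' ?_
  have h2 : ∀ᶠ q : ℝ × ℝ in 𝓝[>] 0 ×ˢ atTop, 0 < q.1 :=
    (eventually_mem_nhdsWithin (a := (0 : ℝ)) (s := Set.Ioi 0)).prod_inl _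
  filter_upwards [h2] with q hq
  have h3 := setIntegral_cutRegion hW hχ (M := q.2) hq
  rw [setIntegral_fin_one _ (symKernel χ)] at h3
  refine Eq.trans ?_ h3.symm
  have hset : {x : ℝ | (fun _ => x) ∈ cutRegion 1 q.1 q.2} = {x : ℝ | q.1 < |x| ∧ |x| < q.2} := by
    ext x
    exact forall_pairs_fin_one (S := fun y => q.1 < |y| ∧ |y| < q.2) fun _ => x
  rw [hset]
  congr 1
  funext x
  rw [symKernel, sincProd_fin_one]
  norm_num

/-- The interval (-π, π) is invariant under u ↦ -u, so symmetrization applies directly, without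
unfolding. The invariant weight (i S)⁻¹ converts 1/Δ̃ into 1/Δ(e^{it}). -/
theorem hasCompactPV_wave_one (hW : AlternatingWave W) (hc : Continuous χ)
    (hχ : ∀ u, ∑ w : Equiv.Perm (Fin (1 + 1)),
      ((Equiv.Perm.sign w : ℤ) : ℂ) * W (permAct w u) = χ u * vandExp u) :
    HasCompactPV (fun u => W u * (1 / vandExp u))
      (2⁻¹ * ∫ x in (-Real.pi)..Real.pi, χ fun _ => x) := by
  set B : Set (Fin 1 → ℝ) := Set.univ.pi fun _ => Set.Ioo (-Real.pi) Real.pi with hB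
  have hBm : MeasurableSet B := MeasurableSet.univ_pi fun _ => measurableSet_Ioo
  have hBinv : PermInvariant B := by
    have : ∀ u : Fin 1 → ℝ, u ∈ B ↔ ∀ i i' : Fin 2, i < i' → |pairSum u i i'| < Real.pi := by
      intro u
      rw [forall_pairs_fin_one (S := fun y => |y| < Real.pi), hB]
      simp [abs_lt]
    intro w u hu
    rw [this] at hu ⊢
    exact forall_pairs_permAct (S := fun y => |y| < Real.pi) (fun x => by simp) w hu
  have hBfin : volume B ≠ ⊤ := by
    refine ((measure_mono (Set.pi_mono fun _ _ => Set.Ioo_subset_Icc_self)).trans_lt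
      (isCompact_univ_pi fun _ => isCompact_Icc).measure_lt_top).ne
  have hval : ∫ u in B, (2⁻¹ : ℂ) * χ u = 2⁻¹ * ∫ x in (-Real.pi)..Real.pi, χ fun _ => x := by
    rw [integral_const_mul, setIntegral_fin_one, intervalIntegral.integral_of_le
      (by linarith [Real.pi_pos]), integral_Ioc_eq_integral_Ioo]
    have : {x : ℝ | (fun _ => x) ∈ B} = Set.Ioo (-Real.pi) Real.pi := by
      ext x; simp [hB]
    rw [this]
  have hint : IntegrableOn (fun u => (2⁻¹ : ℂ) * χ u) B :=
    ((show Continuous fun u => (2⁻¹ : ℂ) * χ u by fun_prop).continuousOn.integrableOn_compact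
      (isCompact_univ_pi fun _ => isCompact_Icc)).mono_set
        (Set.pi_mono fun _ _ => Set.Ioo_subset_Icc_self)
  have h1 := tendsto_setIntegral_of_ae (l := 𝓝[>] (0 : ℝ)) (μ := volume.restrict B)
    (fun ε => measurableSet_sinRegion (m := 1) ε) hint
    (ae_restrict_of_ae (ae_regular.mono fun u hu => eventually_mem_sinRegion hu))
  rw [hval] at h1
  refine h1.congr' ?_
  filter_upwards [self_mem_nhdsWithin] with ε hε
  have hε' : 0 < ε := hε
  rw [compactRegion_eq, Measure.restrict_restrict (measurableSet_sinRegion ε), Set.inter_comm]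
  have hnorm : ∀ u ∈ sinRegion 1 ε, ‖W u * (1 / vandExp u)‖ ≤ ε⁻¹ := by
    intro u hu
    rw [norm_mul, hW.norm_eq, one_mul, norm_div, norm_one, one_div, vandExp_eq, norm_mul, norm_pow,
      Complex.norm_I, one_pow, one_mul, Complex.norm_real, Real.norm_eq_abs]
    refine inv_anti₀ hε' ?_
    have h2 : ε ^ ((1 + 1) * 1 / 2) ≤ |varpi u| := by
      rw [varpi_eq_pairProd, abs_pairProd, ← pairProd_const]
      refine pairProd_mono (fun _ _ _ => hε'.le) fun i i' h => ?_
      rw [abs_mul, abs_two]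
      exact (hu i i' h).le
    simpa using h2
  have hmeas : Measurable fun u => W u * (1 / vandExp u) := by
    have h3 : Continuous fun u : Fin 1 → ℝ => vandExp u := by
      unfold vandExp
      have := continuous_torusEntry (m := 1)
      fun_prop
    exact hW.cont.measurable.mul (measurable_const.div h3.measurable)
  have heq : ∀ u ∈ sinRegion 1 ε, W u * (1 / vandExp u) =
      (Complex.I * (sincProd u : ℂ))⁻¹ * (W u / (vandU u : ℂ)) := by
    intro u hu
    have hreg := regular_of_mem_sinRegion hε'.le hu
    have hv : (varpi u : ℂ) ≠ 0 := by exact_mod_cast hreg.varpi_ne_zero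
    have hv' : (vandU u : ℂ) ≠ 0 := by
      rw [Ne, Complex.ofReal_eq_zero, vandU, Finset.prod_eq_zero_iff]
      rintro ⟨i, _, h⟩
      rw [Finset.prod_eq_zero_iff] at h
      obtain ⟨j, hj, h⟩ := h
      exact hreg.pairSum_ne_zero (by simpa using hj) h
    rw [vandExp_eq, sincProd_eq (sinRegion_ne_zero hε'.le hu)]
    push_cast
    norm_num
    field_simp
  have hmS : MeasurableSet (B ∩ sinRegion 1 ε) := hBm.inter (measurableSet_sinRegion ε)
  have hi0 : IntegrableOn (fun u => W u * (1 / vandExp u)) (B ∩ sinRegion 1 ε) :=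
    Measure.integrableOn_of_bounded (M := ε⁻¹)
      ((measure_mono Set.inter_subset_left).trans_lt hBfin.lt_top).ne hmeas.aestronglyMeasurable
      ((ae_restrict_iff' hmS).2 (ae_of_all _ fun u hu => hnorm u hu.2))
  have hi := hi0.congr_fun (fun u hu => heq u hu.2) hmS
  have h4 := setIntegral_wave_eq hχ hmS
    (fun w u hu => ⟨hBinv w u hu.1, permInvariant_sinRegion ε w u hu.2⟩)
    (fun u hu => sinRegion_ne_zero hε'.le hu.2)
    (g := fun u => (Complex.I * (sincProd u : ℂ))⁻¹) (fun w u => by rw [sincProd_permAct]) hi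
  rw [setIntegral_congr_fun hmS fun u hu => heq u hu.2, h4]
  refine setIntegral_congr_fun hmS fun u hu => ?_
  have hs0 : (sincProd u : ℂ) ≠ 0 := by
    have hreg := regular_of_mem_sinRegion hε'.le hu.2
    rw [Ne, Complex.ofReal_eq_zero, sincProd_eq (sinRegion_ne_zero hε'.le hu.2)]
    refine mul_ne_zero hreg.varpi_ne_zero (inv_ne_zero ?_)
    rw [vandU, Finset.prod_ne_zero_iff]
    intro i _
    rw [Finset.prod_ne_zero_iff]
    exact fun j hj => hreg.pairSum_ne_zero (by simpa using hj)
  rw [symKernel]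
  have hI := Complex.I_ne_zero
  norm_num
  field_simp
  rw [Complex.I_sq]
  ring

end RankOne

/-- Compactification of the principal values. -/
theorem exists_compactPV {m : ℕ} {W : (Fin m → ℝ) → ℂ} (hW : AlternatingWave W)
    {R : MvPolynomial (Fin (m + 1)) ℚ}
    (h : m ≠ 1 → ∀ u : Fin m → ℝ, HasSum (fun p : Fin m → ℤ => (sincProd (shift u p) : ℂ))
        (MvPolynomial.aeval (torusEntry u) R)) (h' : m = 1 → R = 1) :
    ∃ w : ℂ, HasCompactPV (fun u => W u * (MvPolynomial.aeval (torusEntry u) R / vandExp u)) w ∧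
      HasPV (fun u => W u / (vandU u : ℂ)) (Complex.I ^ ((m + 1) * m / 2) * w) := by
  obtain ⟨χ, hc, ⟨C, hC⟩, hχ⟩ := hW.alt
  by_cases hm : m = 1
  · subst hm
    refine ⟨2⁻¹ * ∫ x in (-Real.pi)..Real.pi, χ fun _ => x, ?_, ?_⟩
    · simp_rw [h' rfl, map_one]
      exact hasCompactPV_wave_one hW hc hχ
    · rw [show (1 + 1) * 1 / 2 = 1 from rfl, pow_one]
      exact hasPV_wave_one hW hc hC hχ
  · refine ⟨_, hasCompactPV_wave hm hW hc hC hχ (h hm), ?_⟩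
    rw [mul_inv_cancel_left₀ (pow_ne_zero _ Complex.I_ne_zero)]
    exact hasPV_wave hm hW hc hC hχ

end Horn

end

noncomputable section

namespace Horn

/-! ### Monomial characters of the torus -/

section TorusMonomials

variable {m : ℕ}

/-- The character `∏ z_i ^ c_i` of the torus. -/
def torusMonomial (c : Fin (m + 1) → ℕ) (u : Fin m → ℝ) : ℂ := ∏ i, torusEntry u i ^ c i

theorem torusMonomial_eq (c : Fin (m + 1) → ℕ) (u : Fin m → ℝ) : torusMonomial c u =
    Complex.exp (Complex.I * ((∑ i, (c i : ℝ) * tvar u i : ℝ) : ℂ)) := exp_sum_tvar c u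

theorem torusMonomial_add_const (c : Fin (m + 1) → ℕ) (k : ℕ) (u : Fin m → ℝ) :
    torusMonomial (fun i => c i + k) u = torusMonomial c u := by
  simp [torusMonomial, pow_add, Finset.prod_mul_distrib, Finset.prod_pow, prod_torusEntry]

theorem eq_zero_of_exp_eq_one {a : Fin m → ℝ}
    (h : ∀ u : Fin m → ℝ, Complex.exp (Complex.I * ((∑ j, u j * a j : ℝ) : ℂ)) = 1) : a = 0 := by
  funext j
  by_contra hj
  have hj' : a j ≠ 0 := hj
  have h1 := h (Pi.single j (Real.pi / a j))
  rw [Finset.sum_eq_single j (fun b _ hb => by simp [hb]) (by simp), Pi.single_eq_same,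
    div_mul_cancel₀ _ hj', mul_comm, Complex.exp_pi_mul_I] at h1
  norm_num at h1

theorem tvar_add (u v : Fin m → ℝ) (i : Fin (m + 1)) : tvar (u + v) i = tvar u i + tvar v i := by
  rw [tvar_eq, tvar_eq, tvar_eq, tailSum_add]
  simp only [Pi.add_apply, mul_add, Finset.sum_add_distrib]
  ring

/-- Exponents with the same total and the same exponential have coincide. -/
theorem eq_of_exp_eq {x y : Fin (m + 1) → ℝ} (hs : ∑ i, x i = ∑ i, y i)
    (h : ∀ u : Fin m → ℝ, Complex.exp (Complex.I * ((∑ i, x i * tvar u i : ℝ) : ℂ)) =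
      Complex.exp (Complex.I * ((∑ i, y i * tvar u i : ℝ) : ℂ))) : x = y := by
  have h1 : (fun j : Fin m => (∑ k : Fin (m + 1) with k.val ≤ j.val, (x k - y k)) -
      ((j.val : ℝ) + 1) / ((m : ℝ) + 1) * ∑ k, (x k - y k)) = 0 := by
    refine eq_zero_of_exp_eq_one fun u => ?_
    rw [sum_mul_tvar]
    simp_rw [sub_mul]
    rw [Finset.sum_sub_distrib, Complex.ofReal_sub, mul_sub, Complex.exp_sub, h,
      div_self (Complex.exp_ne_zero _)]
  rw [Finset.sum_sub_distrib, hs, sub_self] at h1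
  have h2 : ∀ j : Fin (m + 1), ∑ k : Fin (m + 1) with k.val ≤ j.val, (x k - y k) = 0 := by
    intro j
    refine Fin.lastCases ?_ (fun k => ?_) j
    · rw [Finset.filter_true_of_mem fun k _ => by simpa using Fin.is_le k, Finset.sum_sub_distrib, hs,
        sub_self]
    · simpa using congrFun h1 k
  funext j
  rw [← sub_eq_zero]
  have h3 := h2 j
  have h4 : (Finset.univ.filter fun k : Fin (m + 1) => k.val ≤ j.val) =
      insert j (Finset.univ.filter fun k : Fin (m + 1) => k.val < j.val) := by
    ext k
    simp only [Finset.mem_filter, Finset.mem_univ, true_and, Finset.mem_insert, Fin.ext_iff]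
    omega
  rw [h4, Finset.sum_insert (by simp)] at h3
  have h5 : ∑ k : Fin (m + 1) with k.val < j.val, (x k - y k) = 0 := by
    rcases Nat.eq_zero_or_pos j.val with h0 | h0
    · rw [h0]; simp
    · have := h2 ⟨j.val - 1, by omega⟩
      rw [← this]
      refine Finset.sum_congr (Finset.filter_congr fun k _ => ?_) fun _ _ => rfl
      simp only
      omega
  rwa [h5, add_zero] at h3

/-- On the torus of SU(n) a character determines its exponents only up to a common constant; fixing
the total removes the ambiguity. -/
theorem torusMonomial_injective {c d : Fin (m + 1) → ℕ} (hs : ∑ i, c i = ∑ i, d i)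
    (h : ∀ u : Fin m → ℝ, torusMonomial c u = torusMonomial d u) : c = d := by
  have := eq_of_exp_eq (x := fun i => (c i : ℝ)) (y := fun i => (d i : ℝ))
    (by exact_mod_cast hs) fun u => by rw [← torusMonomial_eq, ← torusMonomial_eq, h]
  funext i
  exact_mod_cast congrFun this i

/-- `torusMonomial` as a homomorphism. -/
def torusMonomialHom (c : Fin (m + 1) → ℕ) : Multiplicative (Fin m → ℝ) →* ℂ where
  toFun u := torusMonomial c u.toAdd
  map_one' := by
    rw [toAdd_one, torusMonomial, torusEntry_zero]
    simp
  map_mul' u v := by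
    rw [toAdd_mul, torusMonomial_eq, torusMonomial_eq, torusMonomial_eq, ← Complex.exp_add, ← mul_add,
      ← Complex.ofReal_add, ← Finset.sum_add_distrib]
    simp_rw [tvar_add, mul_add]

/-- Distinct monomials of the same degree are linearly independent on the torus. -/
theorem torusMonomial_independent {N : ℕ} {S : Finset (Fin (m + 1) → ℕ)} (hS : ∀ c ∈ S, ∑ i, c i = N)
    {a : (Fin (m + 1) → ℕ) → ℂ} (h : ∀ u : Fin m → ℝ, ∑ c ∈ S, a c * torusMonomial c u = 0) :
    ∀ c ∈ S, a c = 0 := by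
  have hinj : Function.Injective fun c : S => torusMonomialHom (c : Fin (m + 1) → ℕ) := by
    rintro ⟨c, hc⟩ ⟨d, hd⟩ hcd
    refine Subtype.ext (torusMonomial_injective ((hS c hc).trans (hS d hd).symm) fun u => ?_)
    exact DFunLike.congr_fun hcd (Multiplicative.ofAdd u)
  -- Dedekind's independence of characters.
  have hli := (linearIndependent_monoidHom (Multiplicative (Fin m → ℝ)) ℂ).comp _ hinj
  rw [Fintype.linearIndependent_iff] at hli
  have h1 := hli (fun c => a c) ?_
  · exact fun c hc => h1 ⟨c, hc⟩
  · funext u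
    have h2 := h u.toAdd
    rw [← Finset.sum_coe_sort] at h2
    rw [Finset.sum_apply]
    exact h2

/-- An invariant subspace contains the weight components of its elements. -/
theorem weight_component_mem {V : Type*} [AddCommGroup V] [Module ℂ V]
    {A : (Fin m → ℝ) → V →ₗ[ℂ] V} {W : Submodule ℂ V} (hW : ∀ u, ∀ v ∈ W, A u v ∈ W) {N : ℕ}
    {S : Finset (Fin (m + 1) → ℕ)} (hS : ∀ c ∈ S, ∑ i, c i = N) {f : (Fin (m + 1) → ℕ) → V}
    (hf : ∀ c ∈ S, ∀ u, A u (f c) = torusMonomial c u • f c) (hsum : ∑ c ∈ S, f c ∈ W) :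
    ∀ c ∈ S, f c ∈ W := by
  intro c hc
  -- Applying a functional on the quotient by W to the translates of the sum gives a vanishing
  -- combination of independent characters.
  rw [← Submodule.Quotient.mk_eq_zero, ← Module.forall_dual_apply_eq_zero_iff ℂ]
  intro φ
  refine torusMonomial_independent (a := fun c => φ (Submodule.Quotient.mk (f c))) hS (fun u => ?_) c hc
  have h1 := hW u _ hsum
  rw [map_sum, Finset.sum_congr rfl fun c hc => hf c hc u, ← Submodule.Quotient.mk_eq_zero] at h1
  have h2 := congrArg φ h1
  rw [← Submodule.mkQ_apply, map_sum, map_sum, map_zero] at h2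
  simpa [mul_comm] using h2

end TorusMonomials

end Horn

end

noncomputable section

namespace Horn

/-! ### Products of minors -/

section Minors

variable {m : ℕ}

/-- The minor on the first `k + 1` rows and the columns `φ`. -/
def rowMinor (k : Fin m) (φ : Fin (k.val + 1) → Fin (m + 1))
    (x : Matrix (Fin (m + 1)) (Fin (m + 1)) ℂ) : ℂ :=
  (x.submatrix (Fin.castLE (by omega)) φ).det

/-- Multilinearity in the columns. Summing over all column maps, including non-injective ones whose
minors vanish, avoids choosing ordered subsets as in Cauchy–Binet. -/
theorem rowMinor_mul (k : Fin m) (φ : Fin (k.val + 1) → Fin (m + 1))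
    (x g : Matrix (Fin (m + 1)) (Fin (m + 1)) ℂ) :
    rowMinor k φ (x * g) = ∑ ψ, (∏ i, g (ψ i) (φ i)) * rowMinor k ψ x := by
  have h1 : ((x * g).submatrix (Fin.castLE (by omega : k.val + 1 ≤ m + 1)) φ).transpose =
      fun j => ∑ l, g l (φ j) • fun i => x (Fin.castLE (by omega) i) l := by
    funext j i
    simp [Matrix.mul_apply, mul_comm]
  rw [rowMinor, ← Matrix.det_transpose, h1]
  have h2 := (Matrix.detRowAlternating (n := Fin (k.val + 1)) (R := ℂ)).toMultilinearMap.map_sum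
    fun j l => g l (φ j) • fun i => x (Fin.castLE (by omega : k.val + 1 ≤ m + 1) i) l
  refine h2.trans (Finset.sum_congr rfl fun ψ _ => ?_)
  rw [MultilinearMap.map_smul_univ, smul_eq_mul, rowMinor, ← Matrix.det_transpose]
  rfl

theorem rowMinor_mul_diagonal (k : Fin m) (φ : Fin (k.val + 1) → Fin (m + 1))
    (x : Matrix (Fin (m + 1)) (Fin (m + 1)) ℂ) (z : Fin (m + 1) → ℂ) :
    rowMinor k φ (x * Matrix.diagonal z) = (∏ j, z (φ j)) * rowMinor k φ x := by
  rw [rowMinor, rowMinor, ← Matrix.det_mul_row]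
  congr 1
  ext i j
  simp [Matrix.mul_diagonal, mul_comm]

theorem rowMinor_diagonal_mul (k : Fin m) (φ : Fin (k.val + 1) → Fin (m + 1))
    (x : Matrix (Fin (m + 1)) (Fin (m + 1)) ℂ) (z : Fin (m + 1) → ℂ) :
    rowMinor k φ (Matrix.diagonal z * x) =
      (∏ i : Fin (k.val + 1), z (Fin.castLE (by omega) i)) * rowMinor k φ x := by
  rw [rowMinor, rowMinor, ← Matrix.det_mul_column]
  congr 1
  ext i j
  simp [Matrix.diagonal_mul]

theorem rowMinor_eq_zero (k : Fin m) {φ : Fin (k.val + 1) → Fin (m + 1)}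
    (h : ¬ Function.Injective φ) (x : Matrix (Fin (m + 1)) (Fin (m + 1)) ℂ) : rowMinor k φ x = 0 := by
  simp only [Function.Injective, not_forall] at h
  obtain ⟨i, j, hij, hne⟩ := h
  exact Matrix.det_zero_of_column_eq hne fun l => by simp [hij]

theorem rowMinor_comp_perm (k : Fin m) (φ : Fin (k.val + 1) → Fin (m + 1))
    (s : Equiv.Perm (Fin (k.val + 1))) (x : Matrix (Fin (m + 1)) (Fin (m + 1)) ℂ) :
    rowMinor k (φ ∘ s) x = (Equiv.Perm.sign s : ℤ) * rowMinor k φ x := by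
  rw [rowMinor, rowMinor, ← Matrix.det_permute']
  rfl

/-- A minor whose columns lie among the first `k + 1` is a multiple of the principal minor. -/
theorem rowMinor_eq_smul (k : Fin m) {φ : Fin (k.val + 1) → Fin (m + 1)} (hφ : ∀ j, (φ j).val ≤ k.val) :
    ∃ a : ℂ, ∀ x, rowMinor k φ x = a * rowMinor k (Fin.castLE (by omega)) x := by
  by_cases hinj : Function.Injective φ
  · let s₀ : Fin (k.val + 1) → Fin (k.val + 1) := fun j => ⟨(φ j).val, by have := hφ j; omega⟩
    have hs₀ : Function.Injective s₀ := by
      intro i j hij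
      apply hinj
      simpa [s₀, Fin.ext_iff] using hij
    let s := Equiv.ofBijective s₀ (Finite.injective_iff_bijective.1 hs₀)
    have : φ = Fin.castLE (by omega : k.val + 1 ≤ m + 1) ∘ s := by
      funext j
      ext
      simp [s, s₀]
    refine ⟨(Equiv.Perm.sign s : ℤ), fun x => ?_⟩
    rw [this, rowMinor_comp_perm]
  · exact ⟨0, fun x => by rw [rowMinor_eq_zero k hinj, zero_mul]⟩

theorem continuous_rowMinor (k : Fin m) (φ : Fin (k.val + 1) → Fin (m + 1)) :
    Continuous (rowMinor k φ) := by
  unfold rowMinor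
  exact (continuous_id.matrix_submatrix _ _).matrix_det

theorem torus_val (u : Fin m → ℝ) : (torus u).1 = Matrix.diagonal (torusEntry u) := rfl

variable (κ : Fin m → ℕ)

/-- Index of the minors entering a product: `κ_k` minors of size `k + 1`. -/
abbrev MinorIdx : Type := Σ k : Fin m, Fin (κ k)

/-- A choice of columns for every minor. -/
abbrev ColumnChoice : Type := (p : MinorIdx κ) → Fin (p.1.val + 1) → Fin (m + 1)

variable {κ}

/-- The product of minors with prescribed columns. -/
def minorProd (Φ : ColumnChoice κ) (x : SU m) : ℂ := ∏ p, rowMinor p.1 (Φ p) x.1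

/-- The number of times a column occurs. -/
def columnWeight (Φ : ColumnChoice κ) (i : Fin (m + 1)) : ℕ := ∑ p, ∑ j, if Φ p j = i then 1 else 0

variable (κ) in
/-- The choice of the first columns. -/
def topChoice : ColumnChoice κ := fun _ => Fin.castLE (by omega)

variable (m) in
/-- Right translation of functions on `SU(n)`. -/
def rightRep : Representation ℂ (SU m) (SU m → ℂ) where
  toFun g := LinearMap.funLeft ℂ ℂ fun x => x * g
  map_one' := by ext f x; simp [LinearMap.funLeft_apply]
  map_mul' g h := by ext f x; simp [LinearMap.funLeft_apply, mul_assoc]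

@[simp] theorem rightRep_apply (g : SU m) (f : SU m → ℂ) (x : SU m) :
    rightRep m g f x = f (x * g) := rfl

theorem rightRep_minorProd (g : SU m) (Φ : ColumnChoice κ) :
    rightRep m g (minorProd Φ) = ∑ Ψ : ColumnChoice κ, (∏ p, ∏ i, g.1 (Ψ p i) (Φ p i)) • minorProd Ψ := by
  funext x
  rw [rightRep_apply, minorProd, Finset.sum_apply]
  have h1 : ∀ p : MinorIdx κ, rowMinor p.1 (Φ p) (x * g).1 =
      ∑ ψ, (∏ i, g.1 (ψ i) (Φ p i)) * rowMinor p.1 ψ x.1 := fun p => rowMinor_mul _ _ _ _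
  rw [Finset.prod_congr rfl fun p _ => h1 p, Finset.prod_univ_sum, Fintype.piFinset_univ]
  refine Finset.sum_congr rfl fun Ψ _ => ?_
  rw [Finset.prod_mul_distrib]
  rfl

theorem prod_columns (Φ : ColumnChoice κ) (z : Fin (m + 1) → ℂ) :
    ∏ p, ∏ j, z (Φ p j) = ∏ i, z i ^ columnWeight Φ i := by
  simp only [columnWeight, ← Finset.prod_pow_eq_pow_sum]
  rw [Finset.prod_comm]
  refine Finset.prod_congr rfl fun p _ => ?_
  rw [Finset.prod_comm]
  refine Finset.prod_congr rfl fun j _ => ?_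
  rw [Finset.prod_eq_single (Φ p j)]
  · simp
  · intro i _ hi
    simp [hi.symm]
  · simp

theorem rightRep_torus_minorProd (u : Fin m → ℝ) (Φ : ColumnChoice κ) :
    rightRep m (torus u) (minorProd Φ) = torusMonomial (columnWeight Φ) u • minorProd Φ := by
  funext x
  rw [rightRep_apply, Pi.smul_apply, smul_eq_mul, torusMonomial, ← prod_columns, minorProd, minorProd,
    ← Finset.prod_mul_distrib]
  exact Finset.prod_congr rfl fun p _ => rowMinor_mul_diagonal _ _ _ _

theorem minorProd_torus_mul (u : Fin m → ℝ) (Φ : ColumnChoice κ) (x : SU m) :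
    minorProd Φ (torus u * x) = torusMonomial (columnWeight (topChoice κ)) u * minorProd Φ x := by
  rw [torusMonomial, ← prod_columns, minorProd, minorProd, ← Finset.prod_mul_distrib]
  exact Finset.prod_congr rfl fun p _ => rowMinor_diagonal_mul _ _ _ _

theorem minorProd_topChoice_one : minorProd (topChoice κ) 1 = 1 := by
  refine Finset.prod_eq_one fun p _ => ?_
  rw [rowMinor]
  have : ((1 : SU m).1.submatrix (Fin.castLE (by omega : p.1.val + 1 ≤ m + 1)) (topChoice κ p)) = 1 := by
    refine Matrix.submatrix_one _ (Fin.castLE_injective _)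
  rw [this, Matrix.det_one]

theorem continuous_minorProd (Φ : ColumnChoice κ) : Continuous (minorProd Φ) := by
  unfold minorProd
  exact continuous_finsetProd _ fun p _ => (continuous_rowMinor _ _).comp continuous_subtype_val

/-- Partial sums of an exponent. -/
def partialSum (c : Fin (m + 1) → ℕ) (k : Fin (m + 1)) : ℕ := ∑ i with i ≤ k, c i

theorem partialSum_columnWeight (Φ : ColumnChoice κ) (k : Fin (m + 1)) :
    partialSum (columnWeight Φ) k = ∑ p, (Finset.univ.filter fun j => Φ p j ≤ k).card := by
  simp only [partialSum, columnWeight]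
  rw [Finset.sum_comm]
  refine Finset.sum_congr rfl fun p _ => ?_
  rw [Finset.sum_comm, Finset.card_filter]
  refine Finset.sum_congr rfl fun j _ => ?_
  simp

theorem sum_columnWeight (Φ : ColumnChoice κ) :
    ∑ i, columnWeight Φ i = ∑ p : MinorIdx κ, (p.1.val + 1) := by
  simp only [columnWeight]
  rw [Finset.sum_comm]
  refine Finset.sum_congr rfl fun p _ => ?_
  rw [Finset.sum_comm]
  simp

theorem columnWeight_topChoice (i : Fin (m + 1)) : columnWeight (topChoice κ) i = tailSum κ i := by
  simp only [columnWeight, tailSum, Finset.sum_filter]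
  rw [Fintype.sum_sigma]
  refine Finset.sum_congr rfl fun k _ => ?_
  have : ∀ q : Fin (κ k), (∑ j, if topChoice κ ⟨k, q⟩ j = i then 1 else 0) =
      if i.val ≤ k.val then 1 else 0 := by
    intro q
    split_ifs with h
    · rw [Finset.sum_eq_single (⟨i.val, by omega⟩ : Fin (k.val + 1))]
      · simp [topChoice]
      · intro b _ hb
        rw [if_neg]
        intro h2
        apply hb
        simpa [topChoice, Fin.ext_iff] using h2
      · simp
    · refine Finset.sum_eq_zero fun j _ => if_neg fun h2 => h ?_
      rw [← h2]
      simp only [topChoice, Fin.val_castLE]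
      have := j.isLt
      simp only at this
      omega
  simp only [this]
  simp

/-- Distinct columns with index at most i number at most min(k + 1, i + 1), a bound attained by the
first columns. -/
theorem card_filter_le_of_injective {k : Fin m} {φ : Fin (k.val + 1) → Fin (m + 1)}
    (hφ : Function.Injective φ) (i : Fin (m + 1)) :
    (Finset.univ.filter fun j => φ j ≤ i).card ≤
      (Finset.univ.filter fun j : Fin (k.val + 1) =>
        (Fin.castLE (by omega : k.val + 1 ≤ m + 1) j) ≤ i).card := by
  rcases le_or_gt k.val i.val with h | h
  · refine (Finset.card_filter_le _ _).trans (le_of_eq ?_)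
    rw [Finset.filter_true_of_mem fun j _ => ?_]
    rw [Fin.le_def, Fin.val_castLE]
    have := j.isLt
    omega
  · have h1 : (Finset.univ.filter fun j : Fin (k.val + 1) =>
        (Fin.castLE (by omega : k.val + 1 ≤ m + 1) j) ≤ i) = Finset.Iic ⟨i.val, by omega⟩ := by
      ext j
      simp [Fin.le_def]
    rw [h1, Fin.card_Iic]
    have h2 : (Finset.univ.filter fun j => φ j ≤ i).card ≤ (Finset.Iic i).card :=
      Finset.card_le_card_of_injOn φ (fun j hj => by simpa using hj) hφ.injOn
    rwa [Fin.card_Iic] at h2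

theorem injective_of_minorProd_ne_zero {Φ : ColumnChoice κ} (h : minorProd Φ ≠ 0) (p : MinorIdx κ) :
    Function.Injective (Φ p) := by
  by_contra hp
  apply h
  funext x
  exact Finset.prod_eq_zero (Finset.mem_univ p) (rowMinor_eq_zero _ hp _)

/-- The weights of products of minors are dominated by the top weight. -/
theorem partialSum_columnWeight_le {Φ : ColumnChoice κ} (h : minorProd Φ ≠ 0) (k : Fin (m + 1)) :
    partialSum (columnWeight Φ) k ≤ partialSum (columnWeight (topChoice κ)) k := by
  rw [partialSum_columnWeight, partialSum_columnWeight]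
  exact Finset.sum_le_sum fun p _ => card_filter_le_of_injective (injective_of_minorProd_ne_zero h p) k

/-- Equality of weights forces equality in every column count, so each minor uses only its leading
columns. Hence the top weight space is a line. -/
theorem minorProd_eq_smul_of_columnWeight_eq {Φ : ColumnChoice κ}
    (h : columnWeight Φ = columnWeight (topChoice κ)) :
    ∃ a : ℂ, minorProd Φ = a • minorProd (topChoice κ) := by
  by_cases h0 : minorProd Φ = 0
  · exact ⟨0, by rw [h0, zero_smul]⟩
  have hle : ∀ (p : MinorIdx κ) (j : Fin (p.1.val + 1)), (Φ p j).val ≤ p.1.val := by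
    intro p
    have h1 := congrArg (fun c => partialSum c p.1.castSucc) h
    simp only [partialSum_columnWeight] at h1
    have h2 := (Finset.sum_eq_sum_iff_of_le fun p' _ => card_filter_le_of_injective
      (injective_of_minorProd_ne_zero h0 p') p.1.castSucc).1 h1 p (Finset.mem_univ p)
    have h3 : (Finset.univ.filter fun j : Fin (p.1.val + 1) =>
        (Fin.castLE (by omega : p.1.val + 1 ≤ m + 1) j) ≤ p.1.castSucc) = Finset.univ := by
      refine Finset.filter_true_of_mem fun j _ => ?_
      rw [Fin.le_def, Fin.val_castLE, Fin.val_castSucc]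
      have := j.isLt
      omega
    rw [h3] at h2
    have h4 := Finset.filter_card_eq h2
    intro j
    have := h4 j (Finset.mem_univ j)
    simpa [Fin.le_def] using this
  choose a ha using fun p : MinorIdx κ => rowMinor_eq_smul p.1 (hle p)
  refine ⟨∏ p, a p, funext fun x => ?_⟩
  rw [Pi.smul_apply, smul_eq_mul, minorProd, minorProd, ← Finset.prod_mul_distrib]
  exact Finset.prod_congr rfl fun p _ => ha p _

end Minors

end Horn

end

noncomputable section

namespace Horn

/-! ### The irreducible representations -/

section HighestWeight

variable {m : ℕ}

/-- The product of principal minors. -/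
def topVector (κ : Fin m → ℕ) : SU m → ℂ := minorProd (topChoice κ)

/-- The top weight, as an exponent of the torus coordinates. -/
def topWeight (κ : Fin m → ℕ) : Fin (m + 1) → ℕ := columnWeight (topChoice κ)

/-- The span of all products of minors. -/
def minorSpan (κ : Fin m → ℕ) : Submodule ℂ (SU m → ℂ) :=
  Submodule.span ℂ (Set.range (minorProd (κ := κ)))

/-- The cyclic module generated by the product of principal minors. -/
def highestModule (κ : Fin m → ℕ) : Submodule ℂ (SU m → ℂ) :=
  Submodule.span ℂ (Set.range fun g => rightRep m g (topVector κ))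

variable {κ : Fin m → ℕ}

theorem topVector_mem : topVector κ ∈ highestModule κ :=
  Submodule.subset_span ⟨1, by simp⟩

theorem rightRep_mem_highestModule (g : SU m) {f : SU m → ℂ} (hf : f ∈ highestModule κ) :
    rightRep m g f ∈ highestModule κ := by
  induction hf using Submodule.span_induction with
  | mem f hf =>
    obtain ⟨h, rfl⟩ := hf
    refine Submodule.subset_span ⟨g * h, ?_⟩
    beta_reduce
    rw [map_mul]
    rfl
  | zero => rw [map_zero]; exact Submodule.zero_mem _
  | add f f' _ _ h h' => rw [map_add]; exact Submodule.add_mem _ h h'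
  | smul a f _ h => rw [map_smul]; exact Submodule.smul_mem _ a h

theorem highestModule_le : highestModule κ ≤ minorSpan κ := by
  refine Submodule.span_le.2 ?_
  rintro _ ⟨g, rfl⟩
  beta_reduce
  rw [topVector, rightRep_minorProd]
  exact Submodule.sum_mem _ fun Ψ _ => Submodule.smul_mem _ _ (Submodule.subset_span ⟨Ψ, rfl⟩)

instance : FiniteDimensional ℂ (minorSpan κ) :=
  FiniteDimensional.span_of_finite ℂ (Set.finite_range _)

instance : FiniteDimensional ℂ (highestModule κ) :=
  Submodule.finiteDimensional_of_le highestModule_le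

theorem continuous_of_mem {f : SU m → ℂ} (hf : f ∈ minorSpan κ) : Continuous f := by
  induction hf using Submodule.span_induction with
  | mem f hf => obtain ⟨Φ, rfl⟩ := hf; exact continuous_minorProd Φ
  | zero => exact continuous_const
  | add f f' _ _ h h' => exact h.add h'
  | smul a f _ h => exact h.const_smul a

/-- All these functions have the same weight under left translation, as in the Borel–Weil model.
Comparing it with right weights at the identity singles out the top component. -/
theorem apply_torus_mul {f : SU m → ℂ} (hf : f ∈ minorSpan κ) (u : Fin m → ℝ) (x : SU m) :
    f (torus u * x) = torusMonomial (topWeight κ) u * f x := by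
  induction hf using Submodule.span_induction with
  | mem f hf => obtain ⟨Φ, rfl⟩ := hf; exact minorProd_torus_mul u Φ x
  | zero => simp
  | add f f' _ _ h h' => rw [Pi.add_apply, Pi.add_apply, h, h', mul_add]
  | smul a f _ h => rw [Pi.smul_apply, Pi.smul_apply, h, smul_eq_mul, smul_eq_mul, mul_left_comm]

/-- Exponents dominated by the top weight. -/
structure Dominated (κ : Fin m → ℕ) (c : Fin (m + 1) → ℕ) : Prop where
  sum_eq : ∑ i, c i = ∑ i, topWeight κ i
  le : ∀ k, partialSum c k ≤ partialSum (topWeight κ) k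

/-- The products of minors are grouped by column weight. Vanishing products are discarded first,
because dominance is known only for the others. -/
theorem exists_weight_decomposition {v : SU m → ℂ} (hv : v ∈ minorSpan κ) :
    ∃ (S : Finset (Fin (m + 1) → ℕ)) (f : (Fin (m + 1) → ℕ) → SU m → ℂ), v = ∑ c ∈ S, f c ∧
      ∀ c ∈ S, Dominated κ c ∧ f c ∈ minorSpan κ ∧
        (∀ u, rightRep m (torus u) (f c) = torusMonomial c u • f c) ∧
        (c = topWeight κ → ∃ a : ℂ, f c = a • topVector κ) := by
  classical
  obtain ⟨a, ha⟩ := (Submodule.mem_span_range_iff_exists_fun ℂ).1 hv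
  set T : Finset (ColumnChoice κ) := Finset.univ.filter fun Φ => minorProd Φ ≠ 0 with hT
  set f : (Fin (m + 1) → ℕ) → SU m → ℂ := fun c =>
    ∑ Φ ∈ T with columnWeight Φ = c, a Φ • minorProd Φ with hf
  refine ⟨T.image columnWeight, f, ?_, ?_⟩
  · rw [hf, Finset.sum_fiberwise_of_maps_to fun Φ hΦ => Finset.mem_image_of_mem _ hΦ, ← ha, hT,
      Finset.sum_filter]
    refine Finset.sum_congr rfl fun Φ _ => ?_
    split_ifs with h
    · rfl
    · rw [not_not.1 h, smul_zero]
  · intro c hc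
    obtain ⟨Φ, hΦ, rfl⟩ := Finset.mem_image.1 hc
    have hΦ0 : minorProd Φ ≠ 0 := (Finset.mem_filter.1 hΦ).2
    refine ⟨⟨?_, partialSum_columnWeight_le hΦ0⟩, ?_, fun u => ?_, fun htop => ?_⟩
    · rw [topWeight, sum_columnWeight, sum_columnWeight]
    · exact Submodule.sum_mem _ fun Ψ _ => Submodule.smul_mem _ _ (Submodule.subset_span ⟨Ψ, rfl⟩)
    · rw [hf, map_sum, Finset.smul_sum]
      refine Finset.sum_congr rfl fun Ψ hΨ => ?_
      rw [map_smul, rightRep_torus_minorProd, (Finset.mem_filter.1 hΨ).2, smul_comm]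
    · have h1 : ∀ Ψ : ColumnChoice κ, columnWeight Ψ = columnWeight Φ →
          ∃ a : ℂ, minorProd Ψ = a • topVector κ := fun Ψ hΨ =>
        minorProd_eq_smul_of_columnWeight_eq (hΨ.trans htop)
      have h2 : f (columnWeight Φ) ∈ Submodule.span ℂ {topVector κ} := by
        refine Submodule.sum_mem _ fun Ψ hΨ => Submodule.smul_mem _ _ ?_
        obtain ⟨b, hb⟩ := h1 Ψ (Finset.mem_filter.1 hΨ).2
        rw [hb]
        exact Submodule.smul_mem _ _ (Submodule.mem_span_singleton_self _)
      obtain ⟨b, hb⟩ := Submodule.mem_span_singleton.1 h2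
      exact ⟨b, hb.symm⟩

theorem topVector_one : topVector κ 1 = 1 := minorProd_topChoice_one

theorem topVector_ne_zero : topVector κ ≠ 0 := fun h => by
  have := topVector_one (κ := κ)
  rw [h] at this
  simp at this

theorem rightRep_torus_topVector (u : Fin m → ℝ) :
    rightRep m (torus u) (topVector κ) = torusMonomial (topWeight κ) u • topVector κ :=
  rightRep_torus_minorProd u _

/-- Every nonzero invariant subspace of the cyclic module is the whole module. -/
theorem highestModule_le_of_invariant {W : Submodule ℂ (SU m → ℂ)} (hW : W ≤ highestModule κ)
    (hinv : ∀ g, ∀ f ∈ W, rightRep m g f ∈ W) (h0 : W ≠ ⊥) : highestModule κ ≤ W := by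
  obtain ⟨f, hfW, hf0⟩ := W.ne_bot_iff.1 h0
  obtain ⟨x, hx⟩ := Function.ne_iff.1 hf0
  -- The translate by x takes the value f x ≠ 0 at the identity.
  have hgW := hinv x f hfW
  obtain ⟨S, F, hg, hF⟩ := exists_weight_decomposition (highestModule_le (hW hgW))
  have hmem : ∀ c ∈ S, F c ∈ W := by
    refine weight_component_mem (A := fun u => rightRep m (torus u)) (fun u => hinv (torus u))
      (N := ∑ i, topWeight κ i) (fun c hc => (hF c hc).1.sum_eq) (fun c hc => (hF c hc).2.2.1) ?_
    rw [← hg]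
    exact hgW
  have h1 : ∃ c ∈ S, F c 1 ≠ 0 := by
    by_contra! h
    have h2 := congrFun hg 1
    rw [Finset.sum_apply, Finset.sum_eq_zero h, rightRep_apply, one_mul] at h2
    exact hx h2
  obtain ⟨c, hc, hc1⟩ := h1
  obtain ⟨hdom, hcF, hcu, hctop⟩ := hF c hc
  -- At the identity, left and right translation by the torus coincide; a component that does not
  -- vanish there must carry the top weight.
  have htop : c = topWeight κ := by
    refine torusMonomial_injective hdom.sum_eq fun u => mul_right_cancel₀ hc1 ?_
    rw [← apply_torus_mul hcF, mul_one]
    have := congrFun (hcu u) 1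
    rw [rightRep_apply, one_mul] at this
    exact this.symm
  obtain ⟨a, ha⟩ := hctop htop
  have ha0 : a ≠ 0 := by
    rintro rfl
    rw [ha, zero_smul] at hc1
    exact hc1 rfl
  have htW : topVector κ ∈ W := by
    have := W.smul_mem a⁻¹ (hmem c hc)
    rwa [ha, inv_smul_smul₀ ha0] at this
  refine Submodule.span_le.2 ?_
  rintro _ ⟨g, rfl⟩
  exact hinv g _ htW

variable (κ) in
/-- The representation on the cyclic module. -/
def highestRep : Representation ℂ (SU m) (highestModule κ) where
  toFun g := (rightRep m g).restrict fun _ hf => rightRep_mem_highestModule g hf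
  map_one' := by ext; simp
  map_mul' g h := by ext; simp

theorem exists_basis_of_span {V : Type*} [AddCommGroup V] [Module ℂ V] [FiniteDimensional ℂ V]
    {s : Set V} (hs : ⊤ ≤ Submodule.span ℂ s) :
    ∃ (d : ℕ) (b : Module.Basis (Fin d) ℂ V), ∀ j, b j ∈ s := by
  have := Module.Finite.finite_basis (Module.Basis.ofSpan hs)
  obtain ⟨hf⟩ := nonempty_fintype ((linearIndepOn_empty ℂ id).extend (Set.empty_subset s))
  refine ⟨_, (Module.Basis.ofSpan hs).reindex (Fintype.equivFin _), fun j => ?_⟩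
  rw [Module.Basis.reindex_apply]
  exact Module.Basis.ofSpan_subset hs ⟨_, rfl⟩

theorem repr_of_eigenbasis {ι V : Type*} [Fintype ι] [AddCommGroup V] [Module ℂ V]
    (b : Module.Basis ι ℂ V) {A : V →ₗ[ℂ] V} {a : ι → ℂ} (h : ∀ j, A (b j) = a j • b j) (v : V)
    (j : ι) : b.repr (A v) j = a j * b.repr v j := by
  classical
  conv_lhs => rw [← b.sum_repr v]
  simp only [map_sum, map_smul, h, Finsupp.coe_finsetSum, Finset.sum_apply, Finsupp.smul_apply,
    Module.Basis.repr_self, smul_eq_mul, Finsupp.single_apply]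
  simp [mul_comm]

theorem trace_of_eigenbasis {ι V : Type*} [Fintype ι] [AddCommGroup V] [Module ℂ V]
    (b : Module.Basis ι ℂ V) {A : V →ₗ[ℂ] V} {a : ι → ℂ} (h : ∀ j, A (b j) = a j • b j) :
    LinearMap.trace ℂ V A = ∑ j, a j := by
  classical
  rw [LinearMap.trace_eq_matrix_trace ℂ b, Matrix.trace]
  refine Finset.sum_congr rfl fun j _ => ?_
  rw [Matrix.diag_apply, LinearMap.toMatrix_apply, h, map_smul, Finsupp.smul_apply,
    Module.Basis.repr_self, Finsupp.single_eq_same, smul_eq_mul, mul_one]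

theorem exists_weight_basis (κ : Fin m → ℕ) :
    ∃ (d : ℕ) (b : Module.Basis (Fin d) ℂ (highestModule κ)) (e : Fin d → Fin (m + 1) → ℕ),
      (∀ j, Dominated κ (e j)) ∧ (∃ j, e j = topWeight κ) ∧
      ∀ j u, highestRep κ (torus u) (b j) = torusMonomial (e j) u • b j := by
  set s : Set (highestModule κ) := {v | ∃ c, Dominated κ c ∧
    ∀ u, highestRep κ (torus u) v = torusMonomial c u • v} with hs
  have hspan : ⊤ ≤ Submodule.span ℂ s := by
    rintro ⟨v, hv⟩ -
    obtain ⟨S, F, hg, hF⟩ := exists_weight_decomposition (highestModule_le hv)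
    have hmem : ∀ c ∈ S, F c ∈ highestModule κ := by
      refine weight_component_mem (A := fun u => rightRep m (torus u))
        (fun u f hf => rightRep_mem_highestModule _ hf)
        (N := ∑ i, topWeight κ i) (fun c hc => (hF c hc).1.sum_eq) (fun c hc => (hF c hc).2.2.1) ?_
      rw [← hg]
      exact hv
    have h1 : (⟨v, hv⟩ : highestModule κ) = ∑ c ∈ S.attach, ⟨F c.1, hmem c.1 c.2⟩ := by
      apply Subtype.ext
      rw [AddSubmonoidClass.coe_finsetSum]
      change v = ∑ c ∈ S.attach, F c.1
      rw [Finset.sum_attach, hg]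
    rw [h1]
    refine Submodule.sum_mem _ fun c _ => Submodule.subset_span ⟨c.1, (hF c.1 c.2).1, fun u => ?_⟩
    exact Subtype.ext ((hF c.1 c.2).2.2.1 u)
  obtain ⟨d, b, hb⟩ := exists_basis_of_span hspan
  choose e he using hb
  refine ⟨d, b, e, fun j => (he j).1, ?_, fun j => (he j).2⟩
  -- A basis vector of another weight cannot occur in the expansion of the top vector, which would
  -- then be zero.
  by_contra! hne
  have hzero : ∀ j, b.repr ⟨topVector κ, topVector_mem⟩ j = 0 := by
    intro j
    by_contra hj
    refine hne j (torusMonomial_injective (he j).1.sum_eq fun u => ?_)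
    have h1 : highestRep κ (torus u) ⟨topVector κ, topVector_mem⟩ =
        torusMonomial (topWeight κ) u • ⟨topVector κ, topVector_mem⟩ :=
      Subtype.ext (rightRep_torus_topVector u)
    have h2 := congrArg (fun v => b.repr v j) h1
    simp only [map_smul, Finsupp.smul_apply, smul_eq_mul] at h2
    rw [repr_of_eigenbasis b fun j => (he j).2 u] at h2
    exact mul_right_cancel₀ hj h2
  have h0 : (⟨topVector κ, topVector_mem⟩ : highestModule κ) = 0 :=
    b.ext_elem fun j => by rw [hzero, map_zero, Finsupp.zero_apply]
  exact topVector_ne_zero (congrArg Subtype.val h0)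

/-- The character of the representation. -/
def highestCharacter (κ : Fin m → ℕ) (g : SU m) : ℂ :=
  LinearMap.trace ℂ (highestModule κ) (highestRep κ g)

theorem weightPairing_eq (wt : Fin m → ℤ) (u : Fin m → ℝ) :
    weightPairing wt u = ∑ i, ((tailSum wt i : ℤ) : ℝ) * tvar u i := by
  rw [weightPairing]
  refine Finset.sum_congr rfl fun i _ => ?_
  congr 2
  simp only [young, tailSum, Finset.sum_filter]
  rw [Fin.sum_univ_castSucc]
  simp only [Fin.snoc_castSucc, Fin.snoc_last, ite_self, add_zero]
  rfl

theorem weightPairing_top (κ : Fin m → ℕ) (u : Fin m → ℝ) :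
    weightPairing (fun k => (κ k : ℤ)) u = ∑ i, (topWeight κ i : ℝ) * tvar u i := by
  rw [weightPairing_eq]
  refine Finset.sum_congr rfl fun i _ => ?_
  rw [topWeight, columnWeight_topChoice]
  simp [tailSum]

/-- Summation by parts: the coefficients of the simple roots are differences of partial sums,
nonnegative by dominance. -/
theorem Dominated.exists_sub {c : Fin (m + 1) → ℕ} (h : Dominated κ c) : ∃ q : Fin m → ℕ,
    ∀ u : Fin m → ℝ, ∑ i, (c i : ℝ) * tvar u i =
      weightPairing (fun k => (κ k : ℤ)) u - ∑ k, (q k : ℝ) * u k := by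
  refine ⟨fun k => partialSum (topWeight κ) k.castSucc - partialSum c k.castSucc, fun u => ?_⟩
  have hs : ∑ i, ((topWeight κ i : ℝ) - c i) = 0 := by
    rw [Finset.sum_sub_distrib, sub_eq_zero]
    exact_mod_cast h.sum_eq.symm
  have h1 := sum_mul_tvar (fun i => (topWeight κ i : ℝ) - c i) u
  rw [hs] at h1
  simp only [sub_mul, Finset.sum_sub_distrib, mul_zero, sub_zero] at h1
  rw [weightPairing_top]
  have h2 : ∀ k : Fin m, ((partialSum (topWeight κ) k.castSucc - partialSum c k.castSucc : ℕ) : ℝ) =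
      ∑ i : Fin (m + 1) with i.val ≤ k.val, (topWeight κ i : ℝ) -
        ∑ i : Fin (m + 1) with i.val ≤ k.val, (c i : ℝ) := by
    intro k
    rw [Nat.cast_sub (h.le _)]
    simp only [partialSum, Nat.cast_sum]
    rfl
  simp_rw [h2, mul_comm _ (u _), h1]
  ring

theorem isIrreducibleCharacter_highestCharacter (κ : Fin m → ℕ) :
    IsIrreducibleCharacter κ (highestCharacter κ) := by
  obtain ⟨d, b, e, hdom, ⟨j₀, hj₀⟩, hbe⟩ := exists_weight_basis κ
  set E := b.equivFun with hE
  let π : Representation ℂ (SU m) (Fin d → ℂ) :=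
    { toFun := fun g => E.conj (highestRep κ g)
      map_one' := by rw [map_one]; exact E.conj_id
      map_mul' := fun g h => by rw [map_mul]; exact E.conj_comp _ _ }
  have hπ : ∀ g v, π g v = E (highestRep κ g (E.symm v)) := fun g v => rfl
  have hdiag : ∀ u v j, π (torus u) v j = torusMonomial (e j) u * v j := by
    intro u v j
    rw [hπ, hE, Module.Basis.equivFun_apply, repr_of_eigenbasis b fun j => hbe j u,
      ← Module.Basis.equivFun_apply, LinearEquiv.apply_symm_apply]
  refine ⟨d, π, fun v => ?_, ?_, ⟨?_, ?_⟩, fun g => ?_⟩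
  · have hcE : Continuous (E : highestModule κ → Fin d → ℂ) :=
      LinearMap.continuous_of_finiteDimensional (E : highestModule κ →ₗ[ℂ] Fin d → ℂ)
    refine hcE.comp (Continuous.subtype_mk (continuous_pi fun x => ?_) _)
    have := continuous_of_mem (highestModule_le (E.symm v).2)
    exact this.comp (continuous_const.mul continuous_id)
  · refine { exists_pair_ne := ⟨⊥, ⊤, fun h => ?_⟩, eq_bot_or_eq_top := fun U => ?_ }
    · have h1 : (Pi.single j₀ 1 : Fin d → ℂ) ∈ (⊥ : Subrepresentation π) := by
        rw [h]; trivial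
      have h2 : (Pi.single j₀ 1 : Fin d → ℂ) = 0 := h1
      have := congrFun h2 j₀
      simp at this
    · set W : Submodule ℂ (SU m → ℂ) :=
        (U.toSubmodule.comap (E : highestModule κ →ₗ[ℂ] Fin d → ℂ)).map (highestModule κ).subtype
        with hW
      have hWmem : ∀ v : highestModule κ, (v : SU m → ℂ) ∈ W ↔ E v ∈ U.toSubmodule := by
        intro v
        rw [hW, Submodule.mem_map]
        constructor
        · rintro ⟨v', hv', hvv⟩
          rwa [← Subtype.ext (hvv : (v' : SU m → ℂ) = v)]
        · exact fun hv => ⟨v, hv, rfl⟩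
      have hle : W ≤ highestModule κ := Submodule.map_subtype_le _ _
      by_cases h0 : W = ⊥
      · left
        apply Subrepresentation.toSubmodule_injective
        change U.toSubmodule = (⊥ : Submodule ℂ (Fin d → ℂ))
        rw [eq_bot_iff]
        intro v hv
        have h1 : ((E.symm v : highestModule κ) : SU m → ℂ) ∈ W := by
          rw [hWmem, LinearEquiv.apply_symm_apply]; exact hv
        rw [h0, Submodule.mem_bot] at h1
        have h2 : E.symm v = 0 := Subtype.ext h1
        rw [LinearEquiv.map_eq_zero_iff] at h2
        rw [h2]
        exact Submodule.zero_mem _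
      · right
        have hinv : ∀ g, ∀ f ∈ W, rightRep m g f ∈ W := by
          intro g f hf
          have h1 := (hWmem ⟨f, hle hf⟩).1 hf
          have h2 := U.apply_mem_toSubmodule g h1
          rw [hπ, LinearEquiv.symm_apply_apply] at h2
          exact (hWmem _).2 h2
        have h3 := highestModule_le_of_invariant hle hinv h0
        apply Subrepresentation.toSubmodule_injective
        change U.toSubmodule = (⊤ : Submodule ℂ (Fin d → ℂ))
        rw [eq_top_iff]
        intro v _
        have h4 := (hWmem (E.symm v)).1 (h3 (E.symm v).2)
        rwa [LinearEquiv.apply_symm_apply] at h4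
  · refine ⟨Pi.single j₀ 1, fun h => ?_, fun u => ?_⟩
    · have := congrFun h j₀
      simp at this
    · funext j
      rw [hdiag, weightPairing_top, ← torusMonomial_eq, Pi.smul_apply, smul_eq_mul]
      by_cases hj : j = j₀
      · rw [hj, hj₀]
      · simp [hj]
  · rintro wt ⟨v, hv0, hv⟩
    obtain ⟨j, hj⟩ := Function.ne_iff.1 hv0
    obtain ⟨q, hq⟩ := (hdom j).exists_sub
    refine ⟨q, fun u => ?_⟩
    rw [← hq]
    -- An SU(n) weight fixes its exponents only up to a constant; δ equalizes the totals so that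
    -- `eq_of_exp_eq` applies.
    set δ : ℝ := (∑ i, (e j i : ℝ) - ∑ i, ((tailSum wt i : ℤ) : ℝ)) / ((m : ℝ) + 1) with hδ
    have hm : (m : ℝ) + 1 ≠ 0 := by positivity
    have hshift : ∀ u : Fin m → ℝ, ∑ i, (((tailSum wt i : ℤ) : ℝ) + δ) * tvar u i =
        weightPairing wt u := by
      intro u
      simp_rw [add_mul]
      rw [Finset.sum_add_distrib, ← Finset.mul_sum, sum_tvar, mul_zero, add_zero, weightPairing_eq]
    have h1 : (fun i => ((tailSum wt i : ℤ) : ℝ) + δ) = fun i => (e j i : ℝ) := by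
      refine eq_of_exp_eq ?_ fun u => ?_
      · rw [Finset.sum_add_distrib, Finset.sum_const, Finset.card_univ, Fintype.card_fin, nsmul_eq_mul,
          hδ]
        push_cast
        field_simp
        ring
      · rw [hshift, ← torusMonomial_eq]
        have h2 := congrFun (hv u) j
        rw [hdiag, Pi.smul_apply, smul_eq_mul] at h2
        exact (mul_right_cancel₀ hj h2).symm
    rw [← hshift]
    exact Finset.sum_congr rfl fun i _ => by rw [congrFun h1 i]
  · exact (LinearMap.trace_conj' (highestRep κ g) E).symm

end HighestWeight

end Horn

end

noncomputable section

namespace Horn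

/-! ### Weyl group elements and complex conjugation -/

section Conjugation

variable {m : ℕ}

/-- The signs making a permutation matrix unimodular. -/
def permSign (w : Equiv.Perm (Fin (m + 1))) (j : Fin (m + 1)) : ℂ :=
  if j = 0 then ((Equiv.Perm.sign w : ℤ) : ℂ) else 1

theorem permSign_mul_self (w : Equiv.Perm (Fin (m + 1))) (j : Fin (m + 1)) :
    permSign w j * permSign w j = 1 := by
  unfold permSign
  split_ifs
  · rcases Int.units_eq_one_or (Equiv.Perm.sign w) with h | h <;> simp [h]
  · simp

theorem star_permSign (w : Equiv.Perm (Fin (m + 1))) (j : Fin (m + 1)) :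
    star (permSign w j) = permSign w j := by
  unfold permSign
  split_ifs <;> simp

/-- The unimodular signed permutation matrix. -/
def permMat (w : Equiv.Perm (Fin (m + 1))) : Matrix (Fin (m + 1)) (Fin (m + 1)) ℂ :=
  Matrix.of fun i j => if i = w j then permSign w j else 0

theorem mul_permMat_apply (w : Equiv.Perm (Fin (m + 1))) (x : Matrix (Fin (m + 1)) (Fin (m + 1)) ℂ)
    (i j : Fin (m + 1)) : (x * permMat w) i j = x i (w j) * permSign w j := by
  simp [Matrix.mul_apply, permMat]

theorem conjTranspose_permMat_mul_apply (w : Equiv.Perm (Fin (m + 1)))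
    (x : Matrix (Fin (m + 1)) (Fin (m + 1)) ℂ) (i j : Fin (m + 1)) :
    ((permMat w).conjTranspose * x) i j = permSign w i * x (w i) j := by
  simp only [Matrix.mul_apply, permMat, Matrix.conjTranspose_apply, Matrix.of_apply]
  rw [Finset.sum_eq_single (w i)]
  · rw [if_pos rfl, star_permSign]
  · intro b _ hb
    rw [if_neg hb, star_zero, zero_mul]
  · simp

theorem det_permMat (w : Equiv.Perm (Fin (m + 1))) : (permMat w).det = 1 := by
  have h1 : permMat w = Matrix.of fun i j =>
      permSign w j * (w⁻¹.permMatrix ℂ) i j := by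
    ext i j
    simp only [permMat, Matrix.of_apply, Equiv.Perm.permMatrix, PEquiv.toMatrix_apply,
      Equiv.toPEquiv_apply, Option.mem_some_iff, mul_ite, mul_one, mul_zero, Equiv.Perm.inv_eq_iff_eq]
  rw [h1, Matrix.det_mul_row, Matrix.det_permutation, Equiv.Perm.sign_inv]
  have h2 : ∏ j, permSign w j = ((Equiv.Perm.sign w : ℤ) : ℂ) := by
    simp [permSign]
  rw [h2]
  rcases Int.units_eq_one_or (Equiv.Perm.sign w) with h | h <;> simp [h]

/-- The element of `SU(n)` given by a signed permutation matrix. -/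
def permElem (w : Equiv.Perm (Fin (m + 1))) : SU m :=
  ⟨permMat w, by
    rw [Matrix.mem_specialUnitaryGroup_iff, Matrix.mem_unitaryGroup_iff']
    refine ⟨?_, det_permMat w⟩
    ext i j
    rw [Matrix.star_eq_conjTranspose, conjTranspose_permMat_mul_apply, permMat, Matrix.of_apply,
      Matrix.one_apply]
    by_cases h : i = j
    · rw [h, if_pos rfl, if_pos rfl, permSign_mul_self]
    · rw [if_neg (w.injective.ne h), if_neg h, mul_zero]⟩

theorem torus_mul_permElem (w : Equiv.Perm (Fin (m + 1))) (u : Fin m → ℝ) :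
    torus u * permElem w = permElem w * torus (permAct w u) := by
  apply Subtype.ext
  change Matrix.diagonal (torusEntry u) * permMat w =
    permMat w * Matrix.diagonal (torusEntry (permAct w u))
  ext i j
  rw [Matrix.diagonal_mul, Matrix.mul_diagonal, torusEntry_permAct, permMat, Matrix.of_apply]
  split_ifs with h
  · rw [h, mul_comm]
  · simp

/-- Permuting the t_i is conjugation by a signed permutation matrix in SU(n), and the trace is a
class function. -/
theorem highestCharacter_permAct (κ : Fin m → ℕ) (w : Equiv.Perm (Fin (m + 1))) (u : Fin m → ℝ) :
    highestCharacter κ (torus (permAct w u)) = highestCharacter κ (torus u) := by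
  have h1 : torus (permAct w u) = (permElem w)⁻¹ * (torus u * permElem w) := by
    rw [torus_mul_permElem, inv_mul_cancel_left]
  rw [highestCharacter, highestCharacter, h1, map_mul, LinearMap.trace_mul_comm, ← map_mul, mul_assoc,
    mul_inv_cancel, mul_one]

/-- For a unimodular unitary matrix, complementary principal minors are complex conjugate. -/
theorem star_det_eq_det {p q : Type*} [Fintype p] [Fintype q] [DecidableEq p] [DecidableEq q]
    {A : Matrix p p ℂ} {B : Matrix p q ℂ} {C : Matrix q p ℂ} {D : Matrix q q ℂ}
    (hu : Matrix.fromBlocks A B C D * (Matrix.fromBlocks A B C D).conjTranspose = 1)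
    (hd : (Matrix.fromBlocks A B C D).det = 1) : star A.det = D.det := by
  rw [Matrix.fromBlocks_conjTranspose, Matrix.fromBlocks_multiply, ← Matrix.fromBlocks_one,
    Matrix.fromBlocks_inj] at hu
  obtain ⟨h11, -, h21, -⟩ := hu
  -- Keeping only the first block column of the adjoint, completed by an identity block, makes the
  -- product block triangular; determinants then compare the two diagonal minors.
  have h := congrArg Matrix.det (show Matrix.fromBlocks A B C D *
    Matrix.fromBlocks A.conjTranspose 0 B.conjTranspose 1 = Matrix.fromBlocks 1 B 0 D by
      rw [Matrix.fromBlocks_multiply, h11, h21]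
      simp)
  rwa [Matrix.det_mul, hd, one_mul, Matrix.det_fromBlocks_zero₁₂, Matrix.det_fromBlocks_zero₂₁,
    Matrix.det_one, Matrix.det_one, one_mul, mul_one, Matrix.det_conjTranspose] at h

/-- The first `k + 1` indices and the last `m - k`, the latter in reverse order. -/
def splitIndex (k : Fin m) : Fin (k.val + 1) ⊕ Fin (k.rev.val + 1) → Fin (m + 1) :=
  Sum.elim (Fin.castLE (by omega)) fun j => (Fin.castLE (by omega : k.rev.val + 1 ≤ m + 1) j).rev

theorem splitIndex_bijective (k : Fin m) : Function.Bijective (splitIndex k) := by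
  have hk : k.rev.val = m - (k.val + 1) := Fin.val_rev k
  have hk' := k.isLt
  rw [Fintype.bijective_iff_injective_and_card]
  constructor
  · rintro (i | i) (j | j) hij
    · simpa [splitIndex, Fin.ext_iff] using hij
    · have h1 := i.isLt
      have h2 := j.isLt
      have h3 := congrArg Fin.val hij
      simp only [splitIndex, Sum.elim_inl, Sum.elim_inr, Fin.val_rev, Fin.val_castLE] at h3
      omega
    · have h1 := i.isLt
      have h2 := j.isLt
      have h3 := congrArg Fin.val hij
      simp only [splitIndex, Sum.elim_inl, Sum.elim_inr, Fin.val_rev, Fin.val_castLE] at h3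
      omega
    · exact congrArg Sum.inr (Fin.castLE_injective _ (Fin.rev_injective hij))
  · simp only [Fintype.card_sum, Fintype.card_fin]
    omega

variable (m) in
/-- The longest element of the Weyl group. -/
def longElem : SU m := permElem Fin.revPerm

/-- The conjugate of a leading minor is the complementary trailing minor; the longest Weyl element
moves that one back to the leading corner, where its size corresponds to the reversed index. -/
theorem star_rowMinor (k : Fin m) (y : SU m) :
    star (rowMinor k (Fin.castLE (by omega)) y.1) =
      rowMinor k.rev (Fin.castLE (by omega)) ((longElem m)⁻¹ * y * longElem m).1 := by
  set e := Equiv.ofBijective _ (splitIndex_bijective k) with he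
  obtain ⟨hy1, hy2⟩ := Matrix.mem_specialUnitaryGroup_iff.1 y.2
  rw [Matrix.mem_unitaryGroup_iff, Matrix.star_eq_conjTranspose] at hy1
  have hblocks : Matrix.fromBlocks (y.1.submatrix e e).toBlocks₁₁ (y.1.submatrix e e).toBlocks₁₂
      (y.1.submatrix e e).toBlocks₂₁ (y.1.submatrix e e).toBlocks₂₂ = y.1.submatrix e e :=
    Matrix.fromBlocks_toBlocks _
  have h1 := star_det_eq_det (A := (y.1.submatrix e e).toBlocks₁₁)
    (B := (y.1.submatrix e e).toBlocks₁₂) (C := (y.1.submatrix e e).toBlocks₂₁)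
    (D := (y.1.submatrix e e).toBlocks₂₂)
    (by rw [hblocks, Matrix.conjTranspose_submatrix, Matrix.submatrix_mul_equiv, hy1,
      Matrix.submatrix_one_equiv])
    (by rw [hblocks, Matrix.det_submatrix_equiv_self, hy2])
  have h2 : ((longElem m)⁻¹ * y * longElem m).1 =
      (permMat Fin.revPerm).conjTranspose * (y.1 * permMat Fin.revPerm) := by
    rw [mul_assoc]
    rfl
  -- The signs of the permutation matrix occur once in the rows and once in the columns, so they
  -- cancel.
  have h3 : rowMinor k.rev (Fin.castLE (by omega)) ((longElem m)⁻¹ * y * longElem m).1 =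
      (∏ i : Fin (k.rev.val + 1), permSign Fin.revPerm (Fin.castLE (by omega : _ ≤ m + 1) i)) *
      ((∏ i : Fin (k.rev.val + 1), permSign Fin.revPerm (Fin.castLE (by omega : _ ≤ m + 1) i)) *
        (y.1.submatrix e e).toBlocks₂₂.det) := by
    rw [← Matrix.det_mul_row, ← Matrix.det_mul_column, rowMinor, h2]
    congr 1
    ext i j
    rw [Matrix.submatrix_apply, conjTranspose_permMat_mul_apply, mul_permMat_apply]
    simp only [Matrix.of_apply]
    rw [mul_comm (y.1 _ _)]
    rfl
  rw [h3, ← mul_assoc, ← Finset.prod_mul_distrib, Finset.prod_eq_one fun i _ => permSign_mul_self _ _,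
    one_mul, ← h1]
  rfl

theorem topVector_apply (κ : Fin m → ℕ) (x : SU m) :
    topVector κ x = ∏ k, rowMinor k (Fin.castLE (by omega)) x.1 ^ κ k := by
  rw [topVector, minorProd, Fintype.prod_sigma]
  refine Finset.prod_congr rfl fun k _ => ?_
  change ∏ _y : Fin (κ k), rowMinor k (Fin.castLE (by omega)) x.1 = _
  rw [Finset.prod_const, Finset.card_univ, Fintype.card_fin]

variable (m) in
/-- The conjugate-linear map commuting with right translations. -/
def conjTranslate (h : SU m) : (SU m → ℂ) →ₛₗ[starRingEnd ℂ] (SU m → ℂ) where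
  toFun f x := starRingEnd ℂ (f (h * x))
  map_add' f f' := by funext x; simp
  map_smul' a f := by funext x; simp

theorem conjTranslate_apply (h : SU m) (f : SU m → ℂ) (x : SU m) :
    conjTranslate m h f x = starRingEnd ℂ (f (h * x)) := rfl

theorem conjTranslate_rightRep (h g : SU m) (f : SU m → ℂ) :
    conjTranslate m h (rightRep m g f) = rightRep m g (conjTranslate m h f) := by
  funext x
  simp [conjTranslate_apply, mul_assoc]

theorem conjTranslate_inv (h : SU m) (f : SU m → ℂ) :
    conjTranslate m h⁻¹ (conjTranslate m h f) = f := by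
  funext x
  simp [conjTranslate_apply]

/-- Applies `star_rowMinor` to each minor of the product. The conjugate-linear intertwiner therefore
exchanges the cyclic modules of κ and of the reversed weight. -/
theorem conjTranslate_topVector (κ : Fin m → ℕ) :
    conjTranslate m (longElem m) (topVector κ) =
      rightRep m (longElem m) (topVector (conjWeight κ)) := by
  funext x
  rw [conjTranslate_apply, rightRep_apply, topVector_apply, topVector_apply, map_prod]
  refine Fintype.prod_equiv Fin.revPerm _ _ fun k => ?_
  have h1 : (longElem m)⁻¹ * (longElem m * x) * longElem m = x * longElem m := by
    rw [inv_mul_cancel_left]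
  rw [map_pow, starRingEnd_apply, star_rowMinor, h1, Fin.revPerm_apply, conjWeight, Fin.rev_rev]

theorem conjTranslate_mem {κ κ' : Fin m → ℕ} {h : SU m}
    (ht : conjTranslate m h (topVector κ) ∈ highestModule κ') {f : SU m → ℂ}
    (hf : f ∈ highestModule κ) : conjTranslate m h f ∈ highestModule κ' := by
  induction hf using Submodule.span_induction with
  | mem f hf =>
    obtain ⟨g, rfl⟩ := hf
    beta_reduce
    rw [conjTranslate_rightRep]
    exact rightRep_mem_highestModule g ht
  | zero => rw [map_zero]; exact Submodule.zero_mem _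
  | add f f' _ _ h h' => rw [map_add]; exact Submodule.add_mem _ h h'
  | smul a f _ h => rw [LinearMap.map_smulₛₗ]; exact Submodule.smul_mem _ _ h

theorem conjTranslate_longElem_mem {κ : Fin m → ℕ} {f : SU m → ℂ} (hf : f ∈ highestModule κ) :
    conjTranslate m (longElem m) f ∈ highestModule (conjWeight κ) := by
  refine conjTranslate_mem ?_ hf
  rw [conjTranslate_topVector]
  exact rightRep_mem_highestModule _ topVector_mem

theorem conjTranslate_longElem_inv_mem {κ : Fin m → ℕ} {f : SU m → ℂ}
    (hf : f ∈ highestModule (conjWeight κ)) :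
    conjTranslate m (longElem m)⁻¹ f ∈ highestModule κ := by
  refine conjTranslate_mem ?_ hf
  have h1 := congrArg (fun f => rightRep m (longElem m)⁻¹ (conjTranslate m (longElem m)⁻¹ f))
    (conjTranslate_topVector κ)
  simp only [conjTranslate_inv, conjTranslate_rightRep] at h1
  rw [← Module.End.mul_apply, ← map_mul, inv_mul_cancel, map_one, Module.End.one_apply] at h1
  rw [← h1]
  exact rightRep_mem_highestModule _ topVector_mem

/-- The conjugate-linear isomorphism onto the conjugate representation. -/
def conjModule (κ : Fin m → ℕ) : highestModule κ →ₛₗ[starRingEnd ℂ] highestModule (conjWeight κ) where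
  toFun f := ⟨conjTranslate m (longElem m) f, conjTranslate_longElem_mem f.2⟩
  map_add' _ _ := Subtype.ext (map_add _ _ _)
  map_smul' _ _ := Subtype.ext (LinearMap.map_smulₛₗ _ _ _)

theorem conjModule_bijective (κ : Fin m → ℕ) : Function.Bijective (conjModule κ) := by
  constructor
  · intro f f' h
    apply Subtype.ext
    rw [← conjTranslate_inv (longElem m) f.1, ← conjTranslate_inv (longElem m) f'.1]
    exact congrArg _ (congrArg Subtype.val h)
  · intro f
    refine ⟨⟨_, conjTranslate_longElem_inv_mem f.2⟩, Subtype.ext ?_⟩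
    have := conjTranslate_inv (longElem m)⁻¹ f.1
    rwa [inv_inv] at this

theorem exists_basis_of_conj {ι V V' : Type*} [Fintype ι] [AddCommGroup V] [Module ℂ V]
    [AddCommGroup V'] [Module ℂ V'] {Θ : V →ₛₗ[starRingEnd ℂ] V'} (hΘ : Function.Bijective Θ)
    (b : Module.Basis ι ℂ V) : ∃ b' : Module.Basis ι ℂ V', ∀ j, b' j = Θ (b j) := by
  have hli : LinearIndependent ℂ fun j => Θ (b j) := by
    rw [Fintype.linearIndependent_iff]
    intro g hg j
    have h1 : Θ (∑ j, starRingEnd ℂ (g j) • b j) = 0 := by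
      rw [map_sum, ← hg]
      exact Finset.sum_congr rfl fun j _ => by rw [LinearMap.map_smulₛₗ, Complex.conj_conj]
    rw [← map_zero Θ] at h1
    have h2 := Fintype.linearIndependent_iff.1 b.linearIndependent _ (hΘ.1 h1) j
    simpa using h2
  refine ⟨Module.Basis.mk hli ?_, fun j => Module.Basis.mk_apply _ _ _⟩
  intro v _
  obtain ⟨v, rfl⟩ := hΘ.2 v
  rw [← b.sum_repr v, map_sum]
  refine Submodule.sum_mem _ fun j _ => ?_
  rw [LinearMap.map_smulₛₗ]
  exact Submodule.smul_mem _ _ (Submodule.subset_span ⟨j, rfl⟩)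

/-- A conjugate-linear intertwiner carries a weight basis to a weight basis with conjugate
eigenvalues. -/
theorem highestCharacter_conjWeight (κ : Fin m → ℕ) (u : Fin m → ℝ) :
    highestCharacter (conjWeight κ) (torus u) = starRingEnd ℂ (highestCharacter κ (torus u)) := by
  obtain ⟨d, b, e, -, -, hbe⟩ := exists_weight_basis κ
  obtain ⟨b', hb'⟩ := exists_basis_of_conj (conjModule_bijective κ) b
  rw [highestCharacter, highestCharacter, trace_of_eigenbasis b fun j => hbe j u, map_sum]
  refine trace_of_eigenbasis b' fun j => ?_
  rw [hb', ← LinearMap.map_smulₛₗ, ← hbe]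
  exact Subtype.ext (conjTranslate_rightRep _ _ _).symm

end Conjugation

end Horn

end

noncomputable section

namespace Horn

/-! ### Expansion of symmetric polynomials on irreducible characters -/

section Expansion

open MvPolynomial

variable {m : ℕ}

theorem aeval_torusEntry_eq_sum (p : MvPolynomial (Fin (m + 1)) ℚ) (u : Fin m → ℝ) :
    aeval (torusEntry u) p = ∑ d ∈ p.support, ((coeff d p : ℚ) : ℂ) * torusMonomial d u := by
  rw [aeval_def, eval₂_eq']
  rfl

theorem _root_.MvPolynomial.IsHomogeneous.sum_apply_eq {p : MvPolynomial (Fin (m + 1)) ℚ} {N : ℕ}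
    (hp : p.IsHomogeneous N) {d : Fin (m + 1) →₀ ℕ} (hd : coeff d p ≠ 0) : ∑ i, d i = N := by
  rw [← Finsupp.degree_eq_sum, Finsupp.degree_eq_weight_one (R := ℕ)]
  exact hp hd

/-- A homogeneous polynomial vanishing on the torus is zero. -/
theorem eq_zero_of_aeval_torusEntry {p : MvPolynomial (Fin (m + 1)) ℚ} {N : ℕ} (hp : p.IsHomogeneous N)
    (h : ∀ u : Fin m → ℝ, aeval (torusEntry u) p = 0) : p = 0 := by
  classical
  have hsum : ∀ c ∈ p.support.map ⟨_, DFunLike.coe_injective⟩, ∑ i, c i = N := by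
    intro c hc
    obtain ⟨d, hd, rfl⟩ := Finset.mem_map.1 hc
    exact hp.sum_apply_eq (mem_support_iff.1 hd)
  have h1 := torusMonomial_independent
    (a := fun c => ((coeff (Finsupp.equivFunOnFinite.symm c) p : ℚ) : ℂ)) hsum fun u => by
      rw [Finset.sum_map, ← h u, aeval_torusEntry_eq_sum]
      refine Finset.sum_congr rfl fun d _ => ?_
      simp
  ext d
  rw [coeff_zero]
  by_contra hd
  have h2 := h1 d (Finset.mem_map_of_mem _ (mem_support_iff.2 hd))
  simp only [Finsupp.equivFunOnFinite_symm_coe, Rat.cast_eq_zero] at h2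
  exact hd h2

/-- The exponent `c` shifted by a constant. -/
def shiftExp (c : Fin (m + 1) → ℕ) (k : ℕ) : Fin (m + 1) →₀ ℕ :=
  Finsupp.equivFunOnFinite.symm fun i => c i + k

/-- If c were lexicographically larger, its partial sum at the first index of difference would
exceed that of the top weight. -/
theorem toLex_shiftExp_le {κ : Fin m → ℕ} {c : Fin (m + 1) → ℕ} (h : Dominated κ c) (k : ℕ) :
    toLex (shiftExp c k) ≤ toLex (shiftExp (topWeight κ) k) := by
  by_contra! hlt
  obtain ⟨i, h1, h2⟩ := hlt
  simp only [ofLex_toLex, shiftExp, Finsupp.equivFunOnFinite_symm_apply_apply, add_left_inj,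
    add_lt_add_iff_right] at h1 h2
  refine (h.le i).not_gt (Finset.sum_lt_sum (fun j hj => ?_) ⟨i, by simp, h2⟩)
  rcases (Finset.mem_filter.1 hj).2.lt_or_eq with h3 | rfl
  · exact (h1 j h3).le
  · exact h2.le

/-- The character as the sum of its weight monomials, with multiplicity. The shift by k is invisible
on the torus and adjusts the degree to that of the polynomial being expanded. -/
theorem exists_weight_polynomial (κ : Fin m → ℕ) (k : ℕ) :
    ∃ S : MvPolynomial (Fin (m + 1)) ℚ, S.IsSymmetric ∧ S.IsHomogeneous (∑ i, (topWeight κ i + k)) ∧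
      (∀ u, aeval (torusEntry u) S = highestCharacter κ (torus u)) ∧
      (∀ d ∈ S.support, toLex d ≤ toLex (shiftExp (topWeight κ) k)) ∧
      coeff (shiftExp (topWeight κ) k) S ≠ 0 := by
  classical
  obtain ⟨d, b, e, hdom, ⟨j₀, hj₀⟩, hbe⟩ := exists_weight_basis κ
  set S : MvPolynomial (Fin (m + 1)) ℚ := ∑ j, monomial (shiftExp (e j) k) 1 with hS
  have hval : ∀ u, aeval (torusEntry u) S = highestCharacter κ (torus u) := by
    intro u
    rw [highestCharacter, trace_of_eigenbasis b fun j => hbe j u, hS, map_sum]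
    refine Finset.sum_congr rfl fun j _ => ?_
    rw [aeval_monomial, Finsupp.prod_fintype _ _ (by simp), map_one, one_mul,
      ← torusMonomial_add_const _ k]
    rfl
  have hhom : S.IsHomogeneous (∑ i, (topWeight κ i + k)) := by
    refine IsHomogeneous.sum _ _ _ fun j _ => isHomogeneous_monomial _ ?_
    rw [Finsupp.degree_eq_sum]
    change ∑ i, (e j i + k) = _
    rw [Finset.sum_add_distrib, Finset.sum_add_distrib, (hdom j).sum_eq]
  refine ⟨S, fun w => ?_, hhom, hval, fun c hc => ?_, ?_⟩
  · rw [← sub_eq_zero]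
    -- Symmetry of the polynomial follows from symmetry of its values, since homogeneous polynomials
    -- are determined on the torus.
    refine eq_zero_of_aeval_torusEntry (hhom.rename_isHomogeneous.sub hhom) fun u => ?_
    have h1 : torusEntry u ∘ w = torusEntry (permAct w u) := by
      funext i; simp [torusEntry_permAct]
    rw [map_sub, aeval_rename, h1, hval, hval, highestCharacter_permAct, sub_self]
  · have h1 : ∃ j, shiftExp (e j) k = c := by
      by_contra! hne
      refine mem_support_iff.1 hc ?_
      rw [hS, coeff_sum]
      exact Finset.sum_eq_zero fun j _ => by rw [coeff_monomial, if_neg (hne j)]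
    obtain ⟨j, rfl⟩ := h1
    exact toLex_shiftExp_le (hdom j) k
  -- The coefficients are multiplicities, so nothing can cancel the contribution of j₀; that this
  -- multiplicity equals one is not needed.
  · have h1 : (1 : ℚ) ≤ coeff (shiftExp (topWeight κ) k) S := by
      rw [hS, coeff_sum]
      have h2 := Finset.single_le_sum (f := fun j => coeff (shiftExp (topWeight κ) k)
        (monomial (shiftExp (e j) k) (1 : ℚ))) (fun j _ => by
          rw [coeff_monomial]; split_ifs <;> norm_num) (Finset.mem_univ j₀)
      rw [hj₀, coeff_monomial, if_pos rfl] at h2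
      exact h2
    intro h0
    rw [h0] at h1
    norm_num at h1

/-- The consecutive differences of a decreasing exponent are Dynkin components, and its last entry
is the common shift. -/
theorem exists_topWeight_eq {b : Fin (m + 1) →₀ ℕ} (hb : Antitone b) :
    ∃ κ : Fin m → ℕ, shiftExp (topWeight κ) (b (Fin.last m)) = b := by
  refine ⟨fun k => b k.castSucc - b k.succ, ?_⟩
  ext i
  rw [shiftExp, Finsupp.equivFunOnFinite_symm_apply_apply, topWeight, columnWeight_topChoice]
  have h1 := tailSum_diff (fun i => (b i : ℤ)) i
  have h2 : ((tailSum (fun k : Fin m => b k.castSucc - b k.succ) i : ℕ) : ℤ) =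
      tailSum (fun k : Fin m => (b k.castSucc : ℤ) - b k.succ) i := by
    simp only [tailSum, Nat.cast_sum]
    exact Finset.sum_congr rfl fun k _ => Nat.cast_sub (hb Fin.castSucc_lt_succ.le)
  omega

/-- The lexicographic leading exponent of a symmetric polynomial is decreasing, hence a highest
weight up to a shift. Subtracting the matching rational multiple of its character polynomial either
gives zero or lowers the leading exponent, and the order is well founded. -/
theorem mem_span_highestCharacter {N : ℕ} (p : MvPolynomial (Fin (m + 1)) ℚ) (hsym : p.IsSymmetric)
    (hhom : p.IsHomogeneous N) :
    (fun u : Fin m → ℝ => aeval (torusEntry u) p) ∈ Submodule.span ℚ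
      (Set.range fun (κ : Fin m → ℕ) (u : Fin m → ℝ) => highestCharacter κ (torus u)) := by
  induction hs : p.supDegree toLex using WellFoundedLT.induction generalizing p with | _ t ih
  subst hs
  by_cases h0 : p = 0
  · simp only [h0, map_zero]
    exact Submodule.zero_mem _
  obtain ⟨κ, hκ⟩ := exists_topWeight_eq hsym.antitone_supDegree
  set b := ofLex (p.supDegree toLex) with hb
  obtain ⟨S, hSsym, hShom, hSval, hSle, hS0⟩ := exists_weight_polynomial κ (b (Fin.last m))
  rw [hκ] at hSle hS0
  have hlc : coeff b p ≠ 0 := by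
    rw [hb, ← leadingCoeff_toLex]
    exact (AddMonoidAlgebra.leadingCoeff_ne_zero toLex.injective).2 h0
  set q : MvPolynomial (Fin (m + 1)) ℚ := C (coeff b p / coeff b S) * S with hq
  have hqb : coeff b q = coeff b p := by
    rw [hq, coeff_C_mul, div_mul_cancel₀ _ hS0]
  have hqdeg : q.supDegree toLex = p.supDegree toLex := by
    have h1 : q.supDegree toLex = toLex b := by
      refine AddMonoidAlgebra.supDegree_eq_of_isMaxOn (mem_support_iff.2 (hqb ▸ hlc)) fun d hd => ?_
      refine hSle d (mem_support_iff.2 fun h => mem_support_iff.1 hd ?_)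
      rw [hq, coeff_C_mul, h, mul_zero]
    rw [h1, hb, toLex_ofLex]
  have hN : ∑ i, (topWeight κ i + b (Fin.last m)) = N := by
    have h1 : ∑ i, (topWeight κ i + b (Fin.last m)) = ∑ i, b i := by
      conv_rhs => rw [← hκ]
      rfl
    rw [h1, hhom.sum_apply_eq hlc]
  have hqsym : q.IsSymmetric := (IsSymmetric.C _).mul hSsym
  have hqhom : q.IsHomogeneous N := by
    rw [← zero_add N, ← hN]
    exact (isHomogeneous_C _ _).mul hShom
  have hqmem : (fun u : Fin m → ℝ => aeval (torusEntry u) q) ∈ Submodule.span ℚ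
      (Set.range fun (κ : Fin m → ℕ) (u : Fin m → ℝ) => highestCharacter κ (torus u)) := by
    have h1 : (fun u : Fin m → ℝ => aeval (torusEntry u) q) =
        (coeff b p / coeff b S) • fun u => highestCharacter κ (torus u) := by
      funext u
      rw [hq, map_mul, aeval_C, hSval, Pi.smul_apply, Algebra.smul_def]
    rw [h1]
    exact Submodule.smul_mem _ _ (Submodule.subset_span ⟨κ, rfl⟩)
  rcases AddMonoidAlgebra.supDegree_sub_lt_of_leadingCoeff_eq toLex.injective hqdeg.symm
    (by rw [leadingCoeff_toLex, leadingCoeff_toLex, hqdeg, ← hb, hqb]) with hlt | heq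
  · have h1 := ih _ hlt (p - q) (hsym.sub hqsym) (hhom.sub hqhom) rfl
    have h2 := Submodule.add_mem _ h1 hqmem
    convert h2 using 1
    funext u
    rw [Pi.add_apply, map_sub, sub_add_cancel]
  · rw [heq]
    exact hqmem

theorem conjWeight_conjWeight (κ : Fin m → ℕ) : conjWeight (conjWeight κ) = κ := by
  funext k
  simp [conjWeight]

/-- Real-valued symmetric polynomials on the torus are rational combinations of irreducible
characters, conjugate characters having the same coefficient. -/
theorem exists_character_expansion {N : ℕ} {p : MvPolynomial (Fin (m + 1)) ℚ} (hsym : p.IsSymmetric)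
    (hhom : p.IsHomogeneous N)
    (hreal : ∀ u : Fin m → ℝ, starRingEnd ℂ (aeval (torusEntry u) p) = aeval (torusEntry u) p) :
    ∃ (K : Finset (Fin m → ℕ)) (r : (Fin m → ℕ) → ℚ),
      (∀ κ ∈ K, conjWeight κ ∈ K ∧ r (conjWeight κ) = r κ) ∧
      ∀ u : Fin m → ℝ, aeval (torusEntry u) p =
        ∑ κ ∈ K, (r κ : ℂ) * highestCharacter κ (torus u) := by
  classical
  obtain ⟨f, hf⟩ := Finsupp.mem_span_range_iff_exists_finsupp.1 (mem_span_highestCharacter p hsym hhom)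
  set K := f.support ∪ f.support.image conjWeight with hK
  have hval : ∀ u : Fin m → ℝ, aeval (torusEntry u) p =
      ∑ κ ∈ K, (f κ : ℂ) * highestCharacter κ (torus u) := by
    intro u
    have h1 := congrFun hf u
    rw [Finsupp.sum, Finset.sum_apply] at h1
    rw [← h1]
    refine (Finset.sum_subset Finset.subset_union_left fun κ _ hκ => ?_).trans
      (Finset.sum_congr rfl fun κ _ => ?_)
    · rw [Finsupp.notMem_support_iff.1 hκ, zero_smul]; rfl
    · rw [Pi.smul_apply, Algebra.smul_def]; rfl
  have hconj : ∀ κ ∈ K, conjWeight κ ∈ K := by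
    intro κ hκ
    rw [hK, Finset.mem_union, Finset.mem_image] at hκ ⊢
    rcases hκ with h | ⟨κ', h, rfl⟩
    · exact Or.inr ⟨κ, h, rfl⟩
    · left; rwa [conjWeight_conjWeight]
  -- Conjugating the expansion of a real value permutes the coefficients by conjugation of weights.
  -- The average of the two expansions is again an expansion, with symmetric coefficients, so
  -- uniqueness is not needed.
  refine ⟨K, fun κ => (f κ + f (conjWeight κ)) / 2, fun κ hκ => ⟨hconj κ hκ, ?_⟩, fun u => ?_⟩
  · simp only [conjWeight_conjWeight, add_comm]
  · have h2 : aeval (torusEntry u) p =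
        ∑ κ ∈ K, (f (conjWeight κ) : ℂ) * highestCharacter κ (torus u) := by
      rw [← hreal u, hval u, map_sum]
      refine Finset.sum_nbij' conjWeight conjWeight hconj hconj (fun κ _ => conjWeight_conjWeight κ)
        (fun κ _ => conjWeight_conjWeight κ) fun κ _ => ?_
      rw [map_mul, ← highestCharacter_conjWeight, conjWeight_conjWeight]
      simp
    have h3 : ∀ κ, (((f κ + f (conjWeight κ)) / 2 : ℚ) : ℂ) * highestCharacter κ (torus u) =
        ((f κ : ℂ) * highestCharacter κ (torus u) +
          (f (conjWeight κ) : ℂ) * highestCharacter κ (torus u)) / 2 := by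
      intro κ
      push_cast
      ring
    simp_rw [h3]
    rw [← Finset.sum_div, Finset.sum_add_distrib, ← hval, ← h2]
    ring

end Expansion

theorem torus_zero {m : ℕ} : torus (0 : Fin m → ℝ) = 1 := by
  apply Subtype.ext
  rw [torus_val, torusEntry_zero]
  exact Matrix.diagonal_one

theorem aeval_one_eq_eval {m : ℕ} {R : Type*} [CommRing R] [Algebra ℚ R]
    (p : MvPolynomial (Fin (m + 1)) ℚ) : MvPolynomial.aeval (fun _ => (1 : R)) p =
      algebraMap ℚ R (MvPolynomial.eval (fun _ => (1 : ℚ)) p) := by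
  have h := MvPolynomial.aeval_algebraMap_apply R (fun _ : Fin (m + 1) => (1 : ℚ)) p
  have e : MvPolynomial.aeval (fun _ : Fin (m + 1) => (1 : ℚ)) p =
      MvPolynomial.eval (fun _ => (1 : ℚ)) p := by
    rw [← MvPolynomial.coe_aeval_eq_eval]; rfl
  rw [e] at h
  simpa [Function.comp_def] using h

end Horn

end

/-! ### Assembly of the theorem. -/

theorem mainTheorem6 (m : ℕ) :
    ∃ (R : MvPolynomial (Fin (m + 1)) ℝ) (K : Finset (Fin m → ℕ)) (r : (Fin m → ℕ) → ℚ)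
      (χ : (Fin m → ℕ) → Horn.SU m → ℂ),
      -- the real polynomial `R` is symmetric, and `R_n(T) = D_n ϖ_n`
      R.IsSymmetric ∧
      (∀ u : Fin m → ℝ, Horn.Regular u → ∃ D : ℝ, Horn.HasLatticeSum u D ∧
        MvPolynomial.aeval (Horn.torusEntry u) R = ((D * Horn.varpi u : ℝ) : ℂ)) ∧
      -- expansion on irreducible characters, complex conjugate ones having the same coefficient
      (∀ κ ∈ K, Horn.IsIrreducibleCharacter κ (χ κ)) ∧
      (∀ κ ∈ K, Horn.conjWeight κ ∈ K ∧ r (Horn.conjWeight κ) = r κ) ∧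
      (∀ u : Fin m → ℝ, MvPolynomial.aeval (Horn.torusEntry u) R =
        ∑ κ ∈ K, (r κ : ℂ) * χ κ (Horn.torus u)) ∧
      -- normalization at the identity matrix
      MvPolynomial.eval (fun _ => (1 : ℝ)) R = 1 ∧
      ∑ κ ∈ K, (r κ : ℂ) * χ κ 1 = 1 ∧
      -- compactification of the integrals
      ∀ wl wm wn : Fin (m + 1) → ℤ, Horn.Compatible wl wm wn →
        ∀ P P' P'' : Equiv.Perm (Fin (m + 1)), ∀ A : Fin m → ℝ,
          A = Horn.expA
            (fun i => (Horn.young (wl + Horn.weylVector m) i : ℝ))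
            (fun i => (Horn.young (wm + Horn.weylVector m) i : ℝ))
            (fun i => (Horn.young (wn + Horn.weylVector m) i : ℝ)) P P' P'' →
          ∃ w : ℂ,
            Horn.HasCompactPV (fun u => Horn.planeWave A u *
              (MvPolynomial.aeval (Horn.torusEntry u) R / Horn.vandExp u)) w ∧
            Horn.HasPV (fun u => Horn.planeWave A u / (Horn.vandU u : ℂ))
              (Complex.I ^ ((m + 1) * m / 2) * w) := by
  obtain ⟨N, R, hsym, hhom, hsum, hone, hreal, hlat, hnorm⟩ := Horn.exists_core m
  obtain ⟨K, r, hK, hexp⟩ := Horn.exists_character_expansion hsym hhom hreal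
  have haeval : ∀ u : Fin m → ℝ, MvPolynomial.aeval (Horn.torusEntry u)
      (MvPolynomial.map (algebraMap ℚ ℝ) R) = MvPolynomial.aeval (Horn.torusEntry u) R :=
    fun u => MvPolynomial.aeval_map_algebraMap ℝ _ _
  refine ⟨MvPolynomial.map (algebraMap ℚ ℝ) R, K, r, Horn.highestCharacter, hsym.map _,
    fun u hu => ?_, fun κ _ => Horn.isIrreducibleCharacter_highestCharacter κ, hK, fun u => ?_, ?_, ?_,
    ?_⟩
  · rw [haeval]
    exact hlat u hu
  · rw [haeval]
    exact hexp u
  · rw [MvPolynomial.eval_map, ← MvPolynomial.aeval_def, Horn.aeval_one_eq_eval, hnorm, map_one]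
  -- At u = 0 the torus element is the identity, so the character expansion there is the
  -- normalization.
  · have h := hexp 0
    rw [Horn.torus_zero, Horn.torusEntry_zero, Horn.aeval_one_eq_eval, hnorm, map_one] at h
    exact h.symm
  · rintro wl wm wn hcomp P P' P'' A rfl
    simp_rw [haeval]
    exact Horn.exists_compactPV (Horn.alternatingWave_planeWave hcomp P P' P'') hsum hone
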